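/- Let $\Lambda\subset\mathbb C$ be a lattice, let $\wp$ and $\sigma$ be its Weierstrass functions, $\zeta=\sigma'/\sigma$, and let $\wp(x)=x^{-2}+\sum_{n\ge 0}a_nx^n$ be the Laurent expansion at $x=0$. For $k\notin\Lambda$, $x\in\mathbb C\setminus\Lambda$ and $t=(t_2,t_3,\dots)$ put $$\Phi(x;k)=\frac{\sigma(x+k)}{\sigma(x)}e^{-\zeta(k)x},\qquad \Psi(x,t;k)=\Phi(x;k)\exp\Big[\sum_{j\ge0}\Big(\frac{\wp^{(j)}(k)}{(j+1)!}-\frac{a_j}{j+1}\Big)t_{j+2}\Big].$$ Let $\mathcal A$ be the ring of holomorphic functions on $\mathbb C\setminus\Lambda$ and $\mathcal E$ the ring of formal pseudo-differential operators $\sum_{n\le N}p_n\partial_x^n$, $p_n\in\mathcal A$, with the generalized Leibniz product; $(P)_{\ge0}$ and $(P)_{<0}$ denote the parts of $P\in\mathcal E$ of non-negative and of negative order. It acts on formal series $(\sum_{j\le N}f_j\lambda^j)e^{\xi}$, $f_j\in\mathcal A$, where $\xi(x,t;\lambda)=\lambda x+\sum_{j\ge2}\lambda^jt_j$, through $\partial_x(f\lambda^je^\xi)=(f'\lambda^j+f\lambda^{j+1})e^\xi$;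 on these $\partial_{t_n}\big((\sum_j f_j\lambda^j)e^\xi\big)=\big(\sum_j(\partial_{t_n}f_j)\lambda^j+\sum_jf_j\lambda^{j+n}\big)e^\xi$ if the $f_j$ depend on $t$. Let $v_{0,n}(x)$ and $c_n(t)$ be the coefficients of the expansions at $\lambda=\infty$ $$\frac{\sigma(x-\lambda^{-1})}{\sigma(x)}e^{(\zeta(\lambda^{-1})-\lambda)x}=1+\sum_{n\ge1}v_{0,n}(x)\lambda^{-n},\qquad \exp\Big[\sum_{j\ge0}\omega_{j+2}(\lambda)t_{j+2}\Big]=1+\sum_{n\ge1}c_n(t)\lambda^{-n},$$ $$\omega_{j+2}(\lambda)=\sum_{m\ge1}\frac{(-1)^m(m+j)!}{m!\,(j+1)!}a_{m+j}\lambda^{-m},$$ and put $V_0=1+\sum_{n\ge1}v_{0,n}(x)\partial_x^{-n}$, $C(t)=1+\sum_{n\ge1}c_n(t)\partial_x^{-n}$, $L_0=V_0\partial_xV_0^{-1}$. Let $T$ be the set of all $t$ for which $\sum_j|t_j|r^j<\infty$ for every $r>0$; for $t\in T$ the series $\xi$ converges for all $\lambda$. Then every $v_{0,n}$ is holomorphic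 on $\mathbb C\setminus\Lambda$, $V_0$ is invertible in $\mathcal E$, $L_0=\partial_x+u_2\partial_x^{-1}+u_3\partial_x^{-2}+\cdots$, and for $t\in T$ and $k\notin\Lambda$ the series defining $\Psi(x,t;k)$ converges. Moreover: (1) For every $k\notin\Lambda$ and every $t$ for which the series defining $\Psi(x,t;k)$ converges absolutely, $\Psi(x,t;k)$ is holomorphic in $x\in\mathbb C\setminus\Lambda$ and $\partial_{t_n}\Psi=(L_0^n)_{\ge0}\Psi$ for all $n\ge1$, where $t_1=x$. That is, $\Psi$ is an eigenfunction of $L_0$. (2) Let $t\in T$. If $\lambda\ne0$ and $|\lambda^{-1}|<|l|$ for all $l\in\Lambda\setminus\{0\}$, then $\Psi(x,t;-\lambda^{-1})=V_0C(t)e^{\xi(x,t;\lambda)}$, where the right-hand side, of the form $(1+\sum_{n\ge1}v_n(x,t)\lambda^{-n})e^{\xi}$, converges. The formal series $\psi=V_0C(t)e^\xi$ is a wave function of $L_0$ with eigenvalue $\lambda=-k^{-1}$: $L_0\psi=\lambda\psi$ and $\partial_{t_n}\psi=(L_0^n)_{\ge0}\psi$ for all $n\ge1$. (3) Consequently $V=V_0C(t)$,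 $t\in T$, is a wave operator for $L_0$: it has the form $1+\sum_{n\ge1}v_n\partial_x^{-n}$, is invertible, $\psi=Ve^\xi$, $L_0=V\partial_xV^{-1}$, and $\partial_{t_n}V=(L_0^n)_{\ge0}V-V\partial_x^n=-(V\partial_x^nV^{-1})_{<0}V$ for all $n\ge2$. -/

import Mathlib

noncomputable section

/-! ### Formal pseudo-differential operators over a commutative differential ring -/

/-- Coefficients of the generalized Leibniz rule
`(∑ₙ pₙ ∂ⁿ) (∑ₘ qₘ ∂ᵐ) = ∑ₙₘ ∑_{r ≥ 0} (n choose r) pₙ ∂ʳ(qₘ) ∂^{n+m-r}`: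
the coefficient of `∂ᵏ`, where `m = k - n + r`. -/
def leibnizCoeff {A : Type*} [CommRing A] [Differential A] (p q : ℤ → A) (k : ℤ) : A :=
  ∑ᶠ nr : ℤ × ℕ, Ring.choose nr.1 nr.2 •
    (p nr.1 * (⇑(Differential.deriv (R := A)))^[nr.2] (q (k - nr.1 + nr.2)))

theorem leibniz_term_eq_zero {A : Type*} [CommRing A] [Differential A] {p q : ℤ → A} {N M : ℤ}
    (hp : ∀ n, N < n → p n = 0) (hq : ∀ n, M < n → q n = 0) (k : ℤ) (nr : ℤ × ℕ)
    (h : N < nr.1 ∨ M < k - nr.1 + nr.2) :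
    Ring.choose nr.1 nr.2 •
      (p nr.1 * (⇑(Differential.deriv (R := A)))^[nr.2] (q (k - nr.1 + nr.2))) = 0 := by
  rcases h with h | h
  · simp [hp _ h]
  · rw [hq _ h, Function.iterate_fixed (map_zero _)]
    simp

/-- For operators of finite order the sum in `leibnizCoeff` has only finitely many nonzero
terms. -/
theorem leibniz_support_finite {A : Type*} [CommRing A] [Differential A] {p q : ℤ → A} {N M : ℤ}
    (hp : ∀ n, N < n → p n = 0) (hq : ∀ n, M < n → q n = 0) (k : ℤ) :
    (Function.support fun nr : ℤ × ℕ => Ring.choose nr.1 nr.2 •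
      (p nr.1 * (⇑(Differential.deriv (R := A)))^[nr.2] (q (k - nr.1 + nr.2)))).Finite := by
  refine ((Set.finite_Icc (k - M) N).prod (Set.finite_Iic (M - k + N).toNat)).subset ?_
  intro nr h
  by_contra hc
  apply h
  apply leibniz_term_eq_zero hp hq
  by_contra h'
  push Not at h'
  apply hc
  simp only [Set.mem_prod, Set.mem_Icc, Set.mem_Iic]
  omega

theorem leibnizCoeff_bdd {A : Type*} [CommRing A] [Differential A] {p q : ℤ → A}
    (hp : ∃ N : ℤ, ∀ n, N < n → p n = 0) (hq : ∃ M : ℤ, ∀ n, M < n → q n = 0) :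
    ∃ K : ℤ, ∀ k, K < k → leibnizCoeff p q k = 0 := by
  obtain ⟨N, hN⟩ := hp
  obtain ⟨M, hM⟩ := hq
  refine ⟨N + M, fun k hk => ?_⟩
  apply finsum_eq_zero_of_forall_eq_zero
  intro nr
  apply leibniz_term_eq_zero hN hM
  omega

/-- A formal pseudo-differential operator `∑_{-∞ < n ≪ +∞} aₙ ∂ⁿ` with coefficients in `A`. -/
@[ext]
structure PseudoDiffOp (A : Type*) [CommRing A] where
  coeff : ℤ → A
  bdd : ∃ N : ℤ, ∀ n, N < n → coeff n = 0

/-- An element `(∑_{-∞ < j ≪ +∞} aⱼ λʲ) e^ξ` of the module of formal Baker-Akhiezer functions. -/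
@[ext]
structure FormalWave (A : Type*) [CommRing A] where
  coeff : ℤ → A
  bdd : ∃ N : ℤ, ∀ n, N < n → coeff n = 0

namespace PseudoDiffOp

/-- The operator `∂ᵏ`. -/
def D {A : Type*} [CommRing A] (k : ℤ) : PseudoDiffOp A where
  coeff n := if n = k then 1 else 0
  bdd := ⟨k, fun n hn => if_neg (by omega)⟩

/-- The operator `1 + w₁ ∂⁻¹ + w₂ ∂⁻² + ⋯` (the value `w 0` is not used). -/
def monic {A : Type*} [CommRing A] (w : ℕ → A) : PseudoDiffOp A where
  coeff n := if n = 0 then 1 else if n < 0 then w (-n).toNat else 0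
  bdd := ⟨0, fun n hn => by rw [if_neg (by omega), if_neg (by omega)]⟩

instance {A : Type*} [CommRing A] : One (PseudoDiffOp A) := ⟨D 0⟩

instance {A : Type*} [CommRing A] : Neg (PseudoDiffOp A) :=
  ⟨fun P => ⟨fun n => -P.coeff n, by
    obtain ⟨N, hN⟩ := P.bdd
    exact ⟨N, fun n hn => by rw [hN n hn, neg_zero]⟩⟩⟩

instance {A : Type*} [CommRing A] : Sub (PseudoDiffOp A) :=
  ⟨fun P Q => ⟨fun n => P.coeff n - Q.coeff n, by
    obtain ⟨N, hN⟩ := P.bdd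
    obtain ⟨M, hM⟩ := Q.bdd
    exact ⟨max N M, fun n hn => by
      rw [hN n (lt_of_le_of_lt (le_max_left _ _) hn),
        hM n (lt_of_le_of_lt (le_max_right _ _) hn), sub_zero]⟩⟩⟩

instance {A : Type*} [CommRing A] [Differential A] : Mul (PseudoDiffOp A) :=
  ⟨fun P Q => ⟨leibnizCoeff P.coeff Q.coeff, leibnizCoeff_bdd P.bdd Q.bdd⟩⟩

instance {A : Type*} [CommRing A] [Differential A] : Pow (PseudoDiffOp A) ℕ :=
  ⟨fun P n => npowRec n P⟩

/-- `Q` is a two-sided inverse of `P`. -/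
def IsInverse {A : Type*} [CommRing A] [Differential A] (P Q : PseudoDiffOp A) : Prop :=
  P * Q = 1 ∧ Q * P = 1

open Classical in
/-- The two-sided inverse of an invertible operator (and `1` if there is none). -/
instance {A : Type*} [CommRing A] [Differential A] : Inv (PseudoDiffOp A) :=
  ⟨fun P => if h : ∃ Q, IsInverse P Q then h.choose else 1⟩

/-- The projection `(P)_{≥ 0}` to differential operators. -/
def nonneg {A : Type*} [CommRing A] (P : PseudoDiffOp A) : PseudoDiffOp A where
  coeff n := if 0 ≤ n then P.coeff n else 0
  bdd := by
    obtain ⟨N, hN⟩ := P.bdd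
    exact ⟨N, fun n hn => by rw [hN n hn, ite_self]⟩

/-- The projection `(P)_{< 0}` to operators of negative order. -/
def negPart {A : Type*} [CommRing A] (P : PseudoDiffOp A) : PseudoDiffOp A where
  coeff n := if n < 0 then P.coeff n else 0
  bdd := by
    obtain ⟨N, hN⟩ := P.bdd
    exact ⟨N, fun n hn => by rw [hN n hn, ite_self]⟩

/-- `P` has the form `1 + w₁ ∂⁻¹ + w₂ ∂⁻² + ⋯`. -/
def IsMonicOrderZero {A : Type*} [CommRing A] (P : PseudoDiffOp A) : Prop :=
  P.coeff 0 = 1 ∧ ∀ n, 0 < n → P.coeff n = 0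

/-- `P` has the form `∂ + u₂ ∂⁻¹ + u₃ ∂⁻² + ⋯`. -/
def IsLaxForm {A : Type*} [CommRing A] (P : PseudoDiffOp A) : Prop :=
  P.coeff 1 = 1 ∧ P.coeff 0 = 0 ∧ ∀ n, 1 < n → P.coeff n = 0

end PseudoDiffOp

namespace FormalWave

/-- The element `e^ξ`. -/
def expXi {A : Type*} [CommRing A] : FormalWave A where
  coeff n := if n = 0 then 1 else 0
  bdd := ⟨0, fun n hn => if_neg (by omega)⟩

/-- Multiplication by the spectral parameter `λ`. -/
def mulLambda {A : Type*} [CommRing A] (F : FormalWave A) : FormalWave A where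
  coeff n := F.coeff (n - 1)
  bdd := by
    obtain ⟨N, hN⟩ := F.bdd
    exact ⟨N + 1, fun n hn => hN _ (by omega)⟩

/-- The action of pseudo-differential operators determined by
`∂ (a λʲ e^ξ) = (∂(a) λʲ + a λʲ⁺¹) e^ξ`, that is
`p ∂ⁿ (a λʲ e^ξ) = ∑_{r ≥ 0} (n choose r) p ∂ʳ(a) λ^{j+n-r} e^ξ`. -/
instance {A : Type*} [CommRing A] [Differential A] : SMul (PseudoDiffOp A) (FormalWave A) :=
  ⟨fun P F => ⟨leibnizCoeff P.coeff F.coeff, leibnizCoeff_bdd P.bdd F.bdd⟩⟩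

end FormalWave

/-! ### The differential ring of holomorphic functions on an open subset of `ℂ` -/

/-- Holomorphic functions on `U`. -/
def HolFun (U : TopologicalSpace.Opens ℂ) : Subalgebra ℂ (U → ℂ) where
  carrier := {f | ∃ g : ℂ → ℂ, DifferentiableOn ℂ g U ∧ ∀ x : U, f x = g x}
  mul_mem' := by
    rintro f f' ⟨g, hg, h⟩ ⟨g', hg', h'⟩
    exact ⟨g * g', hg.mul hg', fun x => by simp [h, h']⟩
  add_mem' := by
    rintro f f' ⟨g, hg, h⟩ ⟨g', hg', h'⟩
    exact ⟨g + g', hg.add hg', fun x => by simp [h, h']⟩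
  algebraMap_mem' c := ⟨fun _ => c, differentiableOn_const c, fun _ => rfl⟩

namespace HolFun

variable {U : TopologicalSpace.Opens ℂ}

open Classical in
/-- Extension by zero to `ℂ`. -/
def ext0 (f : U → ℂ) (x : ℂ) : ℂ := if h : x ∈ U then f ⟨x, h⟩ else 0

theorem ext0_coe (f : U → ℂ) (x : U) : ext0 f x = f x := by
  simp [ext0]

theorem differentiableOn_ext0 (f : HolFun U) : DifferentiableOn ℂ (ext0 f.1) U := by
  obtain ⟨g, hg, h⟩ := f.2
  refine hg.congr fun x hx => ?_
  exact (ext0_coe f.1 ⟨x, hx⟩).trans (h ⟨x, hx⟩)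

theorem differentiableAt_ext0 (f : HolFun U) (x : U) :
    DifferentiableAt ℂ (ext0 f.1) x :=
  (differentiableOn_ext0 f).differentiableAt (U.isOpen.mem_nhds x.2)

/-- The complex derivative, as a derivation of the ring of holomorphic functions. -/
instance : Differential (HolFun U) where
  deriv := Derivation.mk'
    { toFun := fun f => ⟨fun x => deriv (ext0 f.1) x,
        deriv (ext0 f.1), (differentiableOn_ext0 f).deriv U.isOpen, fun _ => rfl⟩
      map_add' := fun f g => by
        apply Subtype.ext
        funext x
        have h : ext0 (f + g).1 = ext0 f.1 + ext0 g.1 := by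
          funext y
          by_cases hy : y ∈ U <;> simp [ext0, hy]
        change deriv (ext0 (f + g).1) x = deriv (ext0 f.1) x + deriv (ext0 g.1) x
        rw [h]
        exact deriv_add (differentiableAt_ext0 f x) (differentiableAt_ext0 g x)
      map_smul' := fun n f => by
        apply Subtype.ext
        funext x
        have h : ext0 (n • f).1 = fun y => (n : ℂ) * ext0 f.1 y := by
          funext y
          by_cases hy : y ∈ U <;> simp [ext0, hy]
        change deriv (ext0 (n • f).1) x = n • deriv (ext0 f.1) x
        rw [h, deriv_const_mul _ (differentiableAt_ext0 f x), zsmul_eq_mul] }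
    (fun f g => by
      apply Subtype.ext
      funext x
      have h : ext0 (f * g).1 = ext0 f.1 * ext0 g.1 := by
        funext y
        by_cases hy : y ∈ U <;> simp [ext0, hy]
      change deriv (ext0 (f * g).1) x
        = f.1 x * deriv (ext0 g.1) x + g.1 x * deriv (ext0 f.1) x
      rw [h, deriv_mul (differentiableAt_ext0 f x) (differentiableAt_ext0 g x),
        ext0_coe, ext0_coe]
      ring)

theorem deriv_apply (f : HolFun U) (x : U) :
    (Differential.deriv f).1 x = deriv (ext0 f.1) x := rfl

open Classical in
/-- The element of `HolFun U` given by a function that is holomorphic on `U`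
(and `0` if the function is not holomorphic on `U`). -/
def ofFun (U : TopologicalSpace.Opens ℂ) (g : ℂ → ℂ) : HolFun U :=
  if h : DifferentiableOn ℂ g U then ⟨fun x => g x, g, h, fun _ => rfl⟩ else 0

end HolFun

/-- The differential operator `(P)_{≥ 0} = ∑_{i ≥ 0} bᵢ(x) ∂ⁱ` applied to a function `f`, at the
point `x`. Only finitely many `bᵢ` are nonzero. -/
def PseudoDiffOp.applyNonneg {U : TopologicalSpace.Opens ℂ} (P : PseudoDiffOp (HolFun U))
    (f : ℂ → ℂ) (x : U) : ℂ :=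
  ∑ᶠ i : ℕ, (P.nonneg.coeff (i : ℤ)).1 x * iteratedDeriv i f x

namespace PeriodPair

/-! ### Weierstrass functions and the Lamé function -/

/-- The Weierstrass `σ`-function. -/
def sigma (L : PeriodPair) (z : ℂ) : ℂ :=
  z * ∏' l : {l : L.lattice // l ≠ 0},
    (1 - z / (l : ℂ)) * Complex.exp (z / (l : ℂ) + z ^ 2 / (2 * (l : ℂ) ^ 2))

/-- The Weierstrass `ζ`-function `σ' / σ`. -/
def zeta (L : PeriodPair) (z : ℂ) : ℂ := deriv L.sigma z / L.sigma z

/-- The coefficients of the Laurent expansion `℘(x) = x⁻² + ∑ₙ aₙ xⁿ` at `x = 0`;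
`weierstrassPExcept 0` is `℘(x) - x⁻²`. -/
def laurentCoeff (L : PeriodPair) (n : ℕ) : ℂ :=
  iteratedDeriv n (L.weierstrassPExcept 0) 0 / (n.factorial : ℂ)

/-- The Lamé function `Φ(x; k)`. -/
def lamePhi (L : PeriodPair) (x k : ℂ) : ℂ :=
  L.sigma (x + k) / L.sigma x * Complex.exp (-L.zeta k * x)

/-- The coefficient `℘⁽ʲ⁾(k) / (j+1)! - aⱼ / (j+1)` of `t_{j+2}`. -/
def timeCoeff (L : PeriodPair) (k : ℂ) (j : ℕ) : ℂ :=
  iteratedDeriv j L.weierstrassP k / ((j + 1).factorial : ℂ) - L.laurentCoeff j / ((j : ℂ) + 1)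

/-- The function `Ψ(x, t; k)`. Here and below `t j` stands for the time variable `t_{j+2}`. -/
def wavePsi (L : PeriodPair) (x : ℂ) (t : ℕ → ℂ) (k : ℂ) : ℂ :=
  L.lamePhi x k * Complex.exp (∑' j : ℕ, L.timeCoeff k j * t j)

/-- The complement of the lattice, in which `x` varies. -/
def domain (L : PeriodPair) : TopologicalSpace.Opens ℂ :=
  ⟨(L.lattice : Set ℂ)ᶜ, L.isClosed_lattice.isOpen_compl⟩

/-- The function `z ↦ v̂₀(x; 1/z) = σ(x - z) / σ(x) · exp((ζ(z) - 1/z) x)`, where `z = 1/λ`.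
It is regular at `z = 0` with value `1`, which is also its value there in Lean,
as `ζ 0 = 0` and `1 / 0 = 0` by convention. -/
def vHat0 (L : PeriodPair) (x z : ℂ) : ℂ :=
  L.sigma (x - z) / L.sigma x * Complex.exp ((L.zeta z - 1 / z) * x)

/-- The coefficient `v_{0,n}(x)` of `λ⁻ⁿ` in `v̂₀(x; λ)`. -/
def v0 (L : PeriodPair) (n : ℕ) (x : ℂ) : ℂ :=
  iteratedDeriv n (L.vHat0 x) 0 / (n.factorial : ℂ)

/-- `V₀ = 1 + ∑_{n ≥ 1} v_{0,n}(x) ∂⁻ⁿ`. -/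
def opV0 (L : PeriodPair) : PseudoDiffOp (HolFun L.domain) :=
  PseudoDiffOp.monic fun n => HolFun.ofFun L.domain (L.v0 n)

/-- `L₀ = V₀ ∂ V₀⁻¹`. -/
def opL0 (L : PeriodPair) : PseudoDiffOp (HolFun L.domain) :=
  L.opV0 * PseudoDiffOp.D 1 * L.opV0⁻¹

/-- `ω_{j+2}(λ) = ∑_{m ≥ 1} (-1)ᵐ (m+j)! / (m! (j+1)!) a_{m+j} λ⁻ᵐ` as a function of `z = 1/λ`. -/
def omega (L : PeriodPair) (j : ℕ) (z : ℂ) : ℂ :=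
  ∑' i : ℕ, (-1) ^ (i + 1) * ((i + 1 + j).factorial : ℂ) /
    (((i + 1).factorial : ℂ) * ((j + 1).factorial : ℂ)) * L.laurentCoeff (i + 1 + j) * z ^ (i + 1)

/-- The coefficient `cₙ(t)` of `λ⁻ⁿ` in `exp (∑ⱼ ω_{j+2}(λ) t_{j+2})`. -/
def cCoeff (L : PeriodPair) (t : ℕ → ℂ) (n : ℕ) : ℂ :=
  iteratedDeriv n (fun z => Complex.exp (∑' j : ℕ, L.omega j z * t j)) 0 / (n.factorial : ℂ)

/-- `C(t; ∂) = 1 + c₁(t) ∂⁻¹ + c₂(t) ∂⁻² + ⋯`. -/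
def opC (L : PeriodPair) (t : ℕ → ℂ) : PseudoDiffOp (HolFun L.domain) :=
  PseudoDiffOp.monic fun n => algebraMap ℂ (HolFun L.domain) (L.cCoeff t n)

end PeriodPair

/-! ### Wave functions and wave operators -/

/-- The sequences of times `t = (t₂, t₃, …)` for which `ξ(x, t; λ)` converges (absolutely) for
every `λ`. Every finitely supported sequence is of this kind. -/
def entireTimes : Set (ℕ → ℂ) := {t | ∀ r : ℝ, Summable fun j => ‖t j‖ * r ^ j}

/-- `ξ(x, t; λ) = λ x + ∑_{j ≥ 2} λʲ tⱼ`. -/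
def xiPhase (x : ℂ) (t : ℕ → ℂ) (lam : ℂ) : ℂ :=
  lam * x + ∑' j : ℕ, lam ^ (j + 2) * t j

/-- `∂P / ∂t_{j+2} = Q` at `t`, coefficientwise, for an operator `P` depending on `t`. -/
def HasOpTimeDerivAt {U : TopologicalSpace.Opens ℂ} (P : (ℕ → ℂ) → PseudoDiffOp (HolFun U))
    (Q : PseudoDiffOp (HolFun U)) (j : ℕ) (t : ℕ → ℂ) : Prop :=
  ∀ (m : ℤ) (x : U),
    HasDerivAt (fun s : ℂ => ((P (t + Pi.single j s)).coeff m).1 x) ((Q.coeff m).1 x) 0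

/-- `∂F / ∂t_{j+2} = G` at `t` for formal Baker-Akhiezer functions, where
`∂((∑ₘ aₘ λᵐ) e^ξ) / ∂tₙ = (∑ₘ (∂aₘ/∂tₙ) λᵐ + ∑ₘ aₘ λ^{m+n}) e^ξ`. -/
def HasWaveTimeDerivAt {U : TopologicalSpace.Opens ℂ} (F : (ℕ → ℂ) → FormalWave (HolFun U))
    (G : FormalWave (HolFun U)) (j : ℕ) (t : ℕ → ℂ) : Prop :=
  ∀ (m : ℤ) (x : U), ∃ a' : ℂ,
    HasDerivAt (fun s : ℂ => ((F (t + Pi.single j s)).coeff m).1 x) a' 0 ∧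
      (G.coeff m).1 x = a' + ((F t).coeff (m - ((j : ℤ) + 2))).1 x

/-- `ψ = (1 + ∑_{j ≥ 1} wⱼ λ⁻ʲ) e^ξ` is a wave function of the (time-independent) operator `Lax`:
it has this form, `Lax ψ = λ ψ`, and `∂ψ/∂tₙ = (Laxⁿ)_{≥ 0} ψ` for all `n ≥ 1`,
where `t₁ = x`. -/
structure IsWaveFunction {U : TopologicalSpace.Opens ℂ} (Lax : PseudoDiffOp (HolFun U))
    (ψ : (ℕ → ℂ) → FormalWave (HolFun U)) : Prop where
  coeff_zero : ∀ t ∈ entireTimes, (ψ t).coeff 0 = 1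
  coeff_pos : ∀ t ∈ entireTimes, ∀ n, 0 < n → (ψ t).coeff n = 0
  eigen : ∀ t ∈ entireTimes, Lax • ψ t = (ψ t).mulLambda
  deriv_x : ∀ t ∈ entireTimes,
    (PseudoDiffOp.D 1 : PseudoDiffOp (HolFun U)) • ψ t = (Lax ^ 1).nonneg • ψ t
  deriv_t : ∀ t ∈ entireTimes, ∀ j : ℕ,
    HasWaveTimeDerivAt ψ ((Lax ^ (j + 2)).nonneg • ψ t) j t

/-- `W = 1 + ∑_{j ≥ 1} wⱼ ∂⁻ʲ` is a wave operator of `Lax` with wave function `ψ`: `ψ = W e^ξ`,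
`Lax = W ∂ W⁻¹`, and the Sato-Wilson equation
`∂W/∂tₙ = Bₙ W - W ∂ⁿ = -(W ∂ⁿ W⁻¹)_{< 0} W`, `Bₙ = (Laxⁿ)_{≥ 0}`, holds for all `n ≥ 2`. -/
structure IsWaveOperator {U : TopologicalSpace.Opens ℂ} (Lax : PseudoDiffOp (HolFun U))
    (ψ : (ℕ → ℂ) → FormalWave (HolFun U)) (W : (ℕ → ℂ) → PseudoDiffOp (HolFun U)) : Prop where
  monic : ∀ t ∈ entireTimes, (W t).IsMonicOrderZero
  wave : ∀ t ∈ entireTimes, ψ t = W t • FormalWave.expXi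
  inverse : ∀ t ∈ entireTimes, PseudoDiffOp.IsInverse (W t) (W t)⁻¹
  dressing : ∀ t ∈ entireTimes, Lax = W t * PseudoDiffOp.D 1 * (W t)⁻¹
  sato_wilson : ∀ t ∈ entireTimes, ∀ j : ℕ, HasOpTimeDerivAt W
    ((Lax ^ (j + 2)).nonneg * W t - W t * PseudoDiffOp.D ((j : ℤ) + 2)) j t
  sato_wilson_neg : ∀ t ∈ entireTimes, ∀ j : ℕ, HasOpTimeDerivAt W
    (-((W t * PseudoDiffOp.D ((j : ℤ) + 2) * (W t)⁻¹).negPart * W t)) j t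

/-- The formal Baker-Akhiezer function `V₀ C e^ξ`. -/
def PeriodPair.formalPsi (L : PeriodPair) (t : ℕ → ℂ) : FormalWave (HolFun L.domain) :=
  L.opV0 • (L.opC t • FormalWave.expXi)

end

/-! ### Combinatorics of the generalized Leibniz rule -/

noncomputable section

open Finset

section FormalAlgebra

variable {A : Type*} [CommRing A] [Differential A]

local notation "𝒟" => @Differential.deriv A _ _

/-! The algebraic half is a dressing argument. Let V be monic of order zero and L = V∂V⁻¹, and
suppose that (Lⁿ)_{≥0} V = V(∂ⁿ + Ω_n) and ∂C/∂t_n = Ω_n C, where Ω_n and C(t) have constant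
coefficients. Since C commutes with ∂, L = (VC)∂(VC)⁻¹ and (Lⁿ)_{≥0} VC = VΩ_nC + VC∂ⁿ = ∂(VC)/∂t_n
+ VC∂ⁿ, which is the Sato-Wilson equation (`isWaveFunction_dressing`, `isWaveOperator_dressing`).
With Ω_n = ω_n(∂⁻¹) and C the exponential of ∑ t_n Ω_n, the equation for C is immediate, so
everything rests on `nonneg_mul_opV0`: (L₀ⁿ)_{≥0} V₀ = V₀(∂ⁿ + ω_n(∂⁻¹)).

This identity is proved by complex analysis in the spectral parameter. With z = 1/λ one has Φ(x;-z)
= v̂₀(x,z) e^{x/z}, so V₀ has the convergent symbol v̂₀, and the coefficient of t_n in the exponent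
of Ψ at k = -z is z⁻ⁿ + ω_n. Hence the operator identity says, near k = 0, that (L₀ⁿ)_{≥0} Φ equals
this coefficient times Φ (`nonneg_mul_opSeries_sub`, `pow_mul_residual_neg`).

Fix x and let R(k) be the difference of the two sides. From L₀ⁿV₀ = V₀∂ⁿ the operator difference
equals -(L₀ⁿ)_{<0}V₀ - V₀ω_n(∂⁻¹), of negative order; so its symbol vanishes to order n+1 at z = 0
(`taylorCoeff_defect_eq_zero`), and R/Φ extends to k = 0 with value 0. Translating k by a period
multiplies Φ by a factor independent of x, so R/Φ is elliptic in k; its only possible pole modulo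
periods is the simple zero k = -x of Φ. An elliptic function with at most one simple pole is
constant (`IsAlmostPeriodic.exists_eq_const_of_simple_pole`), so R = 0 for all k
(`residual_eq_zero`). This is the eigenfunction property of Φ, hence of Ψ, and read back near z = 0
it is the operator identity.

The convergence statements come from Cauchy estimates: the coefficients of the times grow at most
geometrically, which the times in `entireTimes` absorb. -/

theorem deriv_iterate_add (n : ℕ) (f g : A) : (⇑𝒟)^[n] (f + g) = (⇑𝒟)^[n] f + (⇑𝒟)^[n] g :=
  iterate_map_add (Differential.deriv (R := A)) n f g

theorem deriv_iterate_zero (n : ℕ) : (⇑𝒟)^[n] (0 : A) = 0 :=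
  iterate_map_zero (Differential.deriv (R := A)) n

theorem deriv_iterate_zsmul (n : ℕ) (c : ℤ) (f : A) : (⇑𝒟)^[n] (c • f) = c • (⇑𝒟)^[n] f := by
  induction n with
  | zero => rfl
  | succ n ih => rw [Function.iterate_succ_apply', Function.iterate_succ_apply', ih, map_zsmul]

theorem deriv_iterate_sum {ι : Type*} (n : ℕ) (s : Finset ι) (f : ι → A) :
    (⇑𝒟)^[n] (∑ i ∈ s, f i) = ∑ i ∈ s, (⇑𝒟)^[n] (f i) := by
  classical
  induction s using Finset.induction_on with
  | empty => simp
  | insert i s hi ih => rw [sum_insert hi, sum_insert hi, deriv_iterate_add, ih]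

theorem deriv_iterate_mul (n : ℕ) (f g : A) :
    (⇑𝒟)^[n] (f * g) = ∑ ij ∈ antidiagonal n, (n.choose ij.1) • ((⇑𝒟)^[ij.1] f * (⇑𝒟)^[ij.2] g) := by
  induction n with
  | zero => simp
  | succ n ih =>
    rw [sum_antidiagonal_choose_succ_nsmul fun i j => (⇑𝒟)^[i] f * (⇑𝒟)^[j] g,
      Function.iterate_succ_apply', ih, map_sum, ← sum_add_distrib]
    refine sum_congr rfl fun ij hij => ?_
    rw [map_nsmul, Derivation.leibniz, smul_add, smul_eq_mul, smul_eq_mul,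
      Function.iterate_succ_apply', Function.iterate_succ_apply']
    have : n.choose ij.1 = n.choose ij.2 :=
      (Nat.choose_symm_of_eq_add (HasAntidiagonal.mem_antidiagonal.mp hij).symm)
    rw [← this]
    simp only [mul_comm]

theorem sum_antidiagonal_assoc {M : Type*} [AddCommMonoid M] (n : ℕ) (f : ℕ → ℕ → ℕ → M) :
    ∑ sj ∈ antidiagonal n, ∑ uv ∈ antidiagonal sj.1, f uv.1 uv.2 sj.2 =
      ∑ ui ∈ antidiagonal n, ∑ vj ∈ antidiagonal ui.2, f ui.1 vj.1 vj.2 := by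
  rw [sum_sigma', sum_sigma']
  refine sum_nbij' (fun x => ⟨(x.2.1, x.2.2 + x.1.2), (x.2.2, x.1.2)⟩)
    (fun x => ⟨(x.1.1 + x.2.1, x.2.2), (x.1.1, x.2.1)⟩) ?_ ?_ ?_ ?_ ?_
  · rintro ⟨⟨a, b⟩, c, d⟩ h
    simp only [mem_sigma, HasAntidiagonal.mem_antidiagonal] at h ⊢
    refine ⟨?_, ?_⟩ <;> first | omega | trivial
  · rintro ⟨⟨a, b⟩, c, d⟩ h
    simp only [mem_sigma, HasAntidiagonal.mem_antidiagonal] at h ⊢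
    refine ⟨?_, ?_⟩ <;> first | omega | trivial
  · rintro ⟨⟨a, b⟩, c, d⟩ h
    simp only [mem_sigma, HasAntidiagonal.mem_antidiagonal] at h
    obtain ⟨rfl, rfl⟩ := h
    rfl
  · rintro ⟨⟨a, b⟩, c, d⟩ h
    simp only [mem_sigma, HasAntidiagonal.mem_antidiagonal] at h
    obtain ⟨rfl, rfl⟩ := h
    rfl
  · rintro ⟨⟨a, b⟩, c, d⟩ _
    rfl

/-- This is associativity of the Leibniz product for three monomials. Expanding the derivative of
the product and using choose a (u+v) · choose (u+v) u = choose a u · choose (a-u) v, what remains is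
the Vandermonde convolution in v and j. -/
theorem leibniz_vandermonde (a b : ℤ) (n : ℕ) (g h : A) :
    ∑ sj ∈ antidiagonal n, (Ring.choose a sj.1 * Ring.choose b sj.2) • (⇑𝒟)^[sj.1] (g * (⇑𝒟)^[sj.2] h) =
      ∑ ui ∈ antidiagonal n,
        (Ring.choose a ui.1 * Ring.choose (a + b - ui.1) ui.2) • ((⇑𝒟)^[ui.1] g * (⇑𝒟)^[ui.2] h) := by
  have h1 : ∀ sj ∈ antidiagonal n,
      (Ring.choose a sj.1 * Ring.choose b sj.2) • (⇑𝒟)^[sj.1] (g * (⇑𝒟)^[sj.2] h) =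
      ∑ uv ∈ antidiagonal sj.1, (Ring.choose a (uv.1 + uv.2) * Ring.choose b sj.2 *
        ((uv.1 + uv.2).choose uv.1 : ℕ)) • ((⇑𝒟)^[uv.1] g * (⇑𝒟)^[uv.2 + sj.2] h) := by
    intro sj _
    rw [deriv_iterate_mul, smul_sum]
    refine sum_congr rfl fun uv huv => ?_
    rw [HasAntidiagonal.mem_antidiagonal.mp huv, ← natCast_zsmul, smul_smul, Function.iterate_add_apply]
  rw [sum_congr rfl h1, sum_antidiagonal_assoc n fun u v j =>
    (Ring.choose a (u + v) * Ring.choose b j * ((u + v).choose u : ℕ)) •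
      ((⇑𝒟)^[u] g * (⇑𝒟)^[v + j] h)]
  refine sum_congr rfl fun ui _ => ?_
  have h2 : Ring.choose (a + b - ui.1) ui.2 = ∑ vj ∈ antidiagonal ui.2,
      Ring.choose (a - ui.1) vj.1 * Ring.choose b vj.2 := by
    rw [← Ring.add_choose_eq _ (Commute.all _ _)]
    congr 1
    ring
  rw [h2, mul_sum, sum_smul]
  refine sum_congr rfl fun vj hvj => ?_
  rw [HasAntidiagonal.mem_antidiagonal.mp hvj]
  congr 1
  have h3 := Ring.choose_smul_choose a (Nat.le_add_right ui.1 vj.1)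
  rw [nsmul_eq_mul, Nat.add_sub_cancel_left] at h3
  linear_combination Ring.choose b vj.2 * h3

theorem leibnizCoeff_eq_zero {p q : ℤ → A} {N M k : ℤ} (hp : ∀ n, N < n → p n = 0)
    (hq : ∀ n, M < n → q n = 0) (hk : N + M < k) : leibnizCoeff p q k = 0 :=
  finsum_eq_zero_of_forall_eq_zero fun nr => leibniz_term_eq_zero hp hq k nr (by omega)

/-- Orders are measured as depths α, β below the top orders N, M. The total depth κ then fixes the
number of derivatives as κ - α - β. Any cutoff K above κ is allowed, so that nested products can
share one range and their sums can be interchanged. -/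
theorem leibnizCoeff_eq_sum {p q : ℤ → A} {N M : ℤ} (hp : ∀ n, N < n → p n = 0)
    (hq : ∀ n, M < n → q n = 0) {κ K : ℕ} (hκ : κ < K) :
    leibnizCoeff p q (N + M - κ) = ∑ α ∈ range K, ∑ β ∈ range K, if α + β ≤ κ then
      Ring.choose (N - α) (κ - α - β) • (p (N - α) * (⇑𝒟)^[κ - α - β] (q (M - β))) else 0 := by
  classical
  rw [← sum_product', ← sum_filter]
  have hinj : Set.InjOn (fun ab : ℕ × ℕ => ((N - ab.1 : ℤ), κ - ab.1 - ab.2))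
      ((range K ×ˢ range K).filter fun ab => ab.1 + ab.2 ≤ κ) := by
    rintro ⟨a, b⟩ h ⟨a', b'⟩ h' e
    simp only [coe_filter, mem_product, mem_range, Set.mem_ofPred_eq] at h h'
    simp only [Prod.mk.injEq] at e ⊢
    omega
  rw [leibnizCoeff, finsum_eq_sum_of_support_subset (s := ((range K ×ˢ range K).filter
    fun ab => ab.1 + ab.2 ≤ κ).image fun ab => ((N - ab.1 : ℤ), κ - ab.1 - ab.2)), sum_image hinj]
  · refine sum_congr rfl ?_
    rintro ⟨a, b⟩ h
    simp only [mem_filter, mem_product, mem_range] at h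
    have : N + M - (κ : ℤ) - (N - a) + ((κ - a - b : ℕ) : ℤ) = M - b := by omega
    dsimp only
    rw [this]
  · rintro ⟨n, r⟩ h
    have h1 : ¬ (N < n ∨ M < N + M - κ - n + r) := fun h' =>
      h (leibniz_term_eq_zero hp hq _ _ h')
    simp only [coe_image, Set.mem_image, mem_coe, mem_filter, mem_product, mem_range,
      Prod.mk.injEq, Prod.exists]
    exact ⟨(N - n).toNat, (M - (N + M - κ - n + r)).toNat, by omega, by omega, by omega⟩

end FormalAlgebra

/-- In a triple product n is the depth of the inner product; the outer depths confine it to d ≤ n ≤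
κ - e, an interval rewritten here as an antidiagonal. -/
theorem sum_range_ite_shift {M : Type*} [AddCommMonoid M] {K κ d e : ℕ} (hκ : κ < K) (f : ℕ → M) :
    (∑ n ∈ range K, if d ≤ n ∧ n + e ≤ κ then f n else 0) =
      if d + e ≤ κ then ∑ ui ∈ antidiagonal (κ - d - e), f (d + ui.1) else 0 := by
  rw [← sum_filter]
  split_ifs with h
  · refine sum_nbij' (fun n => (n - d, κ - n - e)) (fun ui => d + ui.1) ?_ ?_ ?_ ?_ ?_
    · intro n hn
      simp only [mem_filter, mem_range, HasAntidiagonal.mem_antidiagonal] at hn ⊢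
      omega
    · intro n hn
      simp only [mem_filter, mem_range, HasAntidiagonal.mem_antidiagonal] at hn ⊢
      omega
    · intro n hn
      simp only [mem_filter, mem_range] at hn
      omega
    · rintro ⟨u, i⟩ hn
      simp only [HasAntidiagonal.mem_antidiagonal, Prod.mk.injEq] at hn ⊢
      omega
    · intro n hn
      simp only [mem_filter, mem_range] at hn
      rw [Nat.add_sub_cancel' hn.2.1]
  · refine sum_eq_zero fun n hn => ?_
    simp only [mem_filter, mem_range] at hn
    omega

theorem sum_comm_four {M : Type*} [AddCommMonoid M] (s : Finset ℕ) (f : ℕ → ℕ → ℕ → ℕ → M) :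
    ∑ n ∈ s, ∑ c ∈ s, ∑ a ∈ s, ∑ b ∈ s, f n c a b =
      ∑ a ∈ s, ∑ b ∈ s, ∑ c ∈ s, ∑ n ∈ s, f n c a b := by
  rw [sum_comm]
  refine (sum_congr rfl fun γ _ => sum_comm.trans (sum_congr rfl fun α _ => sum_comm)).trans ?_
  exact sum_comm.trans (sum_congr rfl fun α _ => sum_comm)

end

/-! ### The ring of pseudo-differential operators -/

noncomputable section

open Finset

namespace PseudoDiffOp

section Coefficients

variable {A : Type*} [CommRing A]

instance : Zero (PseudoDiffOp A) := ⟨⟨fun _ => 0, 0, fun _ _ => rfl⟩⟩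

instance : Add (PseudoDiffOp A) :=
  ⟨fun P Q => ⟨fun n => P.coeff n + Q.coeff n, by
    obtain ⟨N, hN⟩ := P.bdd
    obtain ⟨M, hM⟩ := Q.bdd
    exact ⟨max N M, fun n hn => by
      rw [hN n (lt_of_le_of_lt (le_max_left _ _) hn),
        hM n (lt_of_le_of_lt (le_max_right _ _) hn), add_zero]⟩⟩⟩

@[simp] theorem zero_coeff (k : ℤ) : (0 : PseudoDiffOp A).coeff k = 0 := rfl

@[simp] theorem add_coeff (P Q : PseudoDiffOp A) (k : ℤ) :
    (P + Q).coeff k = P.coeff k + Q.coeff k := rfl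

@[simp] theorem sub_coeff (P Q : PseudoDiffOp A) (k : ℤ) :
    (P - Q).coeff k = P.coeff k - Q.coeff k := rfl

@[simp] theorem neg_coeff (P : PseudoDiffOp A) (k : ℤ) : (-P).coeff k = -P.coeff k := rfl

theorem one_coeff (k : ℤ) : (1 : PseudoDiffOp A).coeff k = if k = 0 then 1 else 0 := rfl

theorem D_coeff (m k : ℤ) : (D m : PseudoDiffOp A).coeff k = if k = m then 1 else 0 := rfl

theorem one_eq_D : (1 : PseudoDiffOp A) = D 0 := rfl

end Coefficients

section RingStructure

variable {A : Type*} [CommRing A] [Differential A]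

local notation "𝒟" => @Differential.deriv A _ _

theorem mul_coeff (P Q : PseudoDiffOp A) (k : ℤ) :
    (P * Q).coeff k = leibnizCoeff P.coeff Q.coeff k := rfl

theorem mul_coeff_eq_sum {P Q : PseudoDiffOp A} {N M : ℤ} (hP : ∀ n, N < n → P.coeff n = 0)
    (hQ : ∀ n, M < n → Q.coeff n = 0) {κ K : ℕ} (hκ : κ < K) :
    (P * Q).coeff (N + M - κ) = ∑ α ∈ range K, ∑ β ∈ range K, if α + β ≤ κ then
      Ring.choose (N - α) (κ - α - β) •
        (P.coeff (N - α) * (⇑𝒟)^[κ - α - β] (Q.coeff (M - β))) else 0 :=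
  leibnizCoeff_eq_sum hP hQ hκ

theorem mul_coeff_eq_zero {P Q : PseudoDiffOp A} {N M k : ℤ} (hP : ∀ n, N < n → P.coeff n = 0)
    (hQ : ∀ n, M < n → Q.coeff n = 0) (hk : N + M < k) : (P * Q).coeff k = 0 :=
  leibnizCoeff_eq_zero hP hQ hk

/-- Both bracketings are brought to a sum over the depths of the three factors in the same order, so
that associativity can be checked for each triple of monomials by `leibniz_vandermonde`. -/
theorem mul_mul_coeff_aux {P Q R : PseudoDiffOp A} {N M S : ℤ}
    (hP : ∀ n, N < n → P.coeff n = 0) (hQ : ∀ n, M < n → Q.coeff n = 0)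
    (hR : ∀ n, S < n → R.coeff n = 0) (κ : ℕ) :
    (P * Q * R).coeff (N + M + S - κ) = ∑ α ∈ range (κ + 1), ∑ β ∈ range (κ + 1),
      ∑ γ ∈ range (κ + 1), if α + β + γ ≤ κ then ∑ ui ∈ antidiagonal (κ - (α + β) - γ),
        (Ring.choose (N - α) ui.1 * Ring.choose ((N - α) + (M - β) - ui.1) ui.2) •
          (P.coeff (N - α) * ((⇑𝒟)^[ui.1] (Q.coeff (M - β)) * (⇑𝒟)^[ui.2] (R.coeff (S - γ))))
        else 0 := by
  have hPQ : ∀ n, N + M < n → (P * Q).coeff n = 0 := fun n hn => mul_coeff_eq_zero hP hQ hn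
  rw [mul_coeff_eq_sum hPQ hR (Nat.lt_succ_self κ)]
  have h1 : ∀ n ∈ range (κ + 1), ∀ γ ∈ range (κ + 1),
      (if n + γ ≤ κ then Ring.choose (N + M - n) (κ - n - γ) •
        ((P * Q).coeff (N + M - n) * (⇑𝒟)^[κ - n - γ] (R.coeff (S - γ))) else 0) =
      ∑ α ∈ range (κ + 1), ∑ β ∈ range (κ + 1), if α + β ≤ n ∧ n + γ ≤ κ then
        (Ring.choose (N - α) (n - α - β) * Ring.choose (N + M - n) (κ - n - γ)) •
          (P.coeff (N - α) * ((⇑𝒟)^[n - α - β] (Q.coeff (M - β)) *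
            (⇑𝒟)^[κ - n - γ] (R.coeff (S - γ)))) else 0 := by
    intro n hn γ _
    split_ifs with h
    · rw [mul_coeff_eq_sum hP hQ (mem_range.mp hn), sum_mul, smul_sum]
      refine sum_congr rfl fun α _ => ?_
      rw [sum_mul, smul_sum]
      refine sum_congr rfl fun β _ => ?_
      by_cases h' : α + β ≤ n
      · rw [if_pos h', if_pos ⟨h', h⟩, smul_mul_assoc, smul_smul, mul_assoc, mul_comm]
      · rw [if_neg h', if_neg (fun h'' => h' h''.1), zero_mul, smul_zero]
    · exact (sum_eq_zero fun α _ => sum_eq_zero fun β _ => if_neg fun h' => h h'.2).symm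
  rw [sum_congr rfl fun n hn => sum_congr rfl (h1 n hn)]
  rw [sum_comm_four]
  refine sum_congr rfl fun α _ => sum_congr rfl fun β _ => sum_congr rfl fun γ _ => ?_
  rw [sum_range_ite_shift (Nat.lt_succ_self κ)]
  refine if_congr Iff.rfl (sum_congr rfl fun ui hui => ?_) rfl
  have hui := HasAntidiagonal.mem_antidiagonal.mp hui
  have e1 : α + β + ui.1 - α - β = ui.1 := by omega
  have e2 : κ - (α + β + ui.1) - γ = ui.2 := by omega
  have e3 : N + M - ((α + β + ui.1 : ℕ) : ℤ) = N - α + (M - β) - ui.1 := by push_cast; ring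
  rw [e1, e2, e3]

theorem mul_mul_coeff_aux' {P Q R : PseudoDiffOp A} {N M S : ℤ}
    (hP : ∀ n, N < n → P.coeff n = 0) (hQ : ∀ n, M < n → Q.coeff n = 0)
    (hR : ∀ n, S < n → R.coeff n = 0) (κ : ℕ) :
    (P * (Q * R)).coeff (N + (M + S) - κ) = ∑ α ∈ range (κ + 1), ∑ β ∈ range (κ + 1),
      ∑ γ ∈ range (κ + 1), if α + β + γ ≤ κ then ∑ js ∈ antidiagonal (κ - (β + γ) - α),
        (Ring.choose (N - α) js.2 * Ring.choose (M - β) js.1) •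
          (P.coeff (N - α) *
            (⇑𝒟)^[js.2] (Q.coeff (M - β) * (⇑𝒟)^[js.1] (R.coeff (S - γ))))
        else 0 := by
  have hQR : ∀ n, M + S < n → (Q * R).coeff n = 0 := fun n hn => mul_coeff_eq_zero hQ hR hn
  rw [mul_coeff_eq_sum hP hQR (Nat.lt_succ_self κ)]
  refine sum_congr rfl fun α _ => ?_
  have h1 : ∀ n ∈ range (κ + 1),
      (if α + n ≤ κ then Ring.choose (N - α) (κ - α - n) •
        (P.coeff (N - α) * (⇑𝒟)^[κ - α - n] ((Q * R).coeff (M + S - n))) else 0) =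
      ∑ β ∈ range (κ + 1), ∑ γ ∈ range (κ + 1), if β + γ ≤ n ∧ n + α ≤ κ then
        (Ring.choose (N - α) (κ - α - n) * Ring.choose (M - β) (n - β - γ)) •
          (P.coeff (N - α) * (⇑𝒟)^[κ - α - n] (Q.coeff (M - β) *
            (⇑𝒟)^[n - β - γ] (R.coeff (S - γ)))) else 0 := by
    intro n hn
    split_ifs with h
    · rw [mul_coeff_eq_sum hQ hR (mem_range.mp hn), deriv_iterate_sum, mul_sum, smul_sum]
      refine sum_congr rfl fun β _ => ?_
      rw [deriv_iterate_sum, mul_sum, smul_sum]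
      refine sum_congr rfl fun γ _ => ?_
      by_cases h' : β + γ ≤ n
      · rw [if_pos h', if_pos ⟨h', by omega⟩, deriv_iterate_zsmul, mul_smul_comm, smul_smul]
      · rw [if_neg h', if_neg (fun h'' => h' h''.1), deriv_iterate_zero, mul_zero, smul_zero]
    · exact (sum_eq_zero fun β _ => sum_eq_zero fun γ _ =>
        if_neg fun h' => h (by omega)).symm
  rw [sum_congr rfl h1, sum_comm]
  refine sum_congr rfl fun β _ => ?_
  rw [sum_comm]
  refine sum_congr rfl fun γ _ => ?_
  rw [sum_range_ite_shift (Nat.lt_succ_self κ)]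
  refine if_congr (by omega) (sum_congr rfl fun ui hui => ?_) rfl
  have hui := HasAntidiagonal.mem_antidiagonal.mp hui
  have e1 : β + γ + ui.1 - β - γ = ui.1 := by omega
  have e2 : κ - α - (β + γ + ui.1) = ui.2 := by omega
  rw [e1, e2]

protected theorem mul_assoc (P Q R : PseudoDiffOp A) : P * Q * R = P * (Q * R) := by
  obtain ⟨N, hP⟩ := P.bdd
  obtain ⟨M, hQ⟩ := Q.bdd
  obtain ⟨S, hR⟩ := R.bdd
  ext k
  rcases lt_or_ge (N + M + S) k with hk | hk
  · have hPQ : ∀ n, N + M < n → (P * Q).coeff n = 0 := fun n hn => mul_coeff_eq_zero hP hQ hn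
    have hQR : ∀ n, M + S < n → (Q * R).coeff n = 0 := fun n hn => mul_coeff_eq_zero hQ hR hn
    rw [mul_coeff_eq_zero hPQ hR hk, mul_coeff_eq_zero hP hQR (by omega)]
  · obtain ⟨κ, rfl⟩ : ∃ κ : ℕ, k = N + M + S - κ := ⟨(N + M + S - k).toNat, by omega⟩
    rw [mul_mul_coeff_aux hP hQ hR, add_assoc N M S, mul_mul_coeff_aux' hP hQ hR]
    refine sum_congr rfl fun α _ => sum_congr rfl fun β _ => sum_congr rfl fun γ _ =>
      if_congr Iff.rfl ?_ rfl
    have e : κ - (β + γ) - α = κ - (α + β) - γ := by omega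
    have h := congrArg (P.coeff (N - α) * ·) (leibniz_vandermonde (N - α) (M - β)
      (κ - (α + β) - γ) (Q.coeff (M - β)) (R.coeff (S - γ)))
    simp only [mul_sum, mul_smul_comm] at h
    rw [e, ← h]
    exact Finset.Nat.sum_antidiagonal_swap (f := fun js => (Ring.choose (N - α) js.2 *
      Ring.choose (M - β) js.1) • (P.coeff (N - α) * (⇑𝒟)^[js.2] (Q.coeff (M - β) *
        (⇑𝒟)^[js.1] (R.coeff (S - γ)))))

protected theorem one_mul (P : PseudoDiffOp A) : 1 * P = P := by
  ext k
  rw [mul_coeff, leibnizCoeff, finsum_eq_single _ ((0 : ℤ), 0)]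
  · simp [one_coeff]
  · rintro ⟨n, r⟩ h
    by_cases hn : n = 0
    · subst hn
      have hr : r ≠ 0 := fun hr => h (by rw [hr])
      rw [Ring.choose_zero_pos ℤ (Nat.pos_of_ne_zero hr), zero_smul]
    · simp [one_coeff, hn]

theorem mul_D_coeff (P : PseudoDiffOp A) (m k : ℤ) : (P * D m).coeff k = P.coeff (k - m) := by
  rw [mul_coeff, leibnizCoeff, finsum_eq_single _ (k - m, 0)]
  · simp [D_coeff]
  · rintro ⟨n, r⟩ h
    rcases Nat.eq_zero_or_pos r with rfl | hr
    · have : k - n ≠ m := fun h' => h (by rw [← h']; simp)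
      simp [D_coeff, this]
    · obtain ⟨s, rfl⟩ := Nat.exists_eq_succ_of_ne_zero hr.ne'
      have : 𝒟 ((D m : PseudoDiffOp A).coeff (k - n + (s + 1 : ℕ))) = 0 := by
        rw [D_coeff]
        split_ifs <;> simp
      simp only [Function.iterate_succ_apply, this, deriv_iterate_zero, mul_zero, smul_zero]

protected theorem mul_one (P : PseudoDiffOp A) : P * 1 = P := by
  ext k
  rw [one_eq_D, mul_D_coeff, sub_zero]

protected theorem left_distrib (P Q R : PseudoDiffOp A) : P * (Q + R) = P * Q + P * R := by
  obtain ⟨N, hP⟩ := P.bdd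
  obtain ⟨M, hQ⟩ := Q.bdd
  obtain ⟨S, hR⟩ := R.bdd
  ext k
  rw [add_coeff, mul_coeff, mul_coeff, mul_coeff, leibnizCoeff, leibnizCoeff, leibnizCoeff,
    ← finsum_add_distrib (leibniz_support_finite hP hQ k) (leibniz_support_finite hP hR k)]
  refine finsum_congr fun nr => ?_
  rw [add_coeff, deriv_iterate_add, mul_add, smul_add]

protected theorem right_distrib (P Q R : PseudoDiffOp A) : (P + Q) * R = P * R + Q * R := by
  obtain ⟨N, hP⟩ := P.bdd
  obtain ⟨M, hQ⟩ := Q.bdd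
  obtain ⟨S, hR⟩ := R.bdd
  ext k
  rw [add_coeff, mul_coeff, mul_coeff, mul_coeff, leibnizCoeff, leibnizCoeff, leibnizCoeff,
    ← finsum_add_distrib (leibniz_support_finite hP hR k) (leibniz_support_finite hQ hR k)]
  refine finsum_congr fun nr => ?_
  rw [add_coeff, add_mul, smul_add]

instance : AddCommGroup (PseudoDiffOp A) where
  add_assoc P Q R := by ext; simp [add_assoc]
  zero_add P := by ext; simp
  add_zero P := by ext; simp
  add_comm P Q := by ext; simp [add_comm]
  neg_add_cancel P := by ext; simp
  sub_eq_add_neg P Q := by ext; simp [sub_eq_add_neg]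
  nsmul := nsmulRec
  zsmul := zsmulRec

/-- Pseudo-differential operators form a ring. -/
scoped instance : Ring (PseudoDiffOp A) where
  mul_assoc := PseudoDiffOp.mul_assoc
  one_mul := PseudoDiffOp.one_mul
  mul_one := PseudoDiffOp.mul_one
  left_distrib := PseudoDiffOp.left_distrib
  right_distrib := PseudoDiffOp.right_distrib
  zero_mul P := by
    have h := PseudoDiffOp.right_distrib 0 0 P
    rwa [add_zero, left_eq_add] at h
  mul_zero P := by
    have h := PseudoDiffOp.left_distrib P 0 0
    rwa [add_zero, left_eq_add] at h
  zsmul := zsmulRec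
  neg_add_cancel := neg_add_cancel
  sub_eq_add_neg := sub_eq_add_neg
  npow n P := P ^ n
  npow_zero _ := rfl
  npow_succ _ _ := rfl

end RingStructure
end PseudoDiffOp
end

/-! ### Products with constant coefficients, inverses and the Lax form -/

noncomputable section

open Finset

namespace PseudoDiffOp

section Parts

variable {A : Type*} [CommRing A]

theorem nonneg_add_negPart (P : PseudoDiffOp A) : P.nonneg + P.negPart = P := by
  ext k
  simp only [add_coeff, nonneg, negPart]
  split_ifs <;> first | omega | simp

theorem negPart_coeff_eq_zero (P : PseudoDiffOp A) (k : ℤ) (hk : -1 < k) :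
    P.negPart.coeff k = 0 := if_neg (by omega)

end Parts

section Calculus

variable {A : Type*} [CommRing A] [Differential A]

local notation "𝒟" => @Differential.deriv A _ _

theorem D_mul_D (m n : ℤ) : (D m * D n : PseudoDiffOp A) = D (m + n) := by
  ext k
  rw [mul_D_coeff, D_coeff, D_coeff]
  exact if_congr (by omega) rfl rfl

theorem D_one_mul_coeff (P : PseudoDiffOp A) (k : ℤ) :
    (D 1 * P).coeff k = P.coeff (k - 1) + 𝒟 (P.coeff k) := by
  have hsub : (Function.support fun nr : ℤ × ℕ => Ring.choose nr.1 nr.2 •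
      ((D 1 : PseudoDiffOp A).coeff nr.1 * (⇑𝒟)^[nr.2] (P.coeff (k - nr.1 + nr.2)))) ⊆
      (({(1, 0), (1, 1)} : Finset (ℤ × ℕ)) : Set (ℤ × ℕ)) := by
    rintro ⟨n, r⟩ h
    by_contra hc
    apply h
    simp only [coe_insert, coe_singleton, Set.mem_insert_iff, Set.mem_singleton_iff,
      Prod.mk.injEq] at hc
    by_cases hn : n = 1
    · subst hn
      have hr : 1 < r := by omega
      have : Ring.choose (1 : ℤ) r = 0 := by
        have := Ring.choose_natCast (R := ℤ) 1 r
        rw [Nat.choose_eq_zero_of_lt hr] at this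
        simpa using this
      simp [this]
    · simp [D_coeff, hn]
  rw [mul_coeff, leibnizCoeff, finsum_eq_sum_of_support_subset _ hsub, sum_pair (by simp)]
  simp [D_coeff]

/-- Multiplication by the function `a`. -/
def const (a : A) : PseudoDiffOp A where
  coeff n := if n = 0 then a else 0
  bdd := ⟨0, fun n hn => if_neg (by omega)⟩

theorem const_mul_coeff (a : A) (P : PseudoDiffOp A) (k : ℤ) :
    (const a * P).coeff k = a * P.coeff k := by
  rw [mul_coeff, leibnizCoeff, finsum_eq_single _ ((0 : ℤ), 0)]
  · simp [const]
  · rintro ⟨n, r⟩ h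
    by_cases hn : n = 0
    · subst hn
      have hr : r ≠ 0 := fun hr => h (by rw [hr])
      rw [Ring.choose_zero_pos ℤ (Nat.pos_of_ne_zero hr), zero_smul]
    · simp [const, hn]

theorem sum_coeff {ι : Type*} (s : Finset ι) (P : ι → PseudoDiffOp A) (k : ℤ) :
    (∑ i ∈ s, P i).coeff k = ∑ i ∈ s, (P i).coeff k := by
  classical
  induction s using Finset.induction_on with
  | empty => simp
  | insert i s hi ih => rw [sum_insert hi, sum_insert hi, add_coeff, ih]

theorem nonneg_eq_sum {P : PseudoDiffOp A} {n : ℕ} (hP : ∀ m : ℤ, n < m → P.coeff m = 0) :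
    P.nonneg = ∑ i ∈ range (n + 1), const (P.coeff i) * D i := by
  ext k
  simp only [sum_coeff, const_mul_coeff, D_coeff, nonneg]
  split_ifs with hk
  · lift k to ℕ using hk
    simp only [Nat.cast_inj, mul_ite, mul_one, mul_zero, sum_ite_eq, mem_range]
    split_ifs with h
    · rfl
    · exact hP _ (by omega)
  · refine (sum_eq_zero fun i _ => ?_).symm
    rw [if_neg (by omega), mul_zero]

theorem deriv_const_iterate {a : A} (ha : 𝒟 a = 0) {r : ℕ} (hr : r ≠ 0) : (⇑𝒟)^[r] a = 0 := by
  obtain ⟨s, rfl⟩ := Nat.exists_eq_succ_of_ne_zero hr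
  rw [Function.iterate_succ_apply, ha, deriv_iterate_zero]

/-- Every term in which a derivative hits the constant right factor drops out, and the Leibniz
product becomes the product of power series in ∂⁻¹. -/
theorem mul_coeff_of_deriv_eq_zero {P Q : PseudoDiffOp A} (hP : ∀ n, 0 < n → P.coeff n = 0)
    (hQ : ∀ n, 0 < n → Q.coeff n = 0) (hd : ∀ n, 𝒟 (Q.coeff n) = 0) (κ : ℕ) :
    (P * Q).coeff (-κ) = ∑ ab ∈ antidiagonal κ, P.coeff (-ab.1) * Q.coeff (-ab.2) := by
  have h := mul_coeff_eq_sum hP hQ (Nat.lt_succ_self κ)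
  have e : (0 + 0 - κ : ℤ) = -κ := by ring
  rw [e] at h
  rw [h, ← sum_product']
  symm
  refine sum_subset_zero_on_sdiff ?_ ?_ ?_
  · rintro ⟨a, b⟩ h
    simp only [HasAntidiagonal.mem_antidiagonal, mem_product, mem_range] at h ⊢
    omega
  · rintro ⟨a, b⟩ h
    simp only [HasAntidiagonal.mem_antidiagonal, mem_product, mem_range, mem_sdiff] at h
    split_ifs with h'
    · rw [deriv_const_iterate (hd _) (by omega), mul_zero, smul_zero]
    · rfl
  · rintro ⟨a, b⟩ h
    simp only [HasAntidiagonal.mem_antidiagonal] at h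
    rw [if_pos h.le]
    have : κ - a - b = 0 := by omega
    simp [this]

/-- `P` has constant coefficients. -/
def IsConst (P : PseudoDiffOp A) : Prop := ∀ n, 𝒟 (P.coeff n) = 0

theorem IsConst.D_one_mul {P : PseudoDiffOp A} (hP : P.IsConst) : D 1 * P = P * D 1 := by
  ext k
  rw [D_one_mul_coeff, mul_D_coeff, hP, add_zero]

theorem D_natCast_succ (n : ℕ) : (D ((n + 1 : ℕ) : ℤ) : PseudoDiffOp A) = D n * D 1 := by
  rw [D_mul_D]
  push_cast
  rfl

theorem IsConst.D_mul {P : PseudoDiffOp A} (hP : P.IsConst) (n : ℕ) : D n * P = P * D n := by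
  induction n with
  | zero =>
    rw [Nat.cast_zero, ← one_eq_D, one_mul, mul_one]
  | succ n ih => rw [D_natCast_succ, mul_assoc, hP.D_one_mul, ← mul_assoc, ih, mul_assoc]

theorem D_one_pow (n : ℕ) : (D 1 : PseudoDiffOp A) ^ n = D n := by
  induction n with
  | zero => rfl
  | succ n ih => rw [pow_succ, ih, D_natCast_succ]

/-- The coefficients of the inverse of `P = 1 + w₁ ∂⁻¹ + ⋯`. -/
def invCoeff (P : PseudoDiffOp A) : ℕ → A
  -- Solves the coefficient of ∂^{-κ} in P Q = 1 for the κ-th coefficient of Q: the leading 1 of P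
  -- contributes exactly that coefficient, all other terms involve indices β < κ.
  | κ => (if κ = 0 then 1 else 0) - ∑ α ∈ range κ, ∑ β : Fin κ, if α + 1 + β ≤ κ then
      Ring.choose (-((α + 1 : ℕ) : ℤ)) (κ - (α + 1) - β) •
        (P.coeff (-((α + 1 : ℕ) : ℤ)) * (⇑𝒟)^[κ - (α + 1) - β] (invCoeff P β)) else 0
  termination_by κ => κ
  decreasing_by exact β.2

/-- The right inverse of `P = 1 + w₁ ∂⁻¹ + ⋯`. -/
def rightInv (P : PseudoDiffOp A) : PseudoDiffOp A where
  coeff n := if n ≤ 0 then invCoeff P (-n).toNat else 0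
  bdd := ⟨0, fun n hn => if_neg (by omega)⟩

theorem rightInv_coeff_neg (P : PseudoDiffOp A) (n : ℕ) :
    P.rightInv.coeff (0 - n) = invCoeff P n := by
  simp [rightInv]

theorem rightInv_coeff_pos (P : PseudoDiffOp A) (n : ℤ) (hn : 0 < n) : P.rightInv.coeff n = 0 :=
  if_neg (by omega)

theorem isMonicOrderZero_rightInv (P : PseudoDiffOp A) : P.rightInv.IsMonicOrderZero := by
  refine ⟨?_, rightInv_coeff_pos P⟩
  have := rightInv_coeff_neg P 0
  rw [invCoeff] at this
  simpa using this

theorem IsMonicOrderZero.mul_rightInv {P : PseudoDiffOp A} (hP : P.IsMonicOrderZero) :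
    P * P.rightInv = 1 := by
  ext k
  rcases lt_or_ge 0 k with hk | hk
  · rw [mul_coeff_eq_zero hP.2 (rightInv_coeff_pos P) (by simpa using hk), one_coeff,
      if_neg hk.ne']
  · obtain ⟨κ, rfl⟩ : ∃ κ : ℕ, k = -κ := ⟨(-k).toNat, by omega⟩
    have h := mul_coeff_eq_sum hP.2 (rightInv_coeff_pos P) (Nat.lt_succ_self κ)
    have e : (0 + 0 - κ : ℤ) = -κ := by ring
    rw [e] at h
    rw [h, sum_range_succ', one_coeff]
    -- The row of the leading coefficient 1 of P: `Ring.choose 0 r` vanishes for r > 0, so only β =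
    -- κ survives.
    have h0 : ∑ β ∈ range (κ + 1), (if 0 + β ≤ κ then
        Ring.choose (0 - ((0 : ℕ) : ℤ)) (κ - 0 - β) • (P.coeff (0 - ((0 : ℕ) : ℤ)) *
          (⇑𝒟)^[κ - 0 - β] (P.rightInv.coeff (0 - β))) else 0) = invCoeff P κ := by
      rw [sum_range_succ, sum_eq_zero, zero_add, rightInv_coeff_neg]
      · simp [hP.1]
      · intro β hβ
        rw [mem_range] at hβ
        have : Ring.choose (0 : ℤ) (κ - β) = 0 := Ring.choose_zero_pos ℤ (by omega)
        simp [this]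
    rw [h0, invCoeff]
    have h1 : ∀ α ∈ range κ, ∑ β ∈ range (κ + 1), (if α + 1 + β ≤ κ then
        Ring.choose (0 - ((α + 1 : ℕ) : ℤ)) (κ - (α + 1) - β) • (P.coeff (0 - ((α + 1 : ℕ) : ℤ)) *
          (⇑𝒟)^[κ - (α + 1) - β] (P.rightInv.coeff (0 - β))) else 0) =
        ∑ β : Fin κ, if α + 1 + β ≤ κ then
          Ring.choose (-((α + 1 : ℕ) : ℤ)) (κ - (α + 1) - β) •
          (P.coeff (-((α + 1 : ℕ) : ℤ)) * (⇑𝒟)^[κ - (α + 1) - β] (invCoeff P β)) else 0 := by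
      intro α _
      rw [sum_range_succ, if_neg (by omega), add_zero, sum_range]
      simp only [rightInv_coeff_neg]
      simp only [zero_sub]
    rw [sum_congr rfl h1, add_sub_cancel]
    exact if_congr (by omega) rfl rfl

/-- The right inverse is again monic of order zero, so it has a right inverse of its own, and by
associativity that one is P. -/
theorem IsMonicOrderZero.isInverse_rightInv {P : PseudoDiffOp A} (hP : P.IsMonicOrderZero) :
    IsInverse P P.rightInv := by
  refine ⟨hP.mul_rightInv, ?_⟩
  have h := (isMonicOrderZero_rightInv P).mul_rightInv
  have : P = P.rightInv.rightInv := by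
    calc P = P * (P.rightInv * P.rightInv.rightInv) := by rw [h, mul_one]
      _ = P.rightInv.rightInv := by rw [← mul_assoc, hP.mul_rightInv, one_mul]
  rwa [← this] at h

theorem IsMonicOrderZero.isInverse_inv {P : PseudoDiffOp A} (hP : P.IsMonicOrderZero) :
    IsInverse P P⁻¹ := by
  have h : ∃ Q, IsInverse P Q := ⟨_, hP.isInverse_rightInv⟩
  have e : P⁻¹ = h.choose := dif_pos h
  rw [e]
  exact h.choose_spec

theorem IsMonicOrderZero.inv_eq {P Q : PseudoDiffOp A} (hP : P.IsMonicOrderZero)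
    (hQ : P * Q = 1) : P⁻¹ = Q := by
  rw [← mul_one P⁻¹, ← hQ, ← mul_assoc, hP.isInverse_inv.2, one_mul]

theorem IsMonicOrderZero.inv {P : PseudoDiffOp A} (hP : P.IsMonicOrderZero) :
    P⁻¹.IsMonicOrderZero := by
  rw [hP.inv_eq hP.mul_rightInv]
  exact isMonicOrderZero_rightInv P

theorem mul_coeff_top {P Q : PseudoDiffOp A} {N M : ℤ} (hP : ∀ n, N < n → P.coeff n = 0)
    (hQ : ∀ n, M < n → Q.coeff n = 0) : (P * Q).coeff (N + M) = P.coeff N * Q.coeff M := by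
  simpa using mul_coeff_eq_sum hP hQ (κ := 0) (K := 1) one_pos

theorem mul_coeff_subtop {P Q : PseudoDiffOp A} {N M : ℤ} (hP : ∀ n, N < n → P.coeff n = 0)
    (hQ : ∀ n, M < n → Q.coeff n = 0) : (P * Q).coeff (N + M - 1) =
      N • (P.coeff N * 𝒟 (Q.coeff M)) + P.coeff N * Q.coeff (M - 1) +
        P.coeff (N - 1) * Q.coeff M := by
  have h := mul_coeff_eq_sum hP hQ (κ := 1) (K := 2) one_lt_two
  simpa [sum_range_succ, Ring.choose_one_right] using h

theorem IsMonicOrderZero.mul {P Q : PseudoDiffOp A} (hP : P.IsMonicOrderZero)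
    (hQ : Q.IsMonicOrderZero) : (P * Q).IsMonicOrderZero := by
  refine ⟨?_, fun n hn => mul_coeff_eq_zero hP.2 hQ.2 (by simpa using hn)⟩
  simpa [hP.1, hQ.1] using mul_coeff_top hP.2 hQ.2

theorem isMonicOrderZero_monic {B : Type*} [CommRing B] (w : ℕ → B) : (monic w).IsMonicOrderZero :=
  ⟨by simp [monic], fun n hn => by simp only [monic]; rw [if_neg (by omega), if_neg (by omega)]⟩

/-- Compare the two top coefficients in L P = P ∂. The leading coefficient of P is the constant 1,
so no derivative term arises, and the ∂⁻¹ coefficient of P appears on both sides and cancels, which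
leaves no ∂⁰ term in L. -/
theorem IsMonicOrderZero.isLaxForm {P : PseudoDiffOp A} (hP : P.IsMonicOrderZero) :
    (P * D 1 * P⁻¹).IsLaxForm := by
  have hD : ∀ n, (1 : ℤ) < n → (D 1 : PseudoDiffOp A).coeff n = 0 := fun n hn =>
    if_neg hn.ne'
  have hPD : ∀ n, (1 : ℤ) < n → (P * D 1).coeff n = 0 := fun n hn =>
    mul_coeff_eq_zero hP.2 hD (by simpa using hn)
  have hL : ∀ n, (1 : ℤ) < n → (P * D 1 * P⁻¹).coeff n = 0 := fun n hn =>
    mul_coeff_eq_zero hPD hP.inv.2 (by simpa using hn)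
  have hLP : P * D 1 * P⁻¹ * P = P * D 1 := by rw [mul_assoc, hP.isInverse_inv.2, mul_one]
  have h1 := mul_coeff_top hL hP.2
  have h2 := mul_coeff_subtop hL hP.2
  rw [hLP, mul_D_coeff] at h1 h2
  simp only [hP.1, add_zero, sub_self, mul_one] at h1
  refine ⟨h1.symm, ?_, hL⟩
  simpa [hP.1, ← h1] using h2

theorem pow_coeff_eq_zero {P : PseudoDiffOp A} (hP : ∀ n, 1 < n → P.coeff n = 0) (m : ℕ) :
    ∀ n, (m : ℤ) < n → (P ^ m).coeff n = 0 := by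
  induction m with
  | zero =>
    intro n hn
    rw [pow_zero, one_coeff, if_neg (by simpa using hn.ne')]
  | succ m ih =>
    intro n hn
    rw [pow_succ]
    exact mul_coeff_eq_zero ih hP (by simpa using hn)

theorem IsInverse.conj_pow {P Q : PseudoDiffOp A} (h : IsInverse P Q) (R : PseudoDiffOp A)
    (n : ℕ) : (P * R * Q) ^ n * P = P * R ^ n := by
  induction n with
  | zero => rw [pow_zero, pow_zero, one_mul, mul_one]
  | succ n ih =>
    rw [pow_succ', mul_assoc, ih, pow_succ', ← mul_assoc, mul_assoc (P * R), h.2, mul_one,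
      mul_assoc]

end Calculus

end PseudoDiffOp
end

/-! ### Formal waves and the dressing argument -/

noncomputable section

open Finset
open scoped PseudoDiffOp

namespace FormalWave

section

variable {A : Type*} [CommRing A]

/-- The operator with the same coefficients, so that `F = F.toOp e^ξ`. -/
def toOp (F : FormalWave A) : PseudoDiffOp A := ⟨F.coeff, F.bdd⟩

theorem toOp_injective : Function.Injective (toOp (A := A)) := fun F G h => by
  ext n
  exact congrFun (congrArg PseudoDiffOp.coeff h) n

theorem toOp_expXi : (expXi : FormalWave A).toOp = 1 := rfl

variable [Differential A]

theorem toOp_smul (P : PseudoDiffOp A) (F : FormalWave A) : (P • F).toOp = P * F.toOp := rfl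

theorem toOp_mulLambda (F : FormalWave A) : F.mulLambda.toOp = F.toOp * PseudoDiffOp.D 1 := by
  ext k
  rw [PseudoDiffOp.mul_D_coeff]
  rfl

end

end FormalWave

namespace HolFun

variable {U : TopologicalSpace.Opens ℂ}

/-- Evaluation at a point of `U`. -/
def evalHom (x : U) : HolFun U →+* ℂ := (Pi.evalRingHom (fun _ : U => ℂ) x).comp (HolFun U).val

theorem evalHom_apply (x : U) (f : HolFun U) : evalHom x f = f.1 x := rfl

theorem deriv_algebraMap_eq_zero (c : ℂ) :
    Differential.deriv (algebraMap ℂ (HolFun U) c) = 0 := by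
  apply Subtype.ext
  funext x
  rw [deriv_apply]
  have : ext0 (algebraMap ℂ (HolFun U) c).1 =ᶠ[nhds (x : ℂ)] fun _ => c := by
    filter_upwards [U.isOpen.mem_nhds x.2] with y hy
    exact ext0_coe (algebraMap ℂ (HolFun U) c).1 ⟨y, hy⟩
  rw [this.deriv_eq, deriv_const]
  rfl

end HolFun

theorem add_single_mem_entireTimes {t : ℕ → ℂ} (ht : t ∈ entireTimes) (j : ℕ) (s : ℂ) :
    t + Pi.single j s ∈ entireTimes := by
  intro r
  have h : Summable fun i => ‖(Pi.single j s : ℕ → ℂ) i‖ * |r| ^ i :=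
    summable_of_ne_finset_zero (s := {j}) fun i hi => by
      rw [Pi.single_eq_of_ne (by simpa using hi), norm_zero, zero_mul]
  refine Summable.of_norm_bounded ((ht |r|).add h) fun i => ?_
  rw [norm_mul, norm_norm, norm_pow, Real.norm_eq_abs, ← add_mul]
  exact mul_le_mul_of_nonneg_right (norm_add_le _ _) (by positivity)

namespace PseudoDiffOp

variable {U : TopologicalSpace.Opens ℂ}

/-- Constancy of C and Q in x keeps x-derivatives out of the products, so each coefficient is a
finite sum of fixed functions of x times functions of t, differentiated termwise. -/
theorem hasOpTimeDerivAt_mul {V : PseudoDiffOp (HolFun U)} (hV : V.IsMonicOrderZero)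
    {C : (ℕ → ℂ) → PseudoDiffOp (HolFun U)} (hC : ∀ t, (C t).IsMonicOrderZero)
    (hdC : ∀ t, (C t).IsConst) {Q : PseudoDiffOp (HolFun U)} (hQ : ∀ n, 0 < n → Q.coeff n = 0)
    (hdQ : Q.IsConst) {j : ℕ} {t : ℕ → ℂ} (h : HasOpTimeDerivAt C Q j t) :
    HasOpTimeDerivAt (fun t => V * C t) (V * Q) j t := by
  intro m x
  rcases lt_or_ge 0 m with hm | hm
  · have h1 : ∀ s : ℂ, (V * C (t + Pi.single j s)).coeff m = 0 := fun s =>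
      mul_coeff_eq_zero hV.2 (hC _).2 (by simpa using hm)
    simp only [h1]
    rw [mul_coeff_eq_zero hV.2 hQ (by simpa using hm)]
    exact hasDerivAt_const _ _
  · obtain ⟨κ, rfl⟩ : ∃ κ : ℕ, m = -κ := ⟨(-m).toNat, by omega⟩
    simp only [mul_coeff_of_deriv_eq_zero hV.2 (hC _).2 (hdC _),
      mul_coeff_of_deriv_eq_zero hV.2 hQ hdQ, ← HolFun.evalHom_apply, map_sum, map_mul]
    exact HasDerivAt.fun_sum fun ab _ => (h (-ab.2) x).const_mul _

section Dressing

variable {V : PseudoDiffOp (HolFun U)} {C : (ℕ → ℂ) → PseudoDiffOp (HolFun U)}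
  {Ω : ℕ → PseudoDiffOp (HolFun U)}

theorem dressing_eq (hV : V.IsMonicOrderZero) (hdC : ∀ t, (C t).IsConst) (t : ℕ → ℂ) :
    V * D 1 * V⁻¹ * (V * C t) = V * C t * D 1 := by
  rw [mul_assoc (V * D 1), ← mul_assoc V⁻¹, hV.isInverse_inv.2, one_mul, mul_assoc,
    (hdC t).D_one_mul, ← mul_assoc]

theorem dressing_conj (hV : V.IsMonicOrderZero) (hC : ∀ t, (C t).IsMonicOrderZero)
    (hdC : ∀ t, (C t).IsConst) (t : ℕ → ℂ) :
    V * D 1 * V⁻¹ = V * C t * D 1 * (V * C t)⁻¹ := by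
  rw [← dressing_eq hV hdC, mul_assoc _ (V * C t), (hV.mul (hC t)).isInverse_inv.1, mul_one]

theorem dressing_conj_pow (hV : V.IsMonicOrderZero) (hC : ∀ t, (C t).IsMonicOrderZero)
    (hdC : ∀ t, (C t).IsConst) (t : ℕ → ℂ) (n : ℕ) :
    V * C t * D n * (V * C t)⁻¹ = (V * D 1 * V⁻¹) ^ n := by
  have h := (hV.mul (hC t)).isInverse_inv
  rw [dressing_conj hV hC hdC t, ← D_one_pow, ← h.conj_pow, mul_assoc _ (V * C t), h.1, mul_one]

theorem dressing_nonneg_mul (hdC : ∀ t, (C t).IsConst)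
    (hVΩ : ∀ j : ℕ, ((V * D 1 * V⁻¹) ^ (j + 2)).nonneg * V = V * (D ((j : ℤ) + 2) + Ω j))
    (t : ℕ → ℂ) (j : ℕ) : ((V * D 1 * V⁻¹) ^ (j + 2)).nonneg * (V * C t) =
      V * (Ω j * C t) + V * C t * D ((j : ℤ) + 2) := by
  have hD : D ((j : ℤ) + 2) * C t = C t * D ((j : ℤ) + 2) := by
    have := (hdC t).D_mul (j + 2)
    push_cast at this
    exact this
  rw [← mul_assoc, hVΩ, mul_assoc, add_mul, hD, mul_add, mul_assoc V, add_comm]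

theorem IsConst.mul {P Q : PseudoDiffOp (HolFun U)} (hP : ∀ n, 0 < n → P.coeff n = 0)
    (hQ : ∀ n, 0 < n → Q.coeff n = 0) (hdP : P.IsConst) (hdQ : Q.IsConst) :
    (P * Q).IsConst := by
  intro n
  rcases lt_or_ge 0 n with hn | hn
  · rw [mul_coeff_eq_zero hP hQ (by simpa using hn), map_zero]
  · obtain ⟨κ, rfl⟩ : ∃ κ : ℕ, n = -κ := ⟨(-n).toNat, by omega⟩
    rw [mul_coeff_of_deriv_eq_zero hP hQ hdQ, map_sum]
    refine sum_eq_zero fun ab _ => ?_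
    rw [Derivation.leibniz, hdP, hdQ, smul_zero, smul_zero, add_zero]

theorem hasOpTimeDerivAt_dressing (hV : V.IsMonicOrderZero) (hC : ∀ t, (C t).IsMonicOrderZero)
    (hdC : ∀ t, (C t).IsConst) (hΩ : ∀ j n, 0 < n → (Ω j).coeff n = 0)
    (hdΩ : ∀ j, (Ω j).IsConst) {t : ℕ → ℂ} {j : ℕ} (h : HasOpTimeDerivAt C (Ω j * C t) j t) :
    HasOpTimeDerivAt (fun t => V * C t) (V * (Ω j * C t)) j t :=
  hasOpTimeDerivAt_mul hV hC hdC
    (fun n hn => mul_coeff_eq_zero (hΩ j) (hC t).2 (by simpa using hn))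
    (IsConst.mul (hΩ j) (hC t).2 (hdΩ j) (hdC t)) h

/-- Under `toOp` the module of formal waves is the ring acting on itself from the left, with e^ξ
becoming 1 and λ becoming right multiplication by ∂. All assertions about ψ thus become identities
for V C. -/
theorem isWaveFunction_dressing (hV : V.IsMonicOrderZero) (hC : ∀ t, (C t).IsMonicOrderZero)
    (hdC : ∀ t, (C t).IsConst) (hΩ : ∀ j n, 0 < n → (Ω j).coeff n = 0)
    (hdΩ : ∀ j, (Ω j).IsConst)
    (hVΩ : ∀ j : ℕ, ((V * D 1 * V⁻¹) ^ (j + 2)).nonneg * V = V * (D ((j : ℤ) + 2) + Ω j))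
    (hCΩ : ∀ t ∈ entireTimes, ∀ j, HasOpTimeDerivAt C (Ω j * C t) j t) :
    IsWaveFunction (V * D 1 * V⁻¹) fun t => V • (C t • FormalWave.expXi) := by
  have hψ : ∀ t, (V • (C t • (FormalWave.expXi : FormalWave (HolFun U)))).toOp = V * C t := by
    intro t
    rw [FormalWave.toOp_smul, FormalWave.toOp_smul, FormalWave.toOp_expXi, mul_one]
  have hcoeff : ∀ t n, (V • (C t • (FormalWave.expXi : FormalWave (HolFun U)))).coeff n =
      (V * C t).coeff n := fun t n => by rw [← hψ]; rfl
  refine ⟨fun t _ => ?_, fun t _ n hn => ?_, fun t _ => ?_, fun t _ => ?_, fun t ht j m x => ?_⟩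
  · rw [hcoeff, (hV.mul (hC t)).1]
  · rw [hcoeff, (hV.mul (hC t)).2 n hn]
  · apply FormalWave.toOp_injective
    rw [FormalWave.toOp_smul, FormalWave.toOp_mulLambda, hψ, dressing_eq hV hdC]
  -- The flow of t₁ = x: the positive part of L is exactly ∂, because L has no ∂⁰ term.
  · congr 1
    have hL := hV.isLaxForm
    rw [pow_one]
    refine PseudoDiffOp.ext (funext fun n => ?_)
    simp only [D_coeff, nonneg]
    split_ifs with h1 h2 h2
    · rw [h1, hL.1]
    · omega
    · rcases (by omega : n = 0 ∨ 1 < n) with rfl | hn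
      · exact hL.2.1.symm
      · exact (hL.2.2 n hn).symm
    · rfl
  · refine ⟨((V * (Ω j * C t)).coeff m).1 x, ?_, ?_⟩
    · simp only [hcoeff]
      exact hasOpTimeDerivAt_dressing hV hC hdC hΩ hdΩ (hCΩ t ht j) m x
    · have h := congrArg (fun P => coeff P m) (dressing_nonneg_mul hdC hVΩ t j)
      simp only [add_coeff, mul_D_coeff] at h
      rw [hcoeff, ← HolFun.evalHom_apply, ← HolFun.evalHom_apply, ← HolFun.evalHom_apply,
        ← map_add, ← h, ← hψ]
      rfl

/-- The two forms of the Sato-Wilson equation agree because V C ∂ⁿ = Lⁿ V C and (Lⁿ)_{≥0} - Lⁿ =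
-(Lⁿ)_{<0}. -/
theorem isWaveOperator_dressing (hV : V.IsMonicOrderZero) (hC : ∀ t, (C t).IsMonicOrderZero)
    (hdC : ∀ t, (C t).IsConst) (hΩ : ∀ j n, 0 < n → (Ω j).coeff n = 0)
    (hdΩ : ∀ j, (Ω j).IsConst)
    (hVΩ : ∀ j : ℕ, ((V * D 1 * V⁻¹) ^ (j + 2)).nonneg * V = V * (D ((j : ℤ) + 2) + Ω j))
    (hCΩ : ∀ t ∈ entireTimes, ∀ j, HasOpTimeDerivAt C (Ω j * C t) j t) :
    IsWaveOperator (V * D 1 * V⁻¹) (fun t => V • (C t • FormalWave.expXi))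
      fun t => V * C t := by
  have hsw : ∀ t ∈ entireTimes, ∀ j : ℕ, HasOpTimeDerivAt (fun t => V * C t)
      (((V * D 1 * V⁻¹) ^ (j + 2)).nonneg * (V * C t) - V * C t * D ((j : ℤ) + 2)) j t := by
    intro t ht j
    rw [dressing_nonneg_mul hdC hVΩ, add_sub_cancel_right]
    exact hasOpTimeDerivAt_dressing hV hC hdC hΩ hdΩ (hCΩ t ht j)
  refine ⟨fun t _ => hV.mul (hC t), fun t _ => ?_, fun t _ => (hV.mul (hC t)).isInverse_inv,
    fun t _ => dressing_conj hV hC hdC t, hsw, fun t ht j => ?_⟩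
  · apply FormalWave.toOp_injective
    simp only [FormalWave.toOp_smul, FormalWave.toOp_expXi, mul_one]
  · have hpow := dressing_conj_pow hV hC hdC t (j + 2)
    have hD : V * C t * D ((j : ℤ) + 2) = (V * D 1 * V⁻¹) ^ (j + 2) * (V * C t) := by
      rw [← hpow, mul_assoc _ _ (V * C t), (hV.mul (hC t)).isInverse_inv.2, mul_one]
      push_cast
      rfl
    push_cast at hpow
    have h := hsw t ht j
    rw [hD, ← sub_mul] at h
    rw [hpow, ← neg_mul]
    have : ((V * D 1 * V⁻¹) ^ (j + 2)).nonneg - (V * D 1 * V⁻¹) ^ (j + 2) =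
        -((V * D 1 * V⁻¹) ^ (j + 2)).negPart := by
      nth_rewrite 2 [← nonneg_add_negPart ((V * D 1 * V⁻¹) ^ (j + 2))]
      abel
    rwa [this] at h

end Dressing

end PseudoDiffOp
end

/-! ### The Weierstrass product of σ -/

noncomputable section

open Filter Topology

/-- The exponential is chosen so that the derivative of the factor is -u² times an exponential; the
mean value inequality on the disc of radius ‖w‖ then gives a cubic bound, which matches the
convergence of ∑ ‖l‖⁻³. The exponent has modulus at most 3/2 there, whence the crude constant exp 2.
-/
theorem Complex.norm_weierstrassFactor_sub_one_le {w : ℂ} (hw : ‖w‖ ≤ 1) :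
    ‖(1 - w) * Complex.exp (w + w ^ 2 / 2) - 1‖ ≤ Real.exp 2 * ‖w‖ ^ 3 := by
  have hd : ∀ u : ℂ, HasDerivAt (fun u => (1 - u) * Complex.exp (u + u ^ 2 / 2))
      (-u ^ 2 * Complex.exp (u + u ^ 2 / 2)) u := by
    intro u
    have h1 : HasDerivAt (fun u : ℂ => u + u ^ 2 / 2) (1 + u) u := by
      have := (hasDerivAt_id u).add (((hasDerivAt_id u).pow 2).div_const 2)
      refine this.congr_deriv ?_
      simp
    refine (((hasDerivAt_const u (1 : ℂ)).sub (hasDerivAt_id u)).mul h1.cexp).congr_deriv ?_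
    simp
    ring
  have hb : ∀ u ∈ Metric.closedBall (0 : ℂ) ‖w‖,
      ‖-u ^ 2 * Complex.exp (u + u ^ 2 / 2)‖ ≤ Real.exp 2 * ‖w‖ ^ 2 := by
    intro u hu
    have hu : ‖u‖ ≤ ‖w‖ := by simpa using hu
    rw [norm_mul, norm_neg, norm_pow, Complex.norm_exp, mul_comm]
    have h2 : (u + u ^ 2 / 2).re ≤ 2 := by
      refine (Complex.re_le_norm _).trans ((norm_add_le _ _).trans ?_)
      rw [norm_div, norm_pow]
      have : ‖u‖ ≤ 1 := hu.trans hw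
      have h3 : ‖u‖ ^ 2 ≤ 1 := pow_le_one₀ (norm_nonneg _) this
      simp only [Complex.norm_ofNat]
      linarith
    gcongr
  have h := (convex_closedBall (0 : ℂ) ‖w‖).norm_image_sub_le_of_norm_hasDerivWithin_le
    (fun u _ => (hd u).hasDerivWithinAt) hb (x := 0) (y := w) (by simp) (by simp)
  simp only [sub_zero, one_mul, ne_eq, OfNat.ofNat_ne_zero, not_false_eq_true, zero_pow,
    zero_div, add_zero, Complex.exp_zero] at h
  calc _ ≤ _ := h
    _ = _ := by ring

namespace PeriodPair

variable (L : PeriodPair)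

/-- The factors of the Weierstrass product of `σ`. -/
def sigmaFactor (l z : ℂ) : ℂ := (1 - z / l) * Complex.exp (z / l + z ^ 2 / (2 * l ^ 2))

/-- `σ(z) / z`. -/
def sigmaProd (z : ℂ) : ℂ := ∏' l : {l : L.lattice // l ≠ 0}, sigmaFactor l z

theorem sigma_eq (z : ℂ) : L.sigma z = z * L.sigmaProd z := rfl

theorem norm_sigmaFactor_sub_one_le {l z : ℂ} {r : ℝ} (hz : ‖z‖ ≤ r) (hl : r ≤ ‖l‖)
    (hl0 : l ≠ 0) : ‖sigmaFactor l z - 1‖ ≤ Real.exp 2 * r ^ 3 * ‖l‖⁻¹ ^ 3 := by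
  have hpos : 0 < ‖l‖ := norm_pos_iff.mpr hl0
  have e : z ^ 2 / (2 * l ^ 2) = (z / l) ^ 2 / 2 := by field_simp
  have hw : ‖z / l‖ ≤ 1 := by
    rw [norm_div, div_le_one hpos]
    exact hz.trans hl
  rw [sigmaFactor, e]
  refine (Complex.norm_weierstrassFactor_sub_one_le hw).trans ?_
  rw [norm_div, div_eq_mul_inv, mul_pow, mul_assoc]
  gcongr

theorem summable_sigmaBound (r : ℝ) : Summable fun l : {l : L.lattice // l ≠ 0} =>
    Real.exp 2 * r ^ 3 * ‖(l : ℂ)‖⁻¹ ^ 3 := by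
  have h := ZLattice.summable_norm_pow_inv L.lattice 3 (by simp)
  exact (h.comp_injective Subtype.val_injective).mul_left _

theorem finite_lattice_norm_lt (r : ℝ) : {l : {l : L.lattice // l ≠ 0} | ‖(l : ℂ)‖ < r}.Finite := by
  have h := isCompact_iff_finite.mp (isCompact_closedBall (0 : L.lattice) r)
  refine Set.Finite.of_finite_image (f := Subtype.val) (h.subset ?_)
    Subtype.val_injective.injOn
  rintro _ ⟨l, hl, rfl⟩
  have hl : ‖(l : ℂ)‖ < r := hl
  simpa using hl.le

theorem eventually_norm_sigmaFactor_le (r : ℝ) :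
    ∀ᶠ l : {l : L.lattice // l ≠ 0} in cofinite, ∀ z ∈ Metric.ball (0 : ℂ) r,
      ‖sigmaFactor l z - 1‖ ≤ Real.exp 2 * r ^ 3 * ‖(l : ℂ)‖⁻¹ ^ 3 := by
  filter_upwards [(L.finite_lattice_norm_lt r).compl_mem_cofinite] with l hl z hz
  refine norm_sigmaFactor_sub_one_le (by simpa using (Metric.mem_ball.mp hz).le)
    (by simpa using hl) ?_
  simpa using l.2

theorem differentiable_sigmaFactor (l : ℂ) : Differentiable ℂ (sigmaFactor l) := by
  unfold sigmaFactor
  fun_prop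

theorem hasProdLocallyUniformlyOn_sigmaFactor (r : ℝ) :
    HasProdLocallyUniformlyOn (fun (l : {l : L.lattice // l ≠ 0}) z => sigmaFactor l z)
      L.sigmaProd (Metric.ball 0 r) := by
  have h := (L.summable_sigmaBound r).hasProdLocallyUniformlyOn_one_add
    (f := fun (l : {l : L.lattice // l ≠ 0}) z => sigmaFactor l z - 1) Metric.isOpen_ball
    (L.eventually_norm_sigmaFactor_le r)
    (fun l => ((differentiable_sigmaFactor l).continuous.sub continuous_const).continuousOn)
  simp only [add_sub_cancel] at h
  exact h

theorem differentiable_sigmaProd : Differentiable ℂ L.sigmaProd := by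
  intro z
  have h : DifferentiableOn ℂ L.sigmaProd (Metric.ball 0 (‖z‖ + 1)) :=
    (hasProdLocallyUniformlyOn_iff_tendstoLocallyUniformlyOn.mp
      (L.hasProdLocallyUniformlyOn_sigmaFactor _)).differentiableOn
      (.of_forall fun s => DifferentiableOn.fun_finsetProd fun l _ =>
        (differentiable_sigmaFactor l).differentiableOn) Metric.isOpen_ball
  exact h.differentiableAt (Metric.isOpen_ball.mem_nhds (by simp))

theorem differentiable_sigma : Differentiable ℂ L.sigma :=
  differentiable_id.mul L.differentiable_sigmaProd

theorem sigmaFactor_ne_zero {l z : ℂ} (hl : l ≠ 0) (hz : z ≠ l) : sigmaFactor l z ≠ 0 := by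
  refine mul_ne_zero ?_ (Complex.exp_ne_zero _)
  rw [sub_ne_zero, ne_comm, Ne, div_eq_one_iff_eq hl]
  exact hz

theorem sigmaProd_ne_zero {z : ℂ} (hz : ∀ l ∈ L.lattice, l ≠ 0 → z ≠ l) : L.sigmaProd z ≠ 0 := by
  have h := tprod_one_add_ne_zero_of_summable
    (f := fun l : {l : L.lattice // l ≠ 0} => sigmaFactor l z - 1)
    (fun l => by
      rw [add_sub_cancel]
      have hl : (l : ℂ) ≠ 0 := by simpa using l.2
      exact sigmaFactor_ne_zero hl (hz _ l.1.2 hl)) ?_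
  · simp only [add_sub_cancel] at h
    exact h
  · refine Summable.of_norm_bounded_eventually (L.summable_sigmaBound (‖z‖ + 1)) ?_
    filter_upwards [L.eventually_norm_sigmaFactor_le (‖z‖ + 1)] with l hl
    rw [norm_norm]
    exact hl z (by simp)

theorem sigma_ne_zero {z : ℂ} (hz : z ∉ L.lattice) : L.sigma z ≠ 0 := by
  refine mul_ne_zero (fun h => hz (h ▸ zero_mem _)) (L.sigmaProd_ne_zero ?_)
  rintro l hl - rfl
  exact hz hl

theorem sigma_eq_zero {z : ℂ} (hz : z ∈ L.lattice) : L.sigma z = 0 := by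
  rw [sigma_eq]
  by_cases h0 : z = 0
  · rw [h0, zero_mul]
  · rw [sigmaProd, tprod_of_exists_eq_zero, mul_zero]
    refine ⟨⟨⟨z, hz⟩, fun h => h0 (congrArg Subtype.val h)⟩, ?_⟩
    simp [sigmaFactor, h0]

theorem sigmaProd_zero_ne_zero : L.sigmaProd 0 ≠ 0 :=
  L.sigmaProd_ne_zero fun _ _ hl => hl.symm

/-! ### The Weierstrass `ζ`-function -/

/-- `ζ(z) - 1/z`. -/
def zetaExcept (z : ℂ) : ℂ :=
  ∑' l : L.lattice, if l.1 = 0 then 0 else 1 / (z - l) + 1 / l + z / l ^ 2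

theorem norm_zetaTerm_le {r : ℝ} {s l : ℂ} (hr : 0 < r) (hs : ‖s‖ < r) (hl : 2 * r ≤ ‖l‖) :
    ‖1 / (s - l) + 1 / l + s / l ^ 2‖ ≤ 2 * r ^ 2 * ‖l‖⁻¹ ^ 3 := by
  have hpos : 0 < ‖l‖ := by linarith
  have hl0 : l ≠ 0 := norm_pos_iff.mp hpos
  have h1 : ‖l‖ / 2 ≤ ‖s - l‖ := by
    rw [norm_sub_rev]
    exact .trans (by linarith) (norm_sub_norm_le l s)
  have hsl : s - l ≠ 0 := norm_pos_iff.mp (by linarith)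
  have e : 1 / (s - l) + 1 / l + s / l ^ 2 = s ^ 2 / (l ^ 2 * (s - l)) := by
    field_simp
    ring
  rw [e, norm_div, norm_mul, norm_pow, norm_pow]
  calc ‖s‖ ^ 2 / (‖l‖ ^ 2 * ‖s - l‖) ≤ r ^ 2 / (‖l‖ ^ 2 * (‖l‖ / 2)) := by gcongr
    _ = _ := by field_simp

theorem hasSumLocallyUniformly_zetaExcept :
    HasSumLocallyUniformly (fun (l : L.lattice) (z : ℂ) =>
      if l.1 = 0 then 0 else 1 / (z - l) + 1 / l + z / l ^ 2) L.zetaExcept := by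
  refine L.hasSumLocallyUniformly_aux (u := fun r l => 2 * r ^ 2 * ‖(l : ℂ)‖⁻¹ ^ 3) _
    (fun r _ => (ZLattice.summable_norm_pow_inv L.lattice 3 (by simp)).mul_left _) fun r hr =>
    eventually_atTop.mpr ⟨2 * r, ?_⟩
  rintro R h s hs l rfl
  split_ifs
  · rw [norm_zero]
    positivity
  · exact norm_zetaTerm_le hr hs h

theorem differentiableOn_zetaTerm (l : L.lattice) :
    DifferentiableOn ℂ (fun z : ℂ => if l.1 = 0 then 0 else 1 / (z - l) + 1 / l + z / l ^ 2)
      (L.lattice \ {0})ᶜ := by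
  split_ifs with h
  · simp
  · refine ((DifferentiableOn.div (by fun_prop) (by fun_prop) fun x hx => ?_).add
      (by fun_prop)).add (by fun_prop)
    have : x ≠ l := by rintro rfl; simp_all
    simpa [sub_eq_zero]

theorem differentiableOn_zetaExcept : DifferentiableOn ℂ L.zetaExcept (L.lattice \ {0})ᶜ :=
  L.hasSumLocallyUniformly_zetaExcept.hasSumLocallyUniformlyOn.differentiableOn
    (.of_forall fun _ => .fun_sum fun i _ => L.differentiableOn_zetaTerm i)
    L.isOpen_compl_lattice_sdiff

theorem deriv_zetaExcept {z : ℂ} (hz : z ∈ (L.lattice \ {0} : Set ℂ)ᶜ) :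
    deriv L.zetaExcept z = -L.weierstrassPExcept 0 z := by
  have h := (L.hasSumLocallyUniformly_zetaExcept.tendstoLocallyUniformlyOn
    (s := (L.lattice \ {0})ᶜ)).deriv (.of_forall fun _ => .fun_sum fun i _ =>
      L.differentiableOn_zetaTerm i) L.isOpen_compl_lattice_sdiff
  have h2 : HasSum (fun l : L.lattice => deriv (fun z : ℂ => if l.1 = 0 then 0 else
      1 / (z - l) + 1 / l + z / l ^ 2) z) (deriv L.zetaExcept z) := by
    rw [HasSum]
    convert! h.tendsto_at hz using 1
    ext1 s
    exact (deriv_fun_sum fun i _ => (L.differentiableOn_zetaTerm i).differentiableAt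
      (L.isOpen_compl_lattice_sdiff.mem_nhds hz)).symm
  refine h2.unique ?_
  have h4 : (fun l : L.lattice => deriv (fun z : ℂ => if l.1 = 0 then 0 else
      1 / (z - l) + 1 / l + z / l ^ 2) z) =
      fun l : L.lattice => -(if (l : ℂ) = 0 then 0 else (1 / (z - l) ^ 2 - 1 / (l : ℂ) ^ 2)) := by
    funext l
    split_ifs with hl
    · simp
    · have hzl : z - l ≠ 0 := fun e => by
        obtain rfl := sub_eq_zero.mp e
        simp_all
      have h1 : HasDerivAt (fun z : ℂ => 1 / (z - l) + 1 / l + z / l ^ 2)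
          (-1 / (z - l) ^ 2 + 1 / (l : ℂ) ^ 2) z := by
        have h3 : HasDerivAt (fun z : ℂ => (z - l)⁻¹) (-1 / (z - l) ^ 2) z :=
          ((hasDerivAt_id z).sub_const (l : ℂ)).fun_inv hzl
        have h5 : HasDerivAt (fun z : ℂ => z / (l : ℂ) ^ 2) (1 / (l : ℂ) ^ 2) z :=
          (hasDerivAt_id z).div_const ((l : ℂ) ^ 2)
        simpa only [one_div] using (h3.add_const (1 / (l : ℂ))).fun_add h5
      rw [h1.deriv]
      ring
  rw [h4]
  exact (L.hasSum_weierstrassPExcept 0 z).neg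

theorem logDeriv_sigmaFactor {l z : ℂ} (hl : l ≠ 0) (hz : z ≠ l) :
    logDeriv (sigmaFactor l) z = 1 / (z - l) + 1 / l + z / l ^ 2 := by
  have hzl : z - l ≠ 0 := sub_ne_zero.mpr hz
  have hlz : l - z ≠ 0 := sub_ne_zero.mpr hz.symm
  have h1 : HasDerivAt (fun z => z / l + z ^ 2 / (2 * l ^ 2)) (1 / l + z / l ^ 2) z := by
    refine (((hasDerivAt_id z).div_const l).add
      (((hasDerivAt_id z).pow 2).div_const (2 * l ^ 2))).congr_deriv ?_
    simp
    field_simp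
  have h2 : HasDerivAt (fun z => 1 - z / l) (-(1 / l)) z :=
    ((hasDerivAt_id z).div_const l).const_sub 1
  have h3 := (h2.mul h1.cexp).deriv
  have h4 : sigmaFactor l = (fun z => 1 - z / l) * fun z =>
    Complex.exp (z / l + z ^ 2 / (2 * l ^ 2)) := rfl
  rw [logDeriv_apply, h4, h3, Pi.mul_apply]
  have h5 : 1 - z / l ≠ 0 := by
    rw [sub_ne_zero, ne_comm, Ne, div_eq_one_iff_eq hl]
    exact hz
  have := Complex.exp_ne_zero (z / l + z ^ 2 / (2 * l ^ 2))
  generalize Complex.exp (z / l + z ^ 2 / (2 * l ^ 2)) = E at *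
  have h6 : 1 - z / l = (l - z) / l := by field_simp
  rw [h6]
  field_simp
  ring

theorem logDeriv_sigmaProd {z : ℂ} (hz : z ∉ (L.lattice \ {0} : Set ℂ)) :
    logDeriv L.sigmaProd z = L.zetaExcept z := by
  have hne : ∀ l : {l : L.lattice // l ≠ 0}, (l : ℂ) ≠ 0 ∧ z ≠ l := by
    intro l
    have h0 : (l : ℂ) ≠ 0 := by simpa using l.2
    exact ⟨h0, fun h => hz ⟨h ▸ l.1.2, by simpa [h] using h0⟩⟩
  have hs := L.hasSumLocallyUniformly_zetaExcept.hasSum (x := z)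
  have hs' : HasSum (fun l : {l : L.lattice // l ≠ 0} => logDeriv (sigmaFactor l) z)
      (L.zetaExcept z) := by
    have : ∀ l : {l : L.lattice // l ≠ 0}, logDeriv (sigmaFactor l) z =
        (fun l : L.lattice => if l.1 = 0 then 0 else 1 / (z - l) + 1 / l + z / l ^ 2) l := by
      intro l
      rw [logDeriv_sigmaFactor (hne l).1 (hne l).2]
      exact (if_neg (hne l).1).symm
    simp only [this]
    refine (hasSum_subtype_iff_of_support_subset (s := {l : L.lattice | l ≠ 0}) ?_).mpr hs
    intro l hl h0
    apply hl
    have h0 : l = 0 := h0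
    simp [h0]
  have h := logDeriv_tprod_eq_tsum (s := Metric.ball (0 : ℂ) (‖z‖ + 1)) Metric.isOpen_ball
    (x := z) (by simp) (f := fun (l : {l : L.lattice // l ≠ 0}) z => sigmaFactor l z)
    (fun l => sigmaFactor_ne_zero (hne l).1 (hne l).2)
    (fun l => (differentiable_sigmaFactor l).differentiableOn) hs'.summable
    (L.hasProdLocallyUniformlyOn_sigmaFactor _).multipliableLocallyUniformlyOn
    (L.sigmaProd_ne_zero fun l hl h0 h => hz ⟨h ▸ hl, by simpa [h] using h0⟩)
  exact h.trans hs'.tsum_eq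

theorem zeta_eq {z : ℂ} (hz : z ∉ L.lattice) : L.zeta z = 1 / z + L.zetaExcept z := by
  have h0 : z ≠ 0 := fun h => hz (h ▸ zero_mem _)
  have hP : L.sigmaProd z ≠ 0 := L.sigmaProd_ne_zero (by rintro l hl - rfl; exact hz hl)
  have h1 : L.sigma = fun z => id z * L.sigmaProd z := rfl
  have h2 : logDeriv L.sigma z = L.zeta z := rfl
  rw [← h2, h1, logDeriv_mul z h0 hP differentiableAt_id (L.differentiable_sigmaProd z),
    logDeriv_sigmaProd L fun h => hz h.1, logDeriv_id]

/-- The point z = 0, that is λ = ∞, is included: there σ vanishes, so ζ 0 and 1 / 0 are both 0 by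
convention, in agreement with the regular series, whose terms all vanish at 0. -/
theorem zeta_sub_inv {z : ℂ} (hz : z ∉ (L.lattice \ {0} : Set ℂ)) :
    L.zeta z - 1 / z = L.zetaExcept z := by
  by_cases h0 : z = 0
  · subst h0
    simp [zeta, L.sigma_eq_zero (zero_mem _), zetaExcept]
  · have : z ∉ L.lattice := fun h => hz ⟨h, h0⟩
    rw [L.zeta_eq this, add_sub_cancel_left]

end PeriodPair
end

/-! ### Quasi-periodicity of ζ and σ -/

noncomputable section

open Filter Topology

namespace PeriodPair

variable (L : PeriodPair)

theorem isPreconnected_compl_lattice : IsPreconnected (L.lattice : Set ℂ)ᶜ := by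
  have h : (L.lattice : Set ℂ).Countable := Set.countable_coe_iff.mp
    (inferInstanceAs (Countable L.lattice))
  exact (h.isConnected_compl_of_one_lt_rank (by simp)).isPreconnected

theorem isOpen_compl_lattice : IsOpen (L.lattice : Set ℂ)ᶜ := L.isClosed_lattice.isOpen_compl

theorem hasDerivAt_zeta {z : ℂ} (hz : z ∉ L.lattice) : HasDerivAt L.zeta (-L.weierstrassP z) z := by
  have h0 : z ≠ 0 := fun h => hz (h ▸ zero_mem _)
  have hz' : z ∈ (L.lattice \ {0} : Set ℂ)ᶜ := fun h => hz h.1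
  have h1 : L.zeta =ᶠ[𝓝 z] fun z => z⁻¹ + L.zetaExcept z := by
    filter_upwards [L.isOpen_compl_lattice.mem_nhds hz] with w hw
    rw [L.zeta_eq hw, one_div]
  have h2 : HasDerivAt L.zetaExcept (-L.weierstrassPExcept 0 z) z := by
    rw [← L.deriv_zetaExcept hz']
    exact (L.differentiableOn_zetaExcept.differentiableAt
      (L.isOpen_compl_lattice_sdiff.mem_nhds hz')).hasDerivAt
  refine (((hasDerivAt_inv h0).fun_add h2).congr_of_eventuallyEq h1).congr_deriv ?_
  have := L.weierstrassPExcept_def 0 z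
  simp only [ZeroMemClass.coe_zero] at this
  rw [this]
  simp

theorem add_mem_lattice_iff {z w : ℂ} (hw : w ∈ L.lattice) : z + w ∈ L.lattice ↔ z ∈ L.lattice :=
  L.lattice.add_mem_iff_left hw

theorem exists_zeta_add {w : ℂ} (hw : w ∈ L.lattice) :
    ∃ η : ℂ, ∀ z ∉ L.lattice, L.zeta (z + w) = L.zeta z + η := by
  have hd : ∀ z ∉ L.lattice, HasDerivAt (fun z => L.zeta (z + w)) (-L.weierstrassP z) z := by
    intro z hz
    have h := (L.hasDerivAt_zeta (mt (L.add_mem_lattice_iff hw).mp hz)).comp_add_const z w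
    rwa [L.weierstrassP_add_coe z ⟨w, hw⟩] at h
  obtain ⟨η, h⟩ := L.isOpen_compl_lattice.exists_eq_add_of_deriv_eq L.isPreconnected_compl_lattice
    (fun z hz => (hd z hz).differentiableAt.differentiableWithinAt)
    (fun z hz => (L.hasDerivAt_zeta hz).differentiableAt.differentiableWithinAt)
    (fun z hz => by rw [(hd z hz).deriv, (L.hasDerivAt_zeta hz).deriv])
  exact ⟨η, h⟩

/-- Integrate the periodicity of ℘ twice on the connected complement of the lattice: first ζ' = -℘
gives η, then equality of the logarithmic derivatives of σ(z+w) and e^{ηz}σ(z) gives c. At lattice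
points both sides vanish. -/
theorem exists_quasiPeriod {w : ℂ} (hw : w ∈ L.lattice) : ∃ η c : ℂ, c ≠ 0 ∧
    (∀ z ∉ L.lattice, L.zeta (z + w) = L.zeta z + η) ∧
    ∀ z, L.sigma (z + w) = c * Complex.exp (η * z) * L.sigma z := by
  obtain ⟨η, hη⟩ := L.exists_zeta_add hw
  have hexp : Differentiable ℂ fun z => Complex.exp (η * z) := by fun_prop
  have h := (logDeriv_eqOn_iff (f := fun z => L.sigma (z + w))
    (g := fun z => Complex.exp (η * z) * L.sigma z) (s := (L.lattice : Set ℂ)ᶜ)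
    (L.differentiable_sigma.comp (differentiable_id.add_const w)).differentiableOn
    (hexp.mul L.differentiable_sigma).differentiableOn
    L.isOpen_compl_lattice L.isPreconnected_compl_lattice
    (fun z hz => mul_ne_zero (Complex.exp_ne_zero _) (L.sigma_ne_zero hz))
    (fun z hz => L.sigma_ne_zero (mt (L.add_mem_lattice_iff hw).mp hz))).mp ?_
  · obtain ⟨c, hc, h⟩ := h
    refine ⟨η, c, hc, hη, fun z => ?_⟩
    by_cases hz : z ∈ L.lattice
    · rw [L.sigma_eq_zero hz, L.sigma_eq_zero ((L.add_mem_lattice_iff hw).mpr hz), mul_zero]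
    · rw [mul_assoc]
      exact h hz
  · intro z hz
    have h1 : logDeriv (fun z => L.sigma (z + w)) z = L.zeta (z + w) := by
      rw [logDeriv_apply, deriv_comp_add_const]
      rfl
    have h2 : logDeriv (fun z => Complex.exp (η * z)) z = η := by
      have : HasDerivAt (fun z => Complex.exp (η * z)) (Complex.exp (η * z) * η) z := by
        simpa using ((hasDerivAt_id z).const_mul η).cexp
      rw [logDeriv_apply, this.deriv, mul_div_cancel_left₀ _ (Complex.exp_ne_zero _)]
    rw [h1, logDeriv_mul (f := fun z => Complex.exp (η * z)) z (Complex.exp_ne_zero _) (L.sigma_ne_zero hz) (hexp z)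
      (L.differentiable_sigma z), h2, hη z hz, add_comm]
    rfl

/-! ### Elliptic functions with at most one simple pole -/

/-- `f` is periodic with respect to the lattice, up to a discrete set. -/
def IsAlmostPeriodic (f : ℂ → ℂ) : Prop :=
  ∀ w ∈ L.lattice, ∀ z, (fun u => f (u + w)) =ᶠ[𝓝[≠] z] f

variable {L}

theorem map_add_nhdsNE (z w : ℂ) : Tendsto (fun u => u + w) (𝓝[≠] z) (𝓝[≠] (z + w)) :=
  tendsto_nhdsWithin_of_tendsto_nhds_of_eventually_within _
    ((continuous_id.add continuous_const).tendsto' z _ rfl |>.mono_left nhdsWithin_le_nhds)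
    (by filter_upwards [self_mem_nhdsWithin] with u hu; simpa using hu)

theorem map_neg_nhdsNE (z : ℂ) : Tendsto (fun u => -u) (𝓝[≠] z) (𝓝[≠] (-z)) :=
  tendsto_nhdsWithin_of_tendsto_nhds_of_eventually_within _
    (continuous_neg.tendsto z |>.mono_left nhdsWithin_le_nhds)
    (by filter_upwards [self_mem_nhdsWithin] with u hu; simpa using hu)

theorem IsAlmostPeriodic.order_add {f : ℂ → ℂ} (hf : L.IsAlmostPeriodic f) {w : ℂ}
    (hw : w ∈ L.lattice) (z : ℂ) : meromorphicOrderAt f (z + w) = meromorphicOrderAt f z := by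
  rw [← meromorphicOrderAt_congr (hf w hw z)]
  exact meromorphicOrderAt_comp_add_const_eq_meromorphicOrderAt.symm

/-- Liouville's theorem after filling in removable singularities: the normal form is entire, truly
periodic by continuity, and therefore bounded. Equalities are on punctured neighbourhoods because
the given f may have arbitrary values at isolated points. -/
theorem IsAlmostPeriodic.exists_eq_const {f : ℂ → ℂ} (hf : L.IsAlmostPeriodic f)
    (hm : Meromorphic f) (ho : ∀ z, 0 ≤ meromorphicOrderAt f z) :
    ∃ c, ∀ z, f =ᶠ[𝓝[≠] z] fun _ => c := by
  have hm' : MeromorphicOn f Set.univ := fun z _ => hm z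
  set g := toMeromorphicNFOn f Set.univ
  have hfg : ∀ z, f =ᶠ[𝓝[≠] z] g := fun z =>
    hm'.toMeromorphicNFOn_eq_self_on_nhdsNE (Set.mem_univ z) |>.symm
  have hg : ∀ z, AnalyticAt ℂ g z := fun z =>
    (meromorphicNFOn_toMeromorphicNFOn f Set.univ
      (Set.mem_univ z)).meromorphicOrderAt_nonneg_iff_analyticAt.mp
      (by rw [meromorphicOrderAt_toMeromorphicNFOn hm' trivial]; exact ho z)
  have hgd : Differentiable ℂ g := fun z => (hg z).differentiableAt
  have hper : ∀ z w, w ∈ L.lattice → g (z + w) = g z := by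
    intro z w hw
    have h1 : (fun u => g (u + w)) =ᶠ[𝓝[≠] z] g := by
      filter_upwards [hf w hw z, hfg z, (map_add_nhdsNE z w).eventually (hfg (z + w))]
        with u h1 h2 h3
      rw [← h3, h1, h2]
    have h2 : Tendsto (fun u => g (u + w)) (𝓝[≠] z) (𝓝 (g (z + w))) :=
      ((hgd.continuous.comp (continuous_id.add continuous_const)).tendsto z).mono_left
        nhdsWithin_le_nhds
    exact tendsto_nhds_unique (h2.congr' h1)
      ((hgd.continuous.tendsto z).mono_left nhdsWithin_le_nhds)
  refine ⟨g 0, fun z => (hfg z).trans (Eventually.of_forall fun u => ?_)⟩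
  exact hgd.apply_eq_apply_of_bounded (IsZLattice.isCompact_range_of_periodic L.lattice _
    hgd.continuous fun z w hw => hper z w hw).isBounded u 0

theorem one_le_of_pos_withTop {a : WithTop ℤ} (h : 0 < a) : 1 ≤ a := by
  induction a using WithTop.recTopCoe with
  | top => exact le_top
  | coe a =>
    have h1 : (0 : ℤ) < a := by exact_mod_cast h
    have h2 : (1 : ℤ) ≤ a := h1
    exact_mod_cast h2

theorem nonneg_of_one_add_pos {a : WithTop ℤ} (h : 0 < 1 + a) : 0 ≤ a := by
  induction a using WithTop.recTopCoe with
  | top => exact le_top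
  | coe a =>
    norm_cast at h ⊢
    omega

theorem nonneg_one_add {a : WithTop ℤ} (h : -1 ≤ a) : 0 ≤ 1 + a := by
  induction a using WithTop.recTopCoe with
  | top => exact le_top
  | coe a =>
    have : (-1 : ℤ) ≤ a := WithTop.coe_le_coe.mp h
    have h' : 0 ≤ 1 + a := by omega
    exact_mod_cast h'

theorem add_nonneg_withTop {a b : WithTop ℤ} (ha : -1 ≤ a) (hb : 1 ≤ b) : 0 ≤ a + b := by
  rw [add_comm]
  exact (nonneg_one_add ha).trans (by gcongr)

theorem order_sub_const {f : ℂ → ℂ} {z : ℂ} (hf : MeromorphicAt f z) (c : ℂ) {m : WithTop ℤ}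
    (hm : m ≤ 0) (h : m ≤ meromorphicOrderAt f z) :
    m ≤ meromorphicOrderAt (fun u => f u - c) z := by
  have h1 : (fun u => f u - c) = f + fun _ => -c := by
    funext u
    simp [sub_eq_add_neg]
  have h2 : MeromorphicAt (fun _ : ℂ => -c) z := MeromorphicAt.const _ _
  have h3 : 0 ≤ meromorphicOrderAt (fun _ : ℂ => -c) z :=
    AnalyticAt.meromorphicOrderAt_nonneg analyticAt_const
  rw [h1]
  exact (le_min h (hm.trans h3)).trans (meromorphicOrderAt_add hf h2)

/-- An odd function without pole at a half period has a zero there. -/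
theorem IsAlmostPeriodic.order_half_pos {G : ℂ → ℂ} (hG : L.IsAlmostPeriodic G)
    (hm : Meromorphic G) (hodd : ∀ z, (fun u => G (-u)) =ᶠ[𝓝[≠] z] fun u => -G u) {h : ℂ}
    (hh : h + h ∈ L.lattice) (ho : 0 ≤ meromorphicOrderAt G h) :
    1 ≤ meromorphicOrderAt G h := by
  apply one_le_of_pos_withTop
  rw [← tendsto_zero_iff_meromorphicOrderAt_pos (hm h)]
  obtain ⟨l, hl⟩ := tendsto_nhds_of_meromorphicOrderAt_nonneg (hm h) ho
  have h1 : Tendsto (fun u => -u + (h + h)) (𝓝[≠] h) (𝓝[≠] h) := by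
    have := (map_add_nhdsNE (-h) (h + h)).comp (map_neg_nhdsNE h)
    rwa [neg_add_cancel_left] at this
  have h2 : Tendsto (fun u => -G u) (𝓝[≠] h) (𝓝 l) := by
    refine (hl.comp h1).congr' ?_
    filter_upwards [hodd h, (map_neg_nhdsNE h).eventually (hG _ hh (-h))] with u h3 h4
    rw [← h3, ← h4]
    rfl
  have h5 : l = -l := tendsto_nhds_unique h2 hl.neg
  have h6 : l = 0 := by
    linear_combination (1 / 2 : ℂ) * h5
  rwa [h6] at hl

theorem half_add_half_notMem_lattice (L : PeriodPair) : L.ω₂ / 2 + L.ω₁ / 2 ∉ L.lattice := by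
  simpa [inv_mul_eq_div, add_comm] using
    (L.mul_ω₁_add_mul_ω₂_mem_lattice (α := 1 / 2) (β := 1 / 2)).not.mpr (by norm_num)

/-- A substitute for the residue theorem. With h = ω₁/2, in G(u)G(u+h) the simple pole of one factor
at a lattice point meets the zero of the other at the half period h, so the product is constant. It
vanishes at ω₂/2, where G is zero and the second factor is regular, since (ω₁+ω₂)/2 is not a period.
-/
theorem IsAlmostPeriodic.eq_zero_of_odd {G : ℂ → ℂ} (hG : L.IsAlmostPeriodic G)
    (hm : Meromorphic G) (hodd : ∀ z, (fun u => G (-u)) =ᶠ[𝓝[≠] z] fun u => -G u)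
    (ho : ∀ z ∉ L.lattice, 0 ≤ meromorphicOrderAt G z) (ho0 : -1 ≤ meromorphicOrderAt G 0)
    (z : ℂ) : G =ᶠ[𝓝[≠] z] fun _ => 0 := by
  set h := L.ω₁ / 2 with hh
  have h2h : h + h ∈ L.lattice := by
    rw [hh, add_halves]
    exact L.ω₁_mem_lattice
  have hl : ∀ z ∈ L.lattice, -1 ≤ meromorphicOrderAt G z := fun z hz => by
    have := hG.order_add hz 0
    rw [zero_add] at this
    rwa [this]
  have hh1 := hG.order_half_pos hm hodd h2h (ho _ L.ω₁_div_two_notMem_lattice)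
  have hh2 := hG.order_half_pos hm hodd (h := L.ω₂ / 2)
    (by rw [add_halves]; exact L.ω₂_mem_lattice) (ho _ L.ω₂_div_two_notMem_lattice)
  have hm' : Meromorphic fun u => G (u + h) := fun z =>
    (hm (z + h)).comp_analyticAt (g := fun u => u + h) (by fun_prop)
  have hord : ∀ z, meromorphicOrderAt (fun u => G (u + h)) z = meromorphicOrderAt G (z + h) :=
    fun z => meromorphicOrderAt_comp_add_const_eq_meromorphicOrderAt
  have hmul : ∀ z, meromorphicOrderAt (G * fun u => G (u + h)) z =
      meromorphicOrderAt G z + meromorphicOrderAt G (z + h) := fun z => by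
    rw [meromorphicOrderAt_mul (hm z) (hm' z), hord]
  obtain ⟨c, hc⟩ := IsAlmostPeriodic.exists_eq_const (L := L) (f := G * fun u => G (u + h))
    (fun w hw z => by
      filter_upwards [hG w hw z, (map_add_nhdsNE z h).eventually (hG w hw (z + h))] with u h1 h2
      simp only [Pi.mul_apply]
      rw [h1, ← h2, add_right_comm])
    (fun z => (hm z).mul (hm' z)) (fun z => by
      rw [hmul]
      by_cases hz : z ∈ L.lattice
      · refine add_nonneg_withTop (hl z hz) ?_
        rwa [add_comm, hG.order_add hz]
      by_cases hz' : z + h ∈ L.lattice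
      · rw [add_comm]
        refine add_nonneg_withTop (hl _ hz') ?_
        -- Since 2h is a period, z + h in the lattice puts z in the class of h, where G vanishes.
        have : z = h + (z + h - (h + h)) := by ring
        rw [this, hG.order_add (sub_mem hz' h2h)]
        exact hh1
      · exact add_nonneg (ho z hz) (ho _ hz'))
  have hc0 : c = 0 := by
    have h1 : 0 < meromorphicOrderAt (G * fun u => G (u + h)) (L.ω₂ / 2) := by
      rw [hmul]
      exact lt_of_lt_of_le zero_lt_one (hh2.trans
        (le_add_of_nonneg_right (ho _ L.half_add_half_notMem_lattice)))
    exact tendsto_nhds_unique (tendsto_const_nhds.congr' (hc (L.ω₂ / 2)).symm)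
      (tendsto_zero_of_meromorphicOrderAt_pos h1)
  have htop : meromorphicOrderAt G 0 + meromorphicOrderAt G (0 + h) = ⊤ := by
    rw [← hmul, meromorphicOrderAt_eq_top_iff]
    filter_upwards [hc 0] with u hu
    rw [hu, hc0]
  -- One of the two factors vanishes identically near a point, and infinite order spreads over the
  -- connected plane.
  have hall : meromorphicOrderAt G z = ⊤ := by
    by_contra hne
    have := fun y => MeromorphicOn.meromorphicOrderAt_ne_top_of_isPreconnected
      (fun z _ => hm z) (y := y) isPreconnected_univ (Set.mem_univ z) (Set.mem_univ y) hne
    rcases WithTop.add_eq_top.mp htop with h1 | h1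
    · exact this _ h1
    · exact this _ h1
  exact meromorphicOrderAt_eq_top_iff.mp hall

/-- An elliptic function with at most one simple pole in a period parallelogram is constant. -/
theorem IsAlmostPeriodic.exists_eq_const_of_simple_pole {f : ℂ → ℂ} (hf : L.IsAlmostPeriodic f)
    (hm : Meromorphic f) (p : ℂ) (ho : ∀ z, z - p ∉ L.lattice → 0 ≤ meromorphicOrderAt f z)
    (hop : -1 ≤ meromorphicOrderAt f p) : ∃ c, ∀ z, f =ᶠ[𝓝[≠] z] fun _ => c := by
  set F : ℂ → ℂ := fun u => f (u + p)
  have hFm : Meromorphic F := fun z =>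
    (hm (z + p)).comp_analyticAt (g := fun u => u + p) (by fun_prop)
  have hFo : ∀ z, meromorphicOrderAt F z = meromorphicOrderAt f (z + p) := fun z =>
    meromorphicOrderAt_comp_add_const_eq_meromorphicOrderAt
  have hF : L.IsAlmostPeriodic F := fun w hw z => by
    filter_upwards [(map_add_nhdsNE z p).eventually (hf w hw (z + p))] with u h
    simp only [F]
    rw [← h, add_right_comm]
  have hFnm : Meromorphic fun u => F (-u) := fun z =>
    (hFm (-z)).comp_analyticAt (g := fun u => -u) (by fun_prop)
  have hFno : ∀ z, meromorphicOrderAt (fun u => F (-u)) z = meromorphicOrderAt F (-z) := fun z =>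
    meromorphicOrderAt_comp_of_deriv_ne_zero (f := F) (g := fun u => -u) (by fun_prop) (by simp)
  have hFreg : ∀ z ∉ L.lattice, 0 ≤ meromorphicOrderAt F z := fun z hz => by
    rw [hFo]
    exact ho _ (by simpa using hz)
  have hF0 : -1 ≤ meromorphicOrderAt F 0 := by
    rwa [hFo, zero_add]
  set S : ℂ → ℂ := F + fun u => F (-u)
  have hSm : Meromorphic S := fun z => (hFm z).add (hFnm z)
  have hS : L.IsAlmostPeriodic S := fun w hw z => by
    filter_upwards [hF w hw z, (map_neg_nhdsNE z).eventually (hF (-w) (neg_mem hw) (-z))]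
      with u h1 h2
    simp only [S, Pi.add_apply]
    rw [h1, ← h2, neg_add]
  -- The pole cancels in the symmetrization: if u F(u) tends to a, then u S(u) = u F(u) - (-u) F(-u)
  -- tends to a - a = 0, so the order of S at 0 exceeds -1.
  have hS0 : 0 ≤ meromorphicOrderAt S 0 := by
    have hid : MeromorphicAt (id : ℂ → ℂ) 0 := MeromorphicAt.id 0
    have h1 : 0 ≤ meromorphicOrderAt (id * F) 0 := by
      rw [meromorphicOrderAt_mul hid (hFm 0), meromorphicOrderAt_id]
      exact nonneg_one_add hF0
    obtain ⟨a, ha⟩ := tendsto_nhds_of_meromorphicOrderAt_nonneg (hid.mul (hFm 0)) h1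
    have h2 := map_neg_nhdsNE 0
    rw [neg_zero] at h2
    have h3 := ha.sub (ha.comp h2)
    have h4 : 0 < meromorphicOrderAt (id * S) 0 := by
      rw [← tendsto_zero_iff_meromorphicOrderAt_pos (hid.mul (hSm 0))]
      rw [sub_self] at h3
      refine h3.congr fun u => ?_
      simp only [S, Pi.mul_apply, id, Function.comp, Pi.add_apply]
      ring
    rw [meromorphicOrderAt_mul hid (hSm 0), meromorphicOrderAt_id] at h4
    exact nonneg_of_one_add_pos h4
  obtain ⟨c, hc⟩ := hS.exists_eq_const hSm fun z => by
    by_cases hz : z ∈ L.lattice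
    · have := hS.order_add hz 0
      rw [zero_add] at this
      rwa [this]
    · refine (le_min (hFreg z hz) ?_).trans (meromorphicOrderAt_add (hFm z) (hFnm z))
      rw [hFno]
      exact hFreg _ (by simpa using hz)
  -- F(u) + F(-u) is now the constant c, so F - c/2 is odd.
  have hz := IsAlmostPeriodic.eq_zero_of_odd (L := L) (G := fun u => F u - c / 2)
    (fun w hw z => by
      filter_upwards [hF w hw z] with u hu
      rw [hu])
    (fun z => (hFm z).sub (MeromorphicAt.const _ _))
    (fun z => by
      filter_upwards [hc z] with u hu
      have hu : F u + F (-u) = c := hu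
      linear_combination hu)
    (fun z hz => order_sub_const (hFm z) _ le_rfl (hFreg z hz))
    (order_sub_const (hFm 0) _ (by decide) hF0)
  refine ⟨c / 2, fun z => ?_⟩
  have h1 := map_add_nhdsNE z (-p)
  filter_upwards [h1.eventually (hz (z + -p))] with u hu
  simp only [F, neg_add_cancel_right] at hu
  linear_combination hu

end PeriodPair
end

noncomputable section

open Filter Topology Finset

/-! ### Taylor coefficients at the origin -/

/-- The `n`-th Taylor coefficient of `f` at `0`. -/
def taylorCoeff (n : ℕ) (f : ℂ → ℂ) : ℂ := iteratedDeriv n f 0 / (n.factorial : ℂ)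

theorem taylorCoeff_zero (f : ℂ → ℂ) : taylorCoeff 0 f = f 0 := by
  simp [taylorCoeff]

theorem taylorCoeff_congr {f g : ℂ → ℂ} (h : f =ᶠ[𝓝 0] g) (n : ℕ) :
    taylorCoeff n f = taylorCoeff n g := by
  rw [taylorCoeff, taylorCoeff, h.iteratedDeriv_eq]

theorem taylorCoeff_add {f g : ℂ → ℂ} (hf : AnalyticAt ℂ f 0) (hg : AnalyticAt ℂ g 0) (n : ℕ) :
    taylorCoeff n (fun z => f z + g z) = taylorCoeff n f + taylorCoeff n g := by
  rw [taylorCoeff, iteratedDeriv_fun_add hf.contDiffAt hg.contDiffAt, add_div]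
  rfl

theorem taylorCoeff_const_mul (c : ℂ) (f : ℂ → ℂ) (n : ℕ) :
    taylorCoeff n (fun z => c * f z) = c * taylorCoeff n f := by
  rw [taylorCoeff, iteratedDeriv_const_mul_field, mul_div_assoc]
  rfl

theorem taylorCoeff_mul {f g : ℂ → ℂ} (hf : AnalyticAt ℂ f 0) (hg : AnalyticAt ℂ g 0) (n : ℕ) :
    taylorCoeff n (fun z => f z * g z) =
      ∑ ij ∈ antidiagonal n, taylorCoeff ij.1 f * taylorCoeff ij.2 g := by
  have h := iteratedDeriv_mul (n := n) hf.contDiffAt hg.contDiffAt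
  have e : f * g = fun z => f z * g z := rfl
  rw [e] at h
  rw [taylorCoeff, h, Finset.Nat.sum_antidiagonal_eq_sum_range_succ
    (fun i j => taylorCoeff i f * taylorCoeff j g), sum_div]
  refine sum_congr rfl fun i hi => ?_
  have hi : i ≤ n := Nat.lt_succ_iff.mp (mem_range.mp hi)
  rw [taylorCoeff, taylorCoeff, Nat.cast_choose ℂ hi]
  have h1 := Nat.cast_ne_zero (R := ℂ) |>.mpr (Nat.factorial_ne_zero n)
  have h2 := Nat.cast_ne_zero (R := ℂ) |>.mpr (Nat.factorial_ne_zero i)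
  have h3 := Nat.cast_ne_zero (R := ℂ) |>.mpr (Nat.factorial_ne_zero (n - i))
  field_simp

theorem taylorCoeff_id_mul {f : ℂ → ℂ} (hf : AnalyticAt ℂ f 0) (n : ℕ) :
    taylorCoeff n (fun z => z * f z) = if n = 0 then 0 else taylorCoeff (n - 1) f := by
  rw [taylorCoeff_mul (f := fun z => z) (by fun_prop) hf]
  rcases n with _ | n
  · simp [taylorCoeff_zero]
  · rw [if_neg n.succ_ne_zero, sum_eq_single (1, n)]
    · simp [taylorCoeff]
    · rintro ⟨i, j⟩ hij hne
      have hij := HasAntidiagonal.mem_antidiagonal.mp hij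
      rcases i with _ | _ | i
      · simp [taylorCoeff_zero]
      · exact (hne (by rw [Prod.mk.injEq]; simp at hij; omega)).elim
      · have h1 : taylorCoeff (i + 1 + 1) (fun z => z) = 0 := by
          rw [taylorCoeff, iteratedDeriv_succ', iteratedDeriv_succ']
          simp
        rw [h1, zero_mul]
    · intro h
      exact (h (HasAntidiagonal.mem_antidiagonal.mpr (by simp [add_comm]))).elim

theorem taylorCoeff_pow_mul {f : ℂ → ℂ} (hf : AnalyticAt ℂ f 0) (m n : ℕ) :
    taylorCoeff n (fun z => z ^ m * f z) = if n < m then 0 else taylorCoeff (n - m) f := by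
  induction m generalizing n with
  | zero => simp
  | succ m ih =>
    have h : (fun z => z ^ (m + 1) * f z) = fun z => z * (z ^ m * f z) := by
      funext z
      ring
    rw [h, taylorCoeff_id_mul (by fun_prop)]
    split_ifs with h1 h2 h2
    · rfl
    · omega
    · rw [ih, if_pos (by omega)]
    · rw [ih, if_neg (by omega)]
      congr 1
      omega

theorem exists_eq_pow_mul_of_taylorCoeff_eq_zero {f : ℂ → ℂ} (hf : AnalyticAt ℂ f 0) {n : ℕ}
    (h : ∀ m < n, taylorCoeff m f = 0) :
    ∃ g, AnalyticAt ℂ g 0 ∧ ∀ᶠ z in 𝓝 0, f z = z ^ n * g z := by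
  have h1 : (n : ℕ∞) ≤ analyticOrderAt f 0 :=
    (natCast_le_analyticOrderAt_iff_iteratedDeriv_eq_zero hf).mpr fun i hi => by
      have := h i hi
      rw [taylorCoeff, div_eq_zero_iff] at this
      exact this.resolve_right (Nat.cast_ne_zero.mpr (Nat.factorial_ne_zero i))
  obtain ⟨g, hg, h2⟩ := (natCast_le_analyticOrderAt hf).mp h1
  exact ⟨g, hg, by simpa using h2⟩

/-! ### Partial derivatives of jointly analytic functions -/

/-- `F` is jointly analytic at `(x, z)`. -/
def JointAnalyticAt (F : ℂ → ℂ → ℂ) (x z : ℂ) : Prop :=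
  AnalyticAt ℂ (fun p : ℂ × ℂ => F p.1 p.2) (x, z)

/-- The partial derivative in the first variable. -/
def dX (F : ℂ → ℂ → ℂ) (x z : ℂ) : ℂ := deriv (fun y => F y z) x

/-- The partial derivative in the second variable. -/
def dZ (F : ℂ → ℂ → ℂ) (x z : ℂ) : ℂ := deriv (F x) z

theorem iteratedDeriv_eq_dZ (F : ℂ → ℂ → ℂ) (n : ℕ) (x z : ℂ) :
    iteratedDeriv n (F x) z = (dZ^[n] F) x z := by
  induction n generalizing z with
  | zero => simp
  | succ n ih =>
    rw [iteratedDeriv_succ, Function.iterate_succ_apply', dZ]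
    congr 1
    funext w
    exact ih w

theorem iteratedDeriv_eq_dX (F : ℂ → ℂ → ℂ) (n : ℕ) (x z : ℂ) :
    iteratedDeriv n (fun y => F y z) x = (dX^[n] F) x z := by
  induction n generalizing x with
  | zero => simp
  | succ n ih =>
    rw [iteratedDeriv_succ, Function.iterate_succ_apply', dX]
    congr 1
    funext w
    exact ih w

namespace JointAnalyticAt

variable {F G : ℂ → ℂ → ℂ} {x z : ℂ}

theorem congr (hF : JointAnalyticAt F x z) (h : ∀ᶠ p : ℂ × ℂ in 𝓝 (x, z), F p.1 p.2 = G p.1 p.2) :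
    JointAnalyticAt G x z :=
  AnalyticAt.congr hF h

theorem eventually (hF : JointAnalyticAt F x z) :
    ∀ᶠ p : ℂ × ℂ in 𝓝 (x, z), JointAnalyticAt F p.1 p.2 :=
  AnalyticAt.eventually_analyticAt hF

theorem analyticAt_right (hF : JointAnalyticAt F x z) : AnalyticAt ℂ (F x) z :=
  AnalyticAt.comp_of_eq (g := fun p : ℂ × ℂ => F p.1 p.2) (f := fun w : ℂ => (x, w)) hF
    (by fun_prop) rfl

theorem analyticAt_left (hF : JointAnalyticAt F x z) : AnalyticAt ℂ (fun y => F y z) x :=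
  AnalyticAt.comp_of_eq (g := fun p : ℂ × ℂ => F p.1 p.2) (f := fun y : ℂ => (y, z)) hF
    (by fun_prop) rfl

theorem dX_eq_fderiv (hF : JointAnalyticAt F x z) :
    dX F x z = fderiv ℂ (fun p : ℂ × ℂ => F p.1 p.2) (x, z) (1, 0) := by
  have h1 : HasDerivAt (fun y : ℂ => (y, z)) (1, 0) x :=
    (hasDerivAt_id x).prodMk (hasDerivAt_const x z)
  have h2 := (DifferentiableAt.hasFDerivAt (AnalyticAt.differentiableAt hF)).comp_hasDerivAt x h1
  exact h2.deriv

theorem dZ_eq_fderiv (hF : JointAnalyticAt F x z) :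
    dZ F x z = fderiv ℂ (fun p : ℂ × ℂ => F p.1 p.2) (x, z) (0, 1) := by
  have h1 : HasDerivAt (fun y : ℂ => (x, y)) (0, 1) z :=
    (hasDerivAt_const z x).prodMk (hasDerivAt_id z)
  have h2 := (DifferentiableAt.hasFDerivAt (AnalyticAt.differentiableAt hF)).comp_hasDerivAt z h1
  exact h2.deriv

theorem analyticAt_fderiv_apply (hF : JointAnalyticAt F x z) (v : ℂ × ℂ) :
    AnalyticAt ℂ (fun q => fderiv ℂ (fun p : ℂ × ℂ => F p.1 p.2) q v) (x, z) :=
  ((ContinuousLinearMap.apply ℂ ℂ v).analyticAt _).comp (AnalyticAt.fderiv hF)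

theorem dX (hF : JointAnalyticAt F x z) : JointAnalyticAt (dX F) x z := by
  refine (hF.analyticAt_fderiv_apply (1, 0)).congr ?_
  filter_upwards [hF.eventually] with p hp
  exact hp.dX_eq_fderiv.symm

theorem dZ (hF : JointAnalyticAt F x z) : JointAnalyticAt (dZ F) x z := by
  refine (hF.analyticAt_fderiv_apply (0, 1)).congr ?_
  filter_upwards [hF.eventually] with p hp
  exact hp.dZ_eq_fderiv.symm

theorem dX_iterate (hF : JointAnalyticAt F x z) (n : ℕ) : JointAnalyticAt (_root_.dX^[n] F) x z := by
  induction n with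
  | zero => exact hF
  | succ n ih =>
    rw [Function.iterate_succ_apply']
    exact ih.dX

theorem dZ_iterate (hF : JointAnalyticAt F x z) (n : ℕ) : JointAnalyticAt (_root_.dZ^[n] F) x z := by
  induction n with
  | zero => exact hF
  | succ n ih =>
    rw [Function.iterate_succ_apply']
    exact ih.dZ

theorem dX_dZ (hF : JointAnalyticAt F x z) :
    _root_.dX (_root_.dZ F) x z = _root_.dZ (_root_.dX F) x z := by
  set f := fun p : ℂ × ℂ => F p.1 p.2
  have hdd : HasFDerivAt (fderiv ℂ f) (fderiv ℂ (fderiv ℂ f) (x, z)) (x, z) :=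
    (AnalyticAt.fderiv hF).differentiableAt.hasFDerivAt
  have happ : ∀ v w : ℂ × ℂ, fderiv ℂ (fun q => fderiv ℂ f q v) (x, z) w =
      fderiv ℂ (fderiv ℂ f) (x, z) w v := fun v w => by
    have h := hdd.clm_apply (hasFDerivAt_const v (x, z))
    rw [h.fderiv]
    simp
  have h1 : (fun p : ℂ × ℂ => _root_.dZ F p.1 p.2) =ᶠ[𝓝 (x, z)] fun q => fderiv ℂ f q (0, 1) := by
    filter_upwards [hF.eventually] with p hp
    exact hp.dZ_eq_fderiv
  have h2 : (fun p : ℂ × ℂ => _root_.dX F p.1 p.2) =ᶠ[𝓝 (x, z)] fun q => fderiv ℂ f q (1, 0) := by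
    filter_upwards [hF.eventually] with p hp
    exact hp.dX_eq_fderiv
  rw [hF.dZ.dX_eq_fderiv, hF.dX.dZ_eq_fderiv, h1.fderiv_eq, h2.fderiv_eq, happ, happ]
  exact (ContDiffAt.isSymmSndFDerivAt (n := 2) (AnalyticAt.contDiffAt hF) (by simp)).eq _ _

theorem eventually_right {P : ℂ → ℂ → Prop} (h : ∀ᶠ p : ℂ × ℂ in 𝓝 (x, z), P p.1 p.2) :
    ∀ᶠ w in 𝓝 z, P x w :=
  (Continuous.tendsto (f := fun w : ℂ => (x, w)) (by fun_prop) z).eventually h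

theorem dX_dZ_iterate (hF : JointAnalyticAt F x z) (n : ℕ) :
    _root_.dX (_root_.dZ^[n] F) x z = (_root_.dZ^[n] (_root_.dX F)) x z := by
  induction n generalizing z with
  | zero => rfl
  | succ n ih =>
    rw [Function.iterate_succ_apply', Function.iterate_succ_apply', (hF.dZ_iterate n).dX_dZ]
    refine EventuallyEq.deriv_eq ?_
    filter_upwards [eventually_right hF.eventually] with w hw
    exact ih hw

/-- Mixed partial derivatives commute, so Taylor coefficients in z may be differentiated in the
first variable. That variable is x for the holomorphy of v_{0,n} and for the derivation on symbols,
and a time shift s in `hasOpTimeDerivAt_opC`. -/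
theorem hasDerivAt_taylorCoeff (hF : JointAnalyticAt F x 0) (n : ℕ) :
    HasDerivAt (fun y => taylorCoeff n (F y)) (taylorCoeff n (_root_.dX F x)) x := by
  have h := (hF.dZ_iterate n).analyticAt_left.differentiableAt.hasDerivAt
  have h2 := hF.dX_dZ_iterate n
  rw [_root_.dX] at h2
  rw [h2] at h
  simp only [← iteratedDeriv_eq_dZ] at h
  exact h.div_const _

theorem add (hF : JointAnalyticAt F x z) (hG : JointAnalyticAt G x z) :
    JointAnalyticAt (fun x z => F x z + G x z) x z :=
  AnalyticAt.add hF hG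

theorem mul (hF : JointAnalyticAt F x z) (hG : JointAnalyticAt G x z) :
    JointAnalyticAt (fun x z => F x z * G x z) x z :=
  AnalyticAt.mul hF hG

theorem sum {ι : Type*} (s : Finset ι) {F : ι → ℂ → ℂ → ℂ} (hF : ∀ i ∈ s, JointAnalyticAt (F i) x z) :
    JointAnalyticAt (fun x z => ∑ i ∈ s, F i x z) x z :=
  Finset.analyticAt_fun_sum s hF

theorem of_left {f : ℂ → ℂ} (hf : AnalyticAt ℂ f x) : JointAnalyticAt (fun x _ => f x) x z :=
  AnalyticAt.comp_of_eq (g := f) (f := fun p : ℂ × ℂ => p.1) hf analyticAt_fst rfl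

theorem of_right {f : ℂ → ℂ} (hf : AnalyticAt ℂ f z) : JointAnalyticAt (fun _ z => f z) x z :=
  AnalyticAt.comp_of_eq (g := f) (f := fun p : ℂ × ℂ => p.2) hf analyticAt_snd rfl

end JointAnalyticAt
end

noncomputable section

open Filter Topology Finset TopologicalSpace
open scoped PseudoDiffOp

/-! ### Pseudo-differential operators with a convergent symbol -/

theorem HolFun.ofFun_apply {U : Opens ℂ} {g : ℂ → ℂ} (hg : DifferentiableOn ℂ g U) (x : U) :
    (HolFun.ofFun U g).1 x = g x := by
  rw [HolFun.ofFun, dif_pos hg]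

theorem HolFun.deriv_ofFun_apply {U : Opens ℂ} {g : ℂ → ℂ} (hg : DifferentiableOn ℂ g U) (x : U) :
    (Differential.deriv (HolFun.ofFun U g)).1 x = deriv g x := by
  rw [HolFun.deriv_apply]
  refine EventuallyEq.deriv_eq ?_
  filter_upwards [U.isOpen.mem_nhds x.2] with y hy
  rw [← HolFun.ofFun_apply hg ⟨y, hy⟩]
  exact HolFun.ext0_coe _ (⟨y, hy⟩ : U)

theorem HolFun.ext {U : Opens ℂ} {f g : HolFun U} (h : ∀ x : U, f.1 x = g.1 x) : f = g :=
  Subtype.ext (funext h)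

/-- `F` is jointly analytic at all points `(x, 0)` with `x ∈ U`. -/
def JointAnalyticOn (U : Opens ℂ) (F : ℂ → ℂ → ℂ) : Prop := ∀ x ∈ U, JointAnalyticAt F x 0

/-- The operator `∑ₙ cₙ(x) ∂⁻ⁿ`, where `F(x, z) = ∑ₙ cₙ(x) zⁿ`. -/
def opSeries (U : Opens ℂ) (F : ℂ → ℂ → ℂ) : PseudoDiffOp (HolFun U) where
  coeff m := if m ≤ 0 then HolFun.ofFun U fun x => taylorCoeff (-m).toNat (F x) else 0
  bdd := ⟨0, fun _ hn => if_neg (by omega)⟩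

/-- The function `z ∂F/∂x + F`, that is `e^{-x/z} z ∂(e^{x/z} F)/∂x`. -/
def stepX (F : ℂ → ℂ → ℂ) (x z : ℂ) : ℂ := z * dX F x z + F x z

namespace JointAnalyticAt

theorem stepX {F : ℂ → ℂ → ℂ} {x z : ℂ} (hF : JointAnalyticAt F x z) :
    JointAnalyticAt (stepX F) x z :=
  ((of_right analyticAt_id).mul hF.dX).add hF

theorem stepX_iterate {F : ℂ → ℂ → ℂ} {x z : ℂ} (hF : JointAnalyticAt F x z) (n : ℕ) :
    JointAnalyticAt (_root_.stepX^[n] F) x z := by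
  induction n with
  | zero => exact hF
  | succ n ih =>
    rw [Function.iterate_succ_apply']
    exact ih.stepX

end JointAnalyticAt

section OpSeries

variable {U : Opens ℂ} {F G : ℂ → ℂ → ℂ}

theorem JointAnalyticOn.differentiableOn_taylorCoeff (hF : JointAnalyticOn U F) (n : ℕ) :
    DifferentiableOn ℂ (fun x => taylorCoeff n (F x)) U := fun x hx =>
  ((hF x hx).hasDerivAt_taylorCoeff n).differentiableAt.differentiableWithinAt

theorem opSeries_coeff_pos (F : ℂ → ℂ → ℂ) (m : ℤ) (hm : 0 < m) : (opSeries U F).coeff m = 0 :=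
  if_neg (by omega)

theorem opSeries_coeff_neg (F : ℂ → ℂ → ℂ) (n : ℕ) :
    (opSeries U F).coeff (-n) = HolFun.ofFun U fun x => taylorCoeff n (F x) := by
  rw [opSeries]
  simp

/-- Joint analyticity makes the Taylor coefficients holomorphic on U, so `ofFun` does not fall back
on its default value 0. -/
theorem opSeries_coeff_apply (hF : JointAnalyticOn U F) (n : ℕ) (x : U) :
    ((opSeries U F).coeff (-n)).1 x = taylorCoeff n (F x) := by
  rw [opSeries_coeff_neg, HolFun.ofFun_apply (hF.differentiableOn_taylorCoeff n)]

theorem deriv_opSeries_coeff_apply (hF : JointAnalyticOn U F) (n : ℕ) (x : U) :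
    (Differential.deriv ((opSeries U F).coeff (-n))).1 x = taylorCoeff n (dX F x) := by
  rw [opSeries_coeff_neg, HolFun.deriv_ofFun_apply (hF.differentiableOn_taylorCoeff n)]
  exact ((hF x x.2).hasDerivAt_taylorCoeff n).deriv

theorem eq_opSeries (hF : JointAnalyticOn U F) {P : PseudoDiffOp (HolFun U)}
    (hP : ∀ m, 0 < m → P.coeff m = 0)
    (h : ∀ (n : ℕ) (x : U), (P.coeff (-n)).1 x = taylorCoeff n (F x)) : P = opSeries U F := by
  ext1
  funext m
  rcases lt_or_ge 0 m with hm | hm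
  · rw [hP m hm, opSeries_coeff_pos F m hm]
  · obtain ⟨n, rfl⟩ : ∃ n : ℕ, m = -n := ⟨(-m).toNat, by omega⟩
    exact HolFun.ext fun x => by rw [h, opSeries_coeff_apply hF]

theorem opSeries_eq_zero (hF : JointAnalyticOn U F) (h : ∀ x ∈ U, ∀ᶠ z in 𝓝 0, F x z = 0) :
    opSeries U F = 0 := by
  refine (eq_opSeries hF (fun _ _ => rfl) fun n x => ?_).symm
  rw [taylorCoeff_congr (g := fun z => 0 * 0) (by
    filter_upwards [h x x.2] with z hz
    rw [hz, mul_zero]), taylorCoeff_const_mul]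
  simp

theorem opSeries_add (hF : JointAnalyticOn U F) (hG : JointAnalyticOn U G) :
    opSeries U (fun x z => F x z + G x z) = opSeries U F + opSeries U G := by
  refine (eq_opSeries (fun x hx => (hF x hx).add (hG x hx)) (fun m hm => ?_) fun n x => ?_).symm
  · simp [opSeries_coeff_pos _ m hm]
  · rw [PseudoDiffOp.add_coeff, taylorCoeff_add (hF x x.2).analyticAt_right
      (hG x x.2).analyticAt_right, ← opSeries_coeff_apply hF, ← opSeries_coeff_apply hG]
    rfl

theorem JointAnalyticOn.sum {ι : Type*} (s : Finset ι) {F : ι → ℂ → ℂ → ℂ}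
    (hF : ∀ i ∈ s, JointAnalyticOn U (F i)) : JointAnalyticOn U fun x z => ∑ i ∈ s, F i x z :=
  fun x hx => JointAnalyticAt.sum s fun i hi => hF i hi x hx

theorem opSeries_sum {ι : Type*} (s : Finset ι) {F : ι → ℂ → ℂ → ℂ}
    (hF : ∀ i ∈ s, JointAnalyticOn U (F i)) :
    opSeries U (fun x z => ∑ i ∈ s, F i x z) = ∑ i ∈ s, opSeries U (F i) := by
  classical
  induction s using Finset.induction_on with
  | empty =>
    simp only [sum_empty]
    exact opSeries_eq_zero (fun x _ => analyticAt_const) fun x _ => Eventually.of_forall fun _ => rfl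
  | insert i s hi ih =>
    simp only [sum_insert hi]
    rw [opSeries_add (hF i (mem_insert_self i s)) (JointAnalyticOn.sum s fun j hj =>
      hF j (mem_insert_of_mem hj)), ih fun j hj => hF j (mem_insert_of_mem hj)]

theorem JointAnalyticOn.ext0_mul (b : HolFun U) (hF : JointAnalyticOn U F) :
    JointAnalyticOn U fun x z => HolFun.ext0 b.1 x * F x z := fun x hx =>
  (JointAnalyticAt.of_left ((HolFun.differentiableOn_ext0 b).analyticAt
    (U.isOpen.mem_nhds hx))).mul (hF x hx)

theorem opSeries_ext0_mul (b : HolFun U) (hF : JointAnalyticOn U F) :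
    opSeries U (fun x z => HolFun.ext0 b.1 x * F x z) = PseudoDiffOp.const b * opSeries U F := by
  refine (eq_opSeries (hF.ext0_mul b) (fun m hm => ?_) fun n x => ?_).symm
  · rw [PseudoDiffOp.const_mul_coeff, opSeries_coeff_pos _ m hm, mul_zero]
  · rw [PseudoDiffOp.const_mul_coeff, taylorCoeff_const_mul, ← opSeries_coeff_apply hF,
      HolFun.ext0_coe]
    rfl

theorem JointAnalyticOn.mul (hF : JointAnalyticOn U F) (hG : JointAnalyticOn U G) :
    JointAnalyticOn U fun x z => F x z * G x z := fun x hx => (hF x hx).mul (hG x hx)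

theorem JointAnalyticOn.of_right {q : ℂ → ℂ} (hq : AnalyticAt ℂ q 0) :
    JointAnalyticOn U fun _ z => q z := fun _ _ => JointAnalyticAt.of_right hq

theorem JointAnalyticOn.pow_mul (hF : JointAnalyticOn U F) (m : ℕ) :
    JointAnalyticOn U fun x z => z ^ m * F x z :=
  (JointAnalyticOn.of_right (analyticAt_id.pow m)).mul hF

theorem opSeries_pow_mul (hF : JointAnalyticOn U F) (m : ℕ) :
    opSeries U (fun x z => z ^ m * F x z) = opSeries U F * PseudoDiffOp.D (-m) := by
  refine (eq_opSeries (hF.pow_mul m) (fun k hk => ?_) fun n x => ?_).symm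
  · rw [PseudoDiffOp.mul_D_coeff, opSeries_coeff_pos _ _ (by omega)]
  · rw [PseudoDiffOp.mul_D_coeff, taylorCoeff_pow_mul (hF x x.2).analyticAt_right]
    split_ifs with h
    · rw [opSeries_coeff_pos _ _ (by omega)]
      rfl
    · have e : (-n - -m : ℤ) = -(n - m : ℕ) := by omega
      rw [← opSeries_coeff_apply hF, e]

theorem isConst_opSeries {q : ℂ → ℂ} (hq : AnalyticAt ℂ q 0) :
    (opSeries U fun _ z => q z).IsConst := by
  intro m
  rcases lt_or_ge 0 m with hm | hm
  · rw [opSeries_coeff_pos _ m hm, map_zero]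
  · obtain ⟨n, rfl⟩ : ∃ n : ℕ, m = -n := ⟨(-m).toNat, by omega⟩
    refine HolFun.ext fun x => ?_
    rw [deriv_opSeries_coeff_apply (JointAnalyticOn.of_right hq)]
    have h : dX (fun _ z => q z) x = fun z => 0 * q z := by
      funext z
      simp [dX]
    rw [h, taylorCoeff_const_mul, zero_mul]
    rfl

/-- Composition of operators is the plain product of symbols only because q is independent of x; in
general x-derivatives of the right symbol enter. -/
theorem opSeries_mul_right {q : ℂ → ℂ} (hF : JointAnalyticOn U F) (hq : AnalyticAt ℂ q 0) :
    opSeries U (fun x z => F x z * q z) = opSeries U F * opSeries U fun _ z => q z := by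
  have hq' : JointAnalyticOn U fun _ z => q z := JointAnalyticOn.of_right hq
  refine (eq_opSeries (hF.mul hq') (fun k hk => ?_) fun n x => ?_).symm
  · exact PseudoDiffOp.mul_coeff_eq_zero (opSeries_coeff_pos F) (opSeries_coeff_pos _) (by simpa)
  · rw [PseudoDiffOp.mul_coeff_of_deriv_eq_zero (opSeries_coeff_pos F) (opSeries_coeff_pos _)
      (isConst_opSeries hq), taylorCoeff_mul (hF x x.2).analyticAt_right hq, ← HolFun.evalHom_apply,
      map_sum]
    refine sum_congr rfl fun ij _ => ?_
    rw [map_mul, HolFun.evalHom_apply, HolFun.evalHom_apply, opSeries_coeff_apply hF,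
      opSeries_coeff_apply hq']

theorem JointAnalyticOn.stepX_iterate (hF : JointAnalyticOn U F) (i : ℕ) :
    JointAnalyticOn U (stepX^[i] F) := fun x hx => (hF x hx).stepX_iterate i

/-- The operator form of ∂(F e^{x/z}) = z⁻¹ (z F_x + F) e^{x/z}: the factor z⁻¹ becomes the ∂ on the
right. -/
theorem D_one_mul_opSeries (hF : JointAnalyticOn U F) :
    PseudoDiffOp.D 1 * opSeries U F = opSeries U (stepX F) * PseudoDiffOp.D 1 := by
  have hS := hF.stepX_iterate 1
  rw [Function.iterate_one] at hS
  ext1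
  funext k
  rw [PseudoDiffOp.D_one_mul_coeff, PseudoDiffOp.mul_D_coeff]
  rcases lt_or_ge 1 k with hk | hk
  · rw [opSeries_coeff_pos _ _ (by omega), opSeries_coeff_pos _ _ (by omega),
      opSeries_coeff_pos _ _ (by omega), map_zero, add_zero]
  obtain ⟨n, rfl⟩ : ∃ n : ℕ, k = 1 - n := ⟨(1 - k).toNat, by omega⟩
  have e : (1 - n - 1 : ℤ) = -n := by ring
  refine HolFun.ext fun x => ?_
  have hx := hF x x.2
  rw [e, opSeries_coeff_apply hS]
  have h1 : taylorCoeff n (stepX F x) = _ :=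
    taylorCoeff_add (f := fun z => z * dX F x z) (g := F x)
      (by have := hx.dX.analyticAt_right; fun_prop) hx.analyticAt_right n
  rw [h1, taylorCoeff_id_mul hx.dX.analyticAt_right, add_comm, ← HolFun.evalHom_apply, map_add,
    HolFun.evalHom_apply, HolFun.evalHom_apply, opSeries_coeff_apply hF]
  rcases n with _ | n
  · rw [opSeries_coeff_pos _ _ (by simp), map_zero]
    simp
  · have e2 : (1 - (n + 1 : ℕ) : ℤ) = -n := by push_cast; ring
    rw [e2, deriv_opSeries_coeff_apply hF]
    simp

theorem D_mul_opSeries (hF : JointAnalyticOn U F) (i : ℕ) :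
    PseudoDiffOp.D i * opSeries U F = opSeries U (stepX^[i] F) * PseudoDiffOp.D i := by
  induction i with
  | zero => rw [Nat.cast_zero, ← PseudoDiffOp.one_eq_D, one_mul, mul_one]; rfl
  | succ i ih =>
    have e : (PseudoDiffOp.D ((i + 1 : ℕ) : ℤ) : PseudoDiffOp (HolFun U)) =
        PseudoDiffOp.D 1 * PseudoDiffOp.D i := by
      rw [PseudoDiffOp.D_mul_D]
      push_cast
      rw [add_comm]
    rw [e, mul_assoc, ih, ← mul_assoc, D_one_mul_opSeries (hF.stepX_iterate i), mul_assoc,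
      Function.iterate_succ_apply']

/-- The symbol of `(B W_F - W_F (∂ⁿ + W_q)) ∂⁻ⁿ`, where `B = ∑_{i ≤ n} bᵢ ∂ⁱ`. -/
def defect (b : ℕ → ℂ → ℂ) (F : ℂ → ℂ → ℂ) (q : ℂ → ℂ) (n : ℕ) (x z : ℂ) : ℂ :=
  (∑ i ∈ range (n + 1), b i x * (z ^ (n - i) * (stepX^[i] F) x z)) +
    -1 * (F x z + z ^ n * (F x z * q z))

theorem JointAnalyticOn.neg_one_mul (hF : JointAnalyticOn U F) :
    JointAnalyticOn U fun x z => -1 * F x z := fun x hx =>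
  (JointAnalyticAt.of_left (f := fun _ => -1) analyticAt_const).mul (hF x hx)

theorem JointAnalyticOn.defect {q : ℂ → ℂ} (b : ℕ → HolFun U) (hF : JointAnalyticOn U F)
    (hq : AnalyticAt ℂ q 0) (n : ℕ) :
    JointAnalyticOn U (defect (fun i => HolFun.ext0 (b i).1) F q n) := fun x hx =>
  (JointAnalyticOn.sum _ (fun i _ => (((hF.stepX_iterate i).pow_mul (n - i)).ext0_mul (b i)))
    x hx).add (JointAnalyticOn.neg_one_mul (fun x hx => (hF x hx).add
      ((hF.mul (JointAnalyticOn.of_right hq)).pow_mul n x hx)) x hx)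

/-- Moving each ∂ⁱ to the right of W_F and splitting off ∂ⁿ leaves only non-positive powers, so the
operator identity is encoded by one function analytic at z = 0: it holds as soon as that function
vanishes near z = 0. -/
theorem nonneg_mul_opSeries_sub {B : PseudoDiffOp (HolFun U)} {n : ℕ} {q : ℂ → ℂ}
    (hB : ∀ m : ℤ, n < m → B.coeff m = 0) (hF : JointAnalyticOn U F) (hq : AnalyticAt ℂ q 0) :
    B.nonneg * opSeries U F - opSeries U F * (PseudoDiffOp.D n + opSeries U fun _ z => q z) =
      opSeries U (defect (fun i => HolFun.ext0 (B.coeff i).1) F q n) * PseudoDiffOp.D n := by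
  have hFq := hF.mul (JointAnalyticOn.of_right hq)
  have hR : JointAnalyticOn U fun x z => F x z + z ^ n * (F x z * q z) := fun x hx =>
    (hF x hx).add (hFq.pow_mul n x hx)
  have hT : ∀ i ∈ range (n + 1), JointAnalyticOn U fun x z =>
      HolFun.ext0 (B.coeff i).1 x * (z ^ (n - i) * (stepX^[i] F) x z) := fun i _ =>
    ((hF.stepX_iterate i).pow_mul (n - i)).ext0_mul _
  have hneg : opSeries U (fun x z => -1 * (F x z + z ^ n * (F x z * q z))) =
      -opSeries U (fun x z => F x z + z ^ n * (F x z * q z)) := by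
    rw [eq_neg_iff_add_eq_zero, ← opSeries_add hR.neg_one_mul hR]
    exact opSeries_eq_zero (fun x hx => (hR.neg_one_mul x hx).add (hR x hx)) fun x _ =>
      Eventually.of_forall fun z => by ring
  have hD : (PseudoDiffOp.D (-n) * PseudoDiffOp.D n : PseudoDiffOp (HolFun U)) = 1 := by
    rw [PseudoDiffOp.D_mul_D, neg_add_cancel]
    rfl
  have h1 : opSeries U (defect (fun i => HolFun.ext0 (B.coeff i).1) F q n) =
      (∑ i ∈ range (n + 1), PseudoDiffOp.const (B.coeff i) *
        (opSeries U (stepX^[i] F) * PseudoDiffOp.D (-(n - i : ℕ)))) -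
        (opSeries U F + opSeries U F * (opSeries U fun _ z => q z) * PseudoDiffOp.D (-n)) := by
    have h := opSeries_add (JointAnalyticOn.sum _ hT) hR.neg_one_mul
    rw [opSeries_sum _ hT, hneg, opSeries_add hF (hFq.pow_mul n), opSeries_pow_mul hFq,
      opSeries_mul_right hF hq] at h
    rw [sub_eq_add_neg, ← sum_congr rfl fun i hi => ?_]
    · exact h
    · rw [← opSeries_pow_mul (hF.stepX_iterate i), opSeries_ext0_mul _
        ((hF.stepX_iterate i).pow_mul _)]
  rw [h1, PseudoDiffOp.nonneg_eq_sum hB, sub_mul, sum_mul, sum_mul, add_mul, mul_add]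
  congr 1
  · refine sum_congr rfl fun i hi => ?_
    have hi : i ≤ n := Nat.lt_succ_iff.mp (mem_range.mp hi)
    rw [mul_assoc, D_mul_opSeries hF, mul_assoc, mul_assoc, PseudoDiffOp.D_mul_D]
    congr 3
    omega
  · rw [mul_assoc _ _ (PseudoDiffOp.D n), hD, mul_one]

end OpSeries
end

noncomputable section

open Filter Topology Finset TopologicalSpace
open scoped Nat

theorem analyticAt_iteratedDeriv {f : ℂ → ℂ} {z : ℂ} (hf : AnalyticAt ℂ f z) (n : ℕ) :
    AnalyticAt ℂ (iteratedDeriv n f) z := by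
  rw [iteratedDeriv_eq_iterate]
  exact hf.iterated_deriv n

namespace PeriodPair

variable (L : PeriodPair)

/-! ### Joint analyticity of the Lamé function -/

theorem analyticAt_sigma (z : ℂ) : AnalyticAt ℂ L.sigma z := L.differentiable_sigma.analyticAt z

theorem sigma_neg (z : ℂ) : L.sigma (-z) = -L.sigma z := by
  have h : L.sigmaProd (-z) = L.sigmaProd z := by
    rw [sigmaProd, sigmaProd, ← (Equiv.subtypeEquiv (Equiv.neg L.lattice) fun l => by
      simp : {l : L.lattice // l ≠ 0} ≃ {l : L.lattice // l ≠ 0}).tprod_eq]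
    refine tprod_congr fun l => ?_
    simp [sigmaFactor]
  rw [sigma_eq, sigma_eq, h, neg_mul]

theorem zeta_neg (z : ℂ) : L.zeta (-z) = -L.zeta z := by
  have h1 : (fun z => L.sigma (-z)) = fun z => -L.sigma z := funext L.sigma_neg
  have h : deriv L.sigma (-z) = deriv L.sigma z := by
    have := congrArg (fun f => deriv f z) h1
    simp only [deriv_comp_neg, deriv.fun_neg, neg_inj] at this
    exact this
  rw [zeta, zeta, h, sigma_neg, div_neg]

theorem analyticAt_zetaExcept {z : ℂ} (hz : z ∉ (L.lattice \ {0} : Set ℂ)) :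
    AnalyticAt ℂ L.zetaExcept z :=
  L.differentiableOn_zetaExcept.analyticAt (L.isOpen_compl_lattice_sdiff.mem_nhds hz)

theorem analyticAt_zeta {z : ℂ} (hz : z ∉ L.lattice) : AnalyticAt ℂ L.zeta z :=
  DifferentiableOn.analyticAt
    (fun _ hw => (L.hasDerivAt_zeta hw).differentiableAt.differentiableWithinAt)
    (L.isOpen_compl_lattice.mem_nhds hz)

theorem jointAnalyticAt_sigma_mul_exp {a b : ℂ × ℂ → ℂ} {x z : ℂ} (ha : AnalyticAt ℂ a (x, z))
    (hb : AnalyticAt ℂ b (x, z)) (hx : x ∉ L.lattice) :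
    JointAnalyticAt (fun x z => L.sigma (a (x, z)) / L.sigma x * Complex.exp (b (x, z))) x z := by
  have h1 : AnalyticAt ℂ (fun p => L.sigma (a p)) (x, z) :=
    (L.analyticAt_sigma (a (x, z))).comp_of_eq ha rfl
  have h2 : AnalyticAt ℂ (fun p : ℂ × ℂ => L.sigma p.1) (x, z) :=
    (L.analyticAt_sigma x).comp_of_eq analyticAt_fst rfl
  exact (h1.div h2 (L.sigma_ne_zero hx)).mul hb.cexp

theorem jointAnalyticAt_lamePhi {x k : ℂ} (hx : x ∉ L.lattice) (hk : k ∉ L.lattice) :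
    JointAnalyticAt L.lamePhi x k := by
  refine L.jointAnalyticAt_sigma_mul_exp (a := fun p => p.1 + p.2) (b := fun p => -L.zeta p.2 * p.1)
    (analyticAt_fst.add analyticAt_snd) ?_ hx
  have h : AnalyticAt ℂ (fun p : ℂ × ℂ => L.zeta p.2) (x, k) :=
    (L.analyticAt_zeta hk).comp_of_eq analyticAt_snd rfl
  exact h.neg.mul analyticAt_fst

theorem jointAnalyticAt_vHat0 {x z : ℂ} (hx : x ∉ L.lattice) (hz : z ∉ (L.lattice \ {0} : Set ℂ)) :
    JointAnalyticAt L.vHat0 x z := by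
  have h : AnalyticAt ℂ (fun p : ℂ × ℂ => L.zetaExcept p.2) (x, z) :=
    (L.analyticAt_zetaExcept hz).comp_of_eq analyticAt_snd rfl
  refine (L.jointAnalyticAt_sigma_mul_exp (a := fun p => p.1 - p.2)
    (b := fun p => L.zetaExcept p.2 * p.1) (analyticAt_fst.sub analyticAt_snd)
    (h.mul analyticAt_fst) hx).congr ?_
  have h2 : ∀ᶠ p : ℂ × ℂ in 𝓝 (x, z), p.2 ∉ (L.lattice \ {0} : Set ℂ) :=
    (continuous_snd.tendsto (x, z)).eventually (L.isOpen_compl_lattice_sdiff.mem_nhds hz)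
  filter_upwards [h2] with p hp
  rw [vHat0, L.zeta_sub_inv hp]

theorem jointAnalyticOn_vHat0 : JointAnalyticOn L.domain L.vHat0 := fun _ hx =>
  L.jointAnalyticAt_vHat0 hx fun h => h.2 rfl

theorem vHat0_zero {x : ℂ} (hx : x ∉ L.lattice) : L.vHat0 x 0 = 1 := by
  rw [vHat0, L.zeta_sub_inv (fun h => h.2 rfl), zetaExcept]
  simp [L.sigma_ne_zero hx]

/-- As ζ is odd, v̂₀ is Φ at k = -z stripped of its essential singularity e^{x/z}; this links the
symbol of V₀ to the Lamé function. -/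
theorem lamePhi_neg (x z : ℂ) : L.lamePhi x (-z) = L.vHat0 x z * Complex.exp (x / z) := by
  rw [lamePhi, vHat0, mul_assoc, ← Complex.exp_add, zeta_neg, sub_eq_add_neg]
  congr 2
  ring

/-- `monic` puts 1 in degree zero regardless of the sequence, which is consistent with v̂₀(x,0) = 1.
-/
theorem opV0_eq_opSeries : L.opV0 = opSeries L.domain L.vHat0 := by
  refine eq_opSeries L.jointAnalyticOn_vHat0 (fun m hm => ?_) fun n x => ?_
  · exact (PseudoDiffOp.isMonicOrderZero_monic _).2 m hm
  · rcases n with _ | n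
    · rw [taylorCoeff_zero, L.vHat0_zero x.2]
      simp [opV0, PseudoDiffOp.monic]
    · have h : L.opV0.coeff (-(n + 1 : ℕ)) = HolFun.ofFun L.domain (L.v0 (n + 1)) := by
        simp only [opV0, PseudoDiffOp.monic]
        rw [if_neg (by omega), if_pos (by omega), neg_neg, Int.toNat_natCast]
      rw [h]
      exact HolFun.ofFun_apply (L.jointAnalyticOn_vHat0.differentiableOn_taylorCoeff (n + 1)) x

end PeriodPair

/-- Iterated derivatives of `F(x, z) e^{x/z}`. -/
theorem pow_mul_iteratedDeriv_mul_exp {U : Opens ℂ} {F : ℂ → ℂ → ℂ} {z : ℂ} (hz : z ≠ 0)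
    (hF : ∀ x ∈ U, JointAnalyticAt F x z) (i : ℕ) {x : ℂ} (hx : x ∈ U) :
    z ^ i * iteratedDeriv i (fun y => F y z * Complex.exp (y / z)) x =
      (stepX^[i] F) x z * Complex.exp (x / z) := by
  induction i generalizing F with
  | zero => simp
  | succ i ih =>
    have h : deriv (fun y => F y z * Complex.exp (y / z)) =ᶠ[𝓝 x]
        fun y => z⁻¹ * (stepX F y z * Complex.exp (y / z)) := by
      filter_upwards [U.isOpen.mem_nhds hx] with y hy
      have h1 : HasDerivAt (fun y => F y z) (dX F y z) y :=
        (hF y hy).analyticAt_left.differentiableAt.hasDerivAt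
      have h2 : HasDerivAt (fun y => Complex.exp (y / z)) (Complex.exp (y / z) * (1 / z)) y :=
        ((hasDerivAt_id y).div_const z).cexp
      rw [(h1.fun_mul h2).deriv, stepX]
      field_simp
    rw [iteratedDeriv_succ', h.iteratedDeriv_eq, iteratedDeriv_const_mul_field, pow_succ, mul_assoc,
      mul_inv_cancel_left₀ hz, ih fun x hx => (hF x hx).stepX, Function.iterate_succ_apply]

namespace PeriodPair

variable (L : PeriodPair)

theorem pow_mul_iteratedDeriv_lamePhi {x z : ℂ} (hx : x ∉ L.lattice) (hz : z ≠ 0)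
    (hzL : z ∉ L.lattice) (i : ℕ) :
    z ^ i * iteratedDeriv i (fun y => L.lamePhi y (-z)) x =
      (stepX^[i] L.vHat0) x z * Complex.exp (x / z) := by
  simp only [lamePhi_neg]
  exact pow_mul_iteratedDeriv_mul_exp (U := L.domain) hz
    (fun y hy => L.jointAnalyticAt_vHat0 hy fun h => hzL h.1) i hx

/-! ### The coefficients of the times -/

/-- The nonzero periods form a nonempty closed set, so its distance from 0 is attained. The
condition on all periods thereby becomes membership in a disc, to which theorems on Taylor series
apply. -/
theorem exists_minPeriod :
    ∃ R : ℝ, 0 < R ∧ ∀ z : ℂ, (∀ l ∈ L.lattice, l ≠ 0 → ‖z‖ < ‖l‖) ↔ ‖z‖ < R := by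
  set S : Set ℂ := L.lattice \ {0}
  have hS : IsClosed S := isOpen_compl_iff.mp L.isOpen_compl_lattice_sdiff
  have hne : S.Nonempty := ⟨L.ω₁, L.ω₁_mem_lattice, fun h => L.ω₁_div_two_notMem_lattice (by
    rw [Set.mem_singleton_iff.mp h, zero_div]; exact zero_mem _)⟩
  obtain ⟨l, hl, h⟩ := hS.exists_infDist_eq_dist hne 0
  refine ⟨‖l‖, norm_pos_iff.mpr hl.2, fun z => ⟨fun hz => hz l hl.1 hl.2, fun hz m hm hm0 => ?_⟩⟩
  have := Metric.infDist_le_dist_of_mem (x := (0 : ℂ)) (show m ∈ S from ⟨hm, hm0⟩)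
  rw [h, dist_zero_left, dist_zero_left] at this
  linarith

/-- The radius of the largest disk around `0` that contains no nonzero period. -/
def minPeriod : ℝ := L.exists_minPeriod.choose

theorem minPeriod_pos : 0 < L.minPeriod := L.exists_minPeriod.choose_spec.1

theorem norm_lt_minPeriod_iff {z : ℂ} :
    ‖z‖ < L.minPeriod ↔ ∀ l ∈ L.lattice, l ≠ 0 → ‖z‖ < ‖l‖ :=
  (L.exists_minPeriod.choose_spec.2 z).symm

theorem notMem_of_norm_lt {z : ℂ} (hz : ‖z‖ < L.minPeriod) : z ∉ (L.lattice \ {0} : Set ℂ) :=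
  fun h => lt_irrefl _ (L.norm_lt_minPeriod_iff.mp hz z h.1 h.2)

theorem analyticAt_weierstrassPExcept_zero {z : ℂ} (hz : z ∉ (L.lattice \ {0} : Set ℂ)) :
    AnalyticAt ℂ (L.weierstrassPExcept 0) z :=
  (L.differentiableOn_weierstrassPExcept 0).analyticAt (L.isOpen_compl_lattice_sdiff.mem_nhds hz)

theorem differentiableOn_iteratedDeriv_weierstrassPExcept (j : ℕ) :
    DifferentiableOn ℂ (iteratedDeriv j (L.weierstrassPExcept 0)) (Metric.ball 0 L.minPeriod) :=
  fun _ hz => (analyticAt_iteratedDeriv (L.analyticAt_weierstrassPExcept_zero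
    (L.notMem_of_norm_lt (by simpa using hz))) j).differentiableAt.differentiableWithinAt

/-- Taylor expansion at 0 of the j-th derivative of the regular part of ℘, evaluated at -z, whence
the signs. The subtracted a_j/(j+1) is its constant term, which is why ω_{j+2} starts with λ⁻¹. -/
theorem hasSum_omega {z : ℂ} (hz : ‖z‖ < L.minPeriod) (j : ℕ) :
    HasSum (fun i : ℕ => (-1) ^ (i + 1) * ((i + 1 + j).factorial : ℂ) /
      (((i + 1).factorial : ℂ) * ((j + 1).factorial : ℂ)) * L.laurentCoeff (i + 1 + j) * z ^ (i + 1))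
      (iteratedDeriv j (L.weierstrassPExcept 0) (-z) / ((j + 1).factorial : ℂ) -
        L.laurentCoeff j / ((j : ℂ) + 1)) := by
  have h := Complex.hasSum_taylorSeries_on_ball (f := iteratedDeriv j (L.weierstrassPExcept 0))
    (r := L.minPeriod) (c := 0) (z := -z) ?_ ?_
  · have h2 := ((hasSum_nat_add_iff' 1).mpr h).div_const ((j + 1).factorial : ℂ)
    have hj : ((j : ℂ) + 1) ≠ 0 := by exact_mod_cast j.succ_ne_zero
    have hf : ∀ n : ℕ, (n.factorial : ℂ) ≠ 0 := fun n =>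
      Nat.cast_ne_zero.mpr (Nat.factorial_ne_zero n)
    have e1 : (fun i : ℕ => (-1) ^ (i + 1) * ((i + 1 + j).factorial : ℂ) /
        (((i + 1).factorial : ℂ) * ((j + 1).factorial : ℂ)) * L.laurentCoeff (i + 1 + j) *
          z ^ (i + 1)) = fun i => (((i + 1).factorial : ℂ)⁻¹ • (-z - 0) ^ (i + 1) •
        iteratedDeriv (i + 1) (iteratedDeriv j (L.weierstrassPExcept 0)) 0) /
          ((j + 1).factorial : ℂ) := by
      funext i
      have e : iteratedDeriv (i + 1) (iteratedDeriv j (L.weierstrassPExcept 0)) 0 =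
          iteratedDeriv (i + 1 + j) (L.weierstrassPExcept 0) 0 := by
        simp only [iteratedDeriv_eq_iterate, ← Function.iterate_add_apply]
      rw [e, laurentCoeff, sub_zero, neg_pow z, smul_eq_mul, smul_eq_mul]
      have h1 := hf (i + 1)
      have h2 := hf (j + 1)
      have h3 := hf (i + 1 + j)
      field_simp
    have e2 : L.laurentCoeff j / ((j : ℂ) + 1) =
        iteratedDeriv j (L.weierstrassPExcept 0) 0 / ((j + 1).factorial : ℂ) := by
      have h1 := hf j
      rw [laurentCoeff, Nat.factorial_succ]
      push_cast
      field_simp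
    rw [e1, e2, ← sub_div]
    simpa using h2
  · exact L.differentiableOn_iteratedDeriv_weierstrassPExcept j
  · simpa using hz

theorem omega_eq {z : ℂ} (hz : ‖z‖ < L.minPeriod) (j : ℕ) :
    L.omega j z = iteratedDeriv j (L.weierstrassPExcept 0) (-z) / ((j + 1).factorial : ℂ) -
        L.laurentCoeff j / ((j : ℂ) + 1) :=
  (L.hasSum_omega hz j).tsum_eq

theorem omega_zero (j : ℕ) : L.omega j 0 = 0 := by
  simp [omega]

theorem differentiableOn_omega (j : ℕ) :
    DifferentiableOn ℂ (L.omega j) (Metric.ball 0 L.minPeriod) := by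
  have h : DifferentiableOn ℂ (fun z => iteratedDeriv j (L.weierstrassPExcept 0) (-z))
      (Metric.ball 0 L.minPeriod) :=
    (L.differentiableOn_iteratedDeriv_weierstrassPExcept j).comp (differentiableOn_neg _)
      fun z hz => by simpa using hz
  refine ((h.div_const ((j + 1).factorial : ℂ)).sub_const (L.laurentCoeff j / ((j : ℂ) + 1))).congr
    fun z hz => L.omega_eq (by simpa using hz) j

theorem analyticAt_omega (j : ℕ) {z : ℂ} (hz : ‖z‖ < L.minPeriod) : AnalyticAt ℂ (L.omega j) z :=
  (L.differentiableOn_omega j).analyticAt (Metric.isOpen_ball.mem_nhds (by simpa using hz))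

theorem iteratedDeriv_inv_sq (j : ℕ) {z : ℂ} (hz : z ≠ 0) :
    iteratedDeriv j (fun u : ℂ => u ^ (-2 : ℤ)) (-z) = ((j + 1).factorial : ℂ) / z ^ (j + 2) := by
  induction j generalizing z with
  | zero => simp [zpow_neg]
  | succ j ih =>
    have h : iteratedDeriv j (fun u : ℂ => u ^ (-2 : ℤ)) =ᶠ[𝓝 (-z)]
        fun u => ((j + 1).factorial : ℂ) * (-u) ^ (-(j + 2 : ℕ) : ℤ) := by
      filter_upwards [isOpen_ne.mem_nhds (neg_ne_zero.mpr hz)] with u hu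
      have := ih (neg_ne_zero.mpr hu)
      rw [neg_neg] at this
      rw [this, zpow_neg, zpow_natCast, div_eq_mul_inv]
    have h2 : HasDerivAt (fun u : ℂ => (-u) ^ (-(j + 2 : ℕ) : ℤ))
        (((-(j + 2 : ℕ) : ℤ) : ℂ) * z ^ ((-(j + 2 : ℕ) : ℤ) - 1) * -1) (-z) := by
      have h3 := hasDerivAt_zpow (-(j + 2 : ℕ) : ℤ) (- -z) (Or.inl (by simpa using hz))
      have := h3.comp (-z) (hasDerivAt_neg (-z))
      rwa [neg_neg] at this
    rw [iteratedDeriv_succ, h.deriv_eq, (h2.const_mul _).deriv]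
    have e : z ^ ((-(j + 2 : ℕ) : ℤ) - 1) = (z ^ (j + 1 + 2))⁻¹ := by
      rw [← zpow_natCast, ← zpow_neg]
      congr 1
    rw [e, Nat.factorial_succ (j + 1)]
    push_cast
    field_simp
    ring

/-- The polar part u⁻² of ℘ contributes exactly z^{-(j+2)} = λ^{j+2}, the coefficient of t_{j+2} in
ξ; the regular part is ω_{j+2}. -/
theorem timeCoeff_neg (j : ℕ) {z : ℂ} (hz0 : z ≠ 0) (hz : ‖z‖ < L.minPeriod) :
    L.timeCoeff (-z) j = (z ^ (j + 2))⁻¹ + L.omega j z := by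
  have h : L.weierstrassP = fun u => L.weierstrassPExcept 0 u + u ^ (-2 : ℤ) := by
    funext u
    have := L.weierstrassPExcept_add 0 u
    simp only [Submodule.coe_zero, sub_zero] at this
    rw [← this]
    simp [zpow_neg]
  have h1 : ContDiffAt ℂ j (L.weierstrassPExcept 0) (-z) :=
    (L.analyticAt_weierstrassPExcept_zero (L.notMem_of_norm_lt (by simpa using hz))).contDiffAt
  have h2 : ContDiffAt ℂ j (fun u : ℂ => u ^ (-2 : ℤ)) (-z) :=
    (analyticAt_id.zpow (neg_ne_zero.mpr hz0)).contDiffAt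
  rw [timeCoeff, L.omega_eq hz, h, iteratedDeriv_fun_add h1 h2, iteratedDeriv_inv_sq j hz0]
  have hf : ((j + 1).factorial : ℂ) ≠ 0 := Nat.cast_ne_zero.mpr (Nat.factorial_ne_zero _)
  field_simp
  ring

end PeriodPair
end

noncomputable section

open Filter Topology Finset TopologicalSpace

namespace PeriodPair

variable (L : PeriodPair)

/-! ### The auxiliary linear problem for the Lamé function -/

theorem eventually_notMem_lattice (z : ℂ) : ∀ᶠ u in 𝓝[≠] z, u ∉ L.lattice := by
  filter_upwards [nhdsWithin_le_nhds (L.compl_lattice_sdiff_singleton_mem_nhds z),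
    self_mem_nhdsWithin] with u hu hne h
  exact hu ⟨h, hne⟩

theorem timeCoeff_add {w : ℂ} (hw : w ∈ L.lattice) (k : ℂ) (j : ℕ) :
    L.timeCoeff (k + w) j = L.timeCoeff k j := by
  have h : (fun z => L.weierstrassP (z + w)) = L.weierstrassP :=
    funext fun z => L.weierstrassP_add_coe z ⟨w, hw⟩
  have h2 := congrFun (iteratedDeriv_comp_add_const j L.weierstrassP w) k
  rw [h] at h2
  rw [timeCoeff, timeCoeff, h2]

theorem analyticAt_timeCoeff {k : ℂ} (hk : k ∉ L.lattice) (j : ℕ) :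
    AnalyticAt ℂ (fun k => L.timeCoeff k j) k := by
  have h : AnalyticAt ℂ L.weierstrassP k :=
    L.differentiableOn_weierstrassP.analyticAt (L.isOpen_compl_lattice.mem_nhds hk)
  exact (analyticAt_iteratedDeriv h j).div_const.sub analyticAt_const

/-- The jump of ζ(k) in the exponent cancels the part of the multiplier of σ that depends on y. The
remaining factor is independent of y and so passes through all y-derivatives. -/
theorem exists_lamePhi_add {w : ℂ} (hw : w ∈ L.lattice) {k : ℂ} (hk : k ∉ L.lattice) :
    ∃ c ≠ 0, ∀ y, L.lamePhi y (k + w) = c * L.lamePhi y k := by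
  obtain ⟨η, c, hc, hζ, hσ⟩ := L.exists_quasiPeriod hw
  refine ⟨c * Complex.exp (η * k), mul_ne_zero hc (Complex.exp_ne_zero _), fun y => ?_⟩
  have h : Complex.exp (η * (y + k)) * Complex.exp (-(L.zeta k + η) * y) =
      Complex.exp (η * k) * Complex.exp (-L.zeta k * y) := by
    rw [← Complex.exp_add, ← Complex.exp_add]
    congr 1
    ring
  rw [lamePhi, lamePhi, ← add_assoc, hσ, hζ k hk]
  linear_combination (c * L.sigma (y + k) / L.sigma y) * h

/-- `(∑_{i ≤ j+2} bᵢ ∂ⁱ - (℘⁽ʲ⁾(k)/(j+1)! - aⱼ/(j+1))) Φ(x; k)`. -/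
def residual (b : ℕ → ℂ → ℂ) (j : ℕ) (x k : ℂ) : ℂ :=
  (∑ i ∈ range (j + 2 + 1), b i x * iteratedDeriv i (fun y => L.lamePhi y k) x) -
    L.timeCoeff k j * L.lamePhi x k

variable {L} {b : ℕ → ℂ → ℂ} {j : ℕ} {x : ℂ}

theorem analyticAt_lamePhi {k : ℂ} (hx : x ∉ L.lattice) (hk : k ∉ L.lattice) :
    AnalyticAt ℂ (L.lamePhi x) k := (L.jointAnalyticAt_lamePhi hx hk).analyticAt_right

theorem analyticAt_residual {k : ℂ} (hx : x ∉ L.lattice) (hk : k ∉ L.lattice) :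
    AnalyticAt ℂ (L.residual b j x) k := by
  refine (Finset.analyticAt_fun_sum _ fun i _ => analyticAt_const.mul ?_).sub
    ((L.analyticAt_timeCoeff hk j).mul (analyticAt_lamePhi hx hk))
  simp only [iteratedDeriv_eq_dX]
  exact ((L.jointAnalyticAt_lamePhi hx hk).dX_iterate i).analyticAt_right

theorem residual_div_add {w : ℂ} (hw : w ∈ L.lattice) {k : ℂ} (hk : k ∉ L.lattice) :
    L.residual b j x (k + w) / L.lamePhi x (k + w) = L.residual b j x k / L.lamePhi x k := by
  obtain ⟨c, hc, h⟩ := L.exists_lamePhi_add hw hk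
  have h1 : L.residual b j x (k + w) = c * L.residual b j x k := by
    rw [residual, residual, mul_sub, mul_sum, h, L.timeCoeff_add hw]
    simp only [h, iteratedDeriv_const_mul_field]
    congr 1
    · exact sum_congr rfl fun i _ => by ring
    · ring
  rw [h1, h, mul_div_mul_left _ _ hc]

/-- The bridge between function and operator, crossed in both directions: the formal vanishing of
the defect to order n+1 at z = 0 bounds the residual near k = 0, and the vanishing of the residual
for all k later kills the defect. -/
theorem pow_mul_residual_neg (hx : x ∉ L.lattice) {z : ℂ} (hz0 : z ≠ 0) (hz : ‖z‖ < L.minPeriod) :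
    z ^ (j + 2) * L.residual b j x (-z) =
      Complex.exp (x / z) * defect b L.vHat0 (L.omega j) (j + 2) x z := by
  have hzL : z ∉ L.lattice := fun h => L.notMem_of_norm_lt hz ⟨h, hz0⟩
  have h1 : ∀ i ∈ range (j + 2 + 1), z ^ (j + 2) * (b i x *
      iteratedDeriv i (fun y => L.lamePhi y (-z)) x) = Complex.exp (x / z) *
        (b i x * (z ^ (j + 2 - i) * (stepX^[i] L.vHat0) x z)) := by
    intro i hi
    have hi : i ≤ j + 2 := Nat.lt_succ_iff.mp (mem_range.mp hi)
    have h2 := L.pow_mul_iteratedDeriv_lamePhi hx hz0 hzL i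
    have h3 : z ^ (j + 2) = z ^ (j + 2 - i) * z ^ i := by rw [← pow_add, Nat.sub_add_cancel hi]
    rw [h3]
    linear_combination (z ^ (j + 2 - i) * b i x) * h2
  rw [residual, defect, mul_sub, mul_sum, mul_add, mul_sum, sum_congr rfl h1, lamePhi_neg,
    L.timeCoeff_neg j hz0 hz]
  field_simp
  ring

theorem lamePhi_ne_zero {k : ℂ} (hx : x ∉ L.lattice) (hk : k + x ∉ L.lattice) :
    L.lamePhi x k ≠ 0 :=
  mul_ne_zero (div_ne_zero (L.sigma_ne_zero (by rwa [add_comm])) (L.sigma_ne_zero hx))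
    (Complex.exp_ne_zero _)

theorem eventually_lamePhi_ne_zero (hx : x ∉ L.lattice) (z : ℂ) :
    ∀ᶠ k in 𝓝[≠] z, L.lamePhi x k ≠ 0 := by
  filter_upwards [(map_add_nhdsNE z x).eventually (L.eventually_notMem_lattice (z + x))] with k hk
  exact lamePhi_ne_zero hx hk

theorem analyticAt_defect {q : ℂ → ℂ} {F : ℂ → ℂ → ℂ} {n : ℕ} {z : ℂ} (hF : JointAnalyticAt F x z)
    (hq : AnalyticAt ℂ q z) : AnalyticAt ℂ (defect b F q n x) z := by
  have h := hF.analyticAt_right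
  refine (Finset.analyticAt_fun_sum _ fun i _ => ?_).add (by fun_prop)
  have := (hF.stepX_iterate i).analyticAt_right
  fun_prop

/-- In the quotient the essential singularity e^{x/z} cancels, leaving z⁻ⁿ times the defect over v̂₀
with n = j + 2. Vanishing of the defect to order n is enough for regularity; the extra order makes
the value at 0 equal to 0. -/
theorem exists_residual_div_eq (hx : x ∉ L.lattice)
    (h : ∀ m < j + 2 + 1, taylorCoeff m (defect b L.vHat0 (L.omega j) (j + 2) x) = 0) :
    ∃ g, AnalyticAt ℂ g 0 ∧ g 0 = 0 ∧
      (fun k => L.residual b j x k / L.lamePhi x k) =ᶠ[𝓝[≠] 0] g := by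
  have hv : AnalyticAt ℂ (L.vHat0 x) 0 :=
    (L.jointAnalyticAt_vHat0 hx fun h => h.2 rfl).analyticAt_right
  have hv0 : L.vHat0 x 0 = 1 := L.vHat0_zero hx
  obtain ⟨g, hg, hgE⟩ := exists_eq_pow_mul_of_taylorCoeff_eq_zero
    (analyticAt_defect (L.jointAnalyticAt_vHat0 hx fun h => h.2 rfl)
      (L.analyticAt_omega j (by simpa using L.minPeriod_pos))) h
  have hG : AnalyticAt ℂ (fun z => z * g z / L.vHat0 x z) 0 :=
    (analyticAt_id.mul hg).div hv (by simp [hv0])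
  refine ⟨fun k => (-k) * g (-k) / L.vHat0 x (-k), ?_, by simp, ?_⟩
  · exact AnalyticAt.comp_of_eq (g := fun z => z * g z / L.vHat0 x z) (f := fun k => -k) hG
      (by fun_prop) (by simp)
  have h1 : ∀ᶠ z in 𝓝[≠] (0 : ℂ), L.residual b j x (-z) / L.lamePhi x (-z) =
      z * g z / L.vHat0 x z := by
    filter_upwards [nhdsWithin_le_nhds hgE, self_mem_nhdsWithin, nhdsWithin_le_nhds
      (hv.continuousAt.eventually_ne (by rw [hv0]; exact one_ne_zero)),
      nhdsWithin_le_nhds (Metric.ball_mem_nhds (0 : ℂ) L.minPeriod_pos)] with z hz hz0 hvz hzR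
    have h2 := pow_mul_residual_neg (b := b) (j := j) hx hz0 (by simpa using hzR)
    have hz0 : z ≠ 0 := hz0
    rw [hz] at h2
    have h3 : z ^ (j + 2) ≠ 0 := pow_ne_zero _ hz0
    rw [lamePhi_neg, div_eq_div_iff (mul_ne_zero hvz (Complex.exp_ne_zero _)) hvz]
    apply mul_left_cancel₀ h3
    rw [← mul_assoc, h2]
    ring
  have h2 := map_neg_nhdsNE 0
  rw [neg_zero] at h2
  filter_upwards [h2.eventually h1] with k hk
  rw [neg_neg] at hk
  exact hk

theorem residual_eq_zero (hx : x ∉ L.lattice)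
    (h : ∀ m < j + 2 + 1, taylorCoeff m (defect b L.vHat0 (L.omega j) (j + 2) x) = 0)
    {k : ℂ} (hk : k ∉ L.lattice) : L.residual b j x k = 0 := by
  set H : ℂ → ℂ := fun k => L.residual b j x k / L.lamePhi x k
  obtain ⟨g, hg, hg0, hHg⟩ := exists_residual_div_eq hx h
  have hper : L.IsAlmostPeriodic H := fun w hw z => by
    filter_upwards [L.eventually_notMem_lattice z] with u hu
    exact residual_div_add hw hu
  have hm0 : MeromorphicAt H 0 := hg.meromorphicAt.congr hHg.symm
  have ho0 : 0 ≤ meromorphicOrderAt H 0 := by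
    rw [meromorphicOrderAt_congr hHg]
    exact hg.meromorphicOrderAt_nonneg
  have hmer : Meromorphic H := fun z => by
    by_cases hz : z ∈ L.lattice
    · have h1 : MeromorphicAt (fun u => H (u + z)) 0 := hm0.congr (hper z hz 0).symm
      have h2 := MeromorphicAt.comp_analyticAt (f := fun u => H (u + z)) (g := fun u => u - z)
        (x := z) (by simpa using h1) (by fun_prop)
      simpa [Function.comp_def] using h2
    · exact (analyticAt_residual hx hz).meromorphicAt.div (analyticAt_lamePhi hx hz).meromorphicAt
  have hnx : -x ∉ L.lattice := by simpa using hx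
  obtain ⟨c, hc⟩ := hper.exists_eq_const_of_simple_pole hmer (-x) (fun z hz => by
      by_cases hzL : z ∈ L.lattice
      · have := hper.order_add hzL 0
        rw [zero_add] at this
        rwa [this]
      · refine AnalyticAt.meromorphicOrderAt_nonneg ((analyticAt_residual hx hzL).div
          (analyticAt_lamePhi hx hzL) (lamePhi_ne_zero hx (by simpa using hz))))
    (by
      -- Near k = -x the zero of Φ comes from σ(x+k) = (x+k) · `sigmaProd`(x+k), whose second factor
      -- does not vanish at 0; the quotient thus has at most a simple pole.
      have hu : AnalyticAt ℂ (fun k => L.residual b j x k /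
          (L.sigmaProd (x + k) / L.sigma x * Complex.exp (-L.zeta k * x))) (-x) := by
        have h1 : AnalyticAt ℂ (fun k => L.sigmaProd (x + k)) (-x) :=
          AnalyticAt.comp_of_eq (L.differentiable_sigmaProd.analyticAt 0) (by fun_prop) (by simp)
        have h2 := L.analyticAt_zeta hnx
        refine (analyticAt_residual hx hnx).div (by fun_prop) ?_
        rw [add_neg_cancel]
        exact mul_ne_zero (div_ne_zero L.sigmaProd_zero_ne_zero (L.sigma_ne_zero hx))
          (Complex.exp_ne_zero _)
      have h3 : H = (fun u : ℂ => u - -x)⁻¹ * fun k => L.residual b j x k /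
          (L.sigmaProd (x + k) / L.sigma x * Complex.exp (-L.zeta k * x)) := by
        funext k
        simp only [H, Pi.mul_apply, Pi.inv_apply, sub_neg_eq_add, lamePhi,
          sigma_eq L (x + k)]
        rw [div_eq_mul_inv, div_eq_mul_inv (L.residual b j x k), mul_left_comm, ← mul_inv]
        congr 2
        ring
      rw [h3, meromorphicOrderAt_mul (MeromorphicAt.inv (by fun_prop)) hu.meromorphicAt,
        meromorphicOrderAt_inv, meromorphicOrderAt_id_sub_const]
      exact le_add_of_nonneg_right hu.meromorphicOrderAt_nonneg)
  have hc0 : c = 0 := by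
    have h1 : Tendsto H (𝓝[≠] 0) (𝓝 0) := by
      have := hg.continuousAt.tendsto.mono_left (nhdsWithin_le_nhds (s := {0}ᶜ))
      rw [hg0] at this
      exact this.congr' hHg.symm
    exact tendsto_nhds_unique (tendsto_const_nhds.congr' (hc 0).symm) h1
  -- The quotient is zero only off the zeros of Φ; these are isolated, and continuity of the
  -- residual covers them.
  have h0 : L.residual b j x =ᶠ[𝓝[≠] k] fun _ => 0 := by
    filter_upwards [hc k, eventually_lamePhi_ne_zero hx k] with u hu hne
    rw [hc0] at hu
    exact (div_eq_zero_iff.mp hu).resolve_right hne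
  exact tendsto_nhds_unique ((analyticAt_residual hx hk).continuousAt.tendsto.mono_left
    nhdsWithin_le_nhds) (tendsto_const_nhds.congr' h0.symm)

end PeriodPair
end

/-! ### The linear problem for V₀ -/

noncomputable section

open Filter Topology Finset TopologicalSpace
open scoped PseudoDiffOp

namespace PeriodPair

variable (L : PeriodPair)

theorem isMonicOrderZero_opV0 : L.opV0.IsMonicOrderZero := PseudoDiffOp.isMonicOrderZero_monic _

theorem opL0_coeff_eq_zero (n : ℤ) (hn : 1 < n) : L.opL0.coeff n = 0 :=
  L.isMonicOrderZero_opV0.isLaxForm.2.2 n hn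

/-- The operator `ω_{j+2}(∂⁻¹)`. -/
def opOmega (j : ℕ) : PseudoDiffOp (HolFun L.domain) := opSeries L.domain fun _ z => L.omega j z

theorem analyticAt_omega_zero (j : ℕ) : AnalyticAt ℂ (L.omega j) 0 :=
  L.analyticAt_omega j (by simpa using L.minPeriod_pos)

theorem opOmega_coeff_eq_zero (j : ℕ) (m : ℤ) (hm : -1 < m) : (L.opOmega j).coeff m = 0 := by
  rcases lt_or_ge 0 m with h | h
  · exact opSeries_coeff_pos _ m h
  · obtain rfl : m = -(0 : ℕ) := by simp; omega
    refine HolFun.ext fun x => ?_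
    rw [opOmega, opSeries_coeff_apply (JointAnalyticOn.of_right (L.analyticAt_omega_zero j)),
      taylorCoeff_zero, omega_zero]
    rfl

theorem opL0_pow_mul_opV0 (n : ℕ) : L.opL0 ^ n * L.opV0 = L.opV0 * PseudoDiffOp.D n := by
  rw [opL0, L.isMonicOrderZero_opV0.isInverse_inv.conj_pow, PseudoDiffOp.D_one_pow]

/-- The coefficients of `(L₀ⁿ)_{≥ 0}`, extended by zero. -/
def laxCoeff (n i : ℕ) : ℂ → ℂ := HolFun.ext0 ((L.opL0 ^ n).coeff i).1

theorem nonneg_mul_opV0_sub (j : ℕ) :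
    (L.opL0 ^ (j + 2)).nonneg * L.opV0 - L.opV0 * (PseudoDiffOp.D ((j + 2 : ℕ) : ℤ) + L.opOmega j) =
      opSeries L.domain (defect (L.laxCoeff (j + 2)) L.vHat0 (L.omega j) (j + 2)) *
        PseudoDiffOp.D ((j + 2 : ℕ) : ℤ) := by
  have h := nonneg_mul_opSeries_sub (PseudoDiffOp.pow_coeff_eq_zero L.opL0_coeff_eq_zero (j + 2))
    L.jointAnalyticOn_vHat0 (L.analyticAt_omega_zero j)
  rw [L.opV0_eq_opSeries]
  exact h

theorem jointAnalyticOn_defect (j : ℕ) :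
    JointAnalyticOn L.domain (defect (L.laxCoeff (j + 2)) L.vHat0 (L.omega j) (j + 2)) :=
  JointAnalyticOn.defect (fun i => (L.opL0 ^ (j + 2)).coeff i) L.jointAnalyticOn_vHat0
    (L.analyticAt_omega_zero j) (j + 2)

/-- A purely formal fact. By L₀ⁿV₀ = V₀∂ⁿ the operator difference is -(L₀ⁿ)_{<0}V₀ - V₀ω_n(∂⁻¹), of
order at most -1. Its coefficient of ∂^{n-m} is the m-th Taylor coefficient of the defect, so all m
≤ n vanish, with n = j + 2. -/
theorem taylorCoeff_defect_eq_zero (j : ℕ) (x : L.domain) (m : ℕ) (hm : m < j + 2 + 1) :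
    taylorCoeff m (defect (L.laxCoeff (j + 2)) L.vHat0 (L.omega j) (j + 2) x) = 0 := by
  have h1 : (L.opL0 ^ (j + 2)).nonneg * L.opV0 -
      L.opV0 * (PseudoDiffOp.D ((j + 2 : ℕ) : ℤ) + L.opOmega j) =
        -((L.opL0 ^ (j + 2)).negPart * L.opV0) - L.opV0 * L.opOmega j := by
    have h2 := L.opL0_pow_mul_opV0 (j + 2)
    have h3 := congrArg (· * L.opV0) (PseudoDiffOp.nonneg_add_negPart (L.opL0 ^ (j + 2)))
    simp only [add_mul] at h3
    rw [mul_add, ← h2, ← h3]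
    abel
  have h4 := congrArg (fun P => P.coeff ((j + 2 : ℕ) - m : ℤ)) (L.nonneg_mul_opV0_sub j)
  simp only [h1, PseudoDiffOp.mul_D_coeff] at h4
  have e : ((j + 2 : ℕ) - m - (j + 2 : ℕ) : ℤ) = -m := by ring
  rw [e] at h4
  rw [← opSeries_coeff_apply (L.jointAnalyticOn_defect j), ← h4, PseudoDiffOp.sub_coeff,
    PseudoDiffOp.neg_coeff, PseudoDiffOp.mul_coeff_eq_zero
      (PseudoDiffOp.negPart_coeff_eq_zero _) L.isMonicOrderZero_opV0.2 (by omega),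
    PseudoDiffOp.mul_coeff_eq_zero L.isMonicOrderZero_opV0.2 (L.opOmega_coeff_eq_zero j)
      (by omega), neg_zero, sub_zero]
  rfl

theorem residual_laxCoeff_eq_zero (j : ℕ) (x : L.domain) {k : ℂ} (hk : k ∉ L.lattice) :
    L.residual (L.laxCoeff (j + 2)) j x k = 0 :=
  residual_eq_zero x.2 (L.taylorCoeff_defect_eq_zero j x) hk

/-- `(L₀ⁿ)_{≥ 0} V₀ = V₀ (∂ⁿ + ω_n(∂⁻¹))`. -/
theorem nonneg_mul_opV0 (j : ℕ) :
    (L.opL0 ^ (j + 2)).nonneg * L.opV0 = L.opV0 * (PseudoDiffOp.D ((j : ℤ) + 2) + L.opOmega j) := by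
  have h := L.nonneg_mul_opV0_sub j
  rw [opSeries_eq_zero (L.jointAnalyticOn_defect j), zero_mul, sub_eq_zero] at h
  · exact_mod_cast h
  intro x hx
  filter_upwards [Metric.ball_mem_nhds (0 : ℂ) L.minPeriod_pos] with z hz
  have hz : ‖z‖ < L.minPeriod := by simpa using hz
  -- At z = 0 the Lamé function is unavailable, but the zeroth Taylor coefficient is already known
  -- to vanish.
  by_cases hz0 : z = 0
  · have := L.taylorCoeff_defect_eq_zero j ⟨x, hx⟩ 0 (by omega)
    rw [taylorCoeff_zero] at this
    rw [hz0]
    exact this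
  · have hzL : -z ∉ L.lattice := fun h => L.notMem_of_norm_lt hz ⟨by simpa using h, hz0⟩
    have := pow_mul_residual_neg (b := L.laxCoeff (j + 2)) (j := j) hx hz0 hz
    rw [L.residual_laxCoeff_eq_zero j ⟨x, hx⟩ hzL, mul_zero] at this
    exact (mul_eq_zero.mp this.symm).resolve_left (Complex.exp_ne_zero _)

/-! ### The eigenfunction `Ψ` -/

theorem applyNonneg_eq_sum {U : Opens ℂ} {P : PseudoDiffOp (HolFun U)} {n : ℕ}
    (hP : ∀ m : ℤ, n < m → P.coeff m = 0) (f : ℂ → ℂ) (x : U) :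
    P.applyNonneg f x = ∑ i ∈ range (n + 1), (P.coeff i).1 x * iteratedDeriv i f x := by
  have h : ∀ i : ℕ, P.nonneg.coeff i = P.coeff i := fun i =>
    if_pos (e := (0 : HolFun U)) (Int.natCast_nonneg i)
  rw [PseudoDiffOp.applyNonneg]
  simp only [h]
  refine finsum_eq_sum_of_support_subset _ fun i hi => ?_
  by_contra hc
  have hi' : (n : ℤ) < i := by
    simp only [coe_range, Set.mem_Iio, not_lt] at hc
    omega
  apply hi
  simp [hP i hi']

theorem applyNonneg_opL0_pow (n : ℕ) (f : ℂ → ℂ) (x : L.domain) :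
    (L.opL0 ^ n).applyNonneg f x =
      ∑ i ∈ range (n + 1), L.laxCoeff n i x * iteratedDeriv i f x := by
  rw [applyNonneg_eq_sum (PseudoDiffOp.pow_coeff_eq_zero L.opL0_coeff_eq_zero n)]
  refine sum_congr rfl fun i _ => ?_
  rw [laxCoeff, HolFun.ext0_coe]

theorem applyNonneg_opL0_one (f : ℂ → ℂ) (x : L.domain) :
    (L.opL0 ^ 1).applyNonneg f x = deriv f x := by
  have h1 := L.isMonicOrderZero_opV0.isLaxForm.1
  have h0 := L.isMonicOrderZero_opV0.isLaxForm.2.1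
  rw [applyNonneg_eq_sum (PseudoDiffOp.pow_coeff_eq_zero L.opL0_coeff_eq_zero 1), pow_one,
    sum_range_succ, sum_range_one, opL0, Nat.cast_zero, Nat.cast_one, h0, h1]
  simp

theorem applyNonneg_wavePsi (j : ℕ) (x : L.domain) (t : ℕ → ℂ) {k : ℂ} (hk : k ∉ L.lattice) :
    (L.opL0 ^ (j + 2)).applyNonneg (fun y => L.wavePsi y t k) x =
      L.timeCoeff k j * L.wavePsi x t k := by
  have h := L.residual_laxCoeff_eq_zero j x hk
  rw [residual, sub_eq_zero] at h
  rw [applyNonneg_opL0_pow]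
  simp only [wavePsi, mul_comm (L.lamePhi _ _), iteratedDeriv_const_mul_field]
  rw [mul_left_comm, ← h, mul_sum]
  exact sum_congr rfl fun i _ => by ring

theorem differentiableOn_wavePsi (t : ℕ → ℂ) {k : ℂ} (hk : k ∉ L.lattice) :
    DifferentiableOn ℂ (fun y => L.wavePsi y t k) L.domain := fun _ hx =>
  ((L.jointAnalyticAt_lamePhi hx hk).analyticAt_left.differentiableAt.mul_const
    _).differentiableWithinAt

theorem tsum_mul_add_single {a t : ℕ → ℂ} (h : Summable fun i => a i * t i) (j : ℕ) (s : ℂ) :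
    ∑' i, a i * (t + Pi.single j s : ℕ → ℂ) i = (∑' i, a i * t i) + a j * s := by
  have h1 : HasSum (fun i => a i * (Pi.single j s : ℕ → ℂ) i) (a j * s) := by
    have := hasSum_single (f := fun i => a i * (Pi.single j s : ℕ → ℂ) i) j fun i hi => by
      simp [Pi.single_eq_of_ne hi]
    simpa using this
  rw [← (h.hasSum.add h1).tsum_eq]
  exact tsum_congr fun i => by simp [mul_add]

theorem hasDerivAt_wavePsi_time (j : ℕ) (x : ℂ) {t : ℕ → ℂ} {k : ℂ}
    (ht : Summable fun j => L.timeCoeff k j * t j) :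
    HasDerivAt (fun s : ℂ => L.wavePsi x (t + Pi.single j s) k)
      (L.timeCoeff k j * L.wavePsi x t k) 0 := by
  simp only [wavePsi, tsum_mul_add_single ht]
  have h : HasDerivAt (fun s : ℂ => (∑' i, L.timeCoeff k i * t i) + L.timeCoeff k j * s)
      (L.timeCoeff k j) 0 := by
    simpa using ((hasDerivAt_id (0 : ℂ)).const_mul (L.timeCoeff k j)).const_add
      (∑' i, L.timeCoeff k i * t i)
  refine (h.cexp.const_mul (L.lamePhi x k)).congr_deriv ?_
  rw [mul_zero, add_zero]
  ring

end PeriodPair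
end

noncomputable section

open Filter Topology Finset TopologicalSpace
open scoped PseudoDiffOp

/-! ### Cauchy estimates and convergence -/

/-- Cauchy's estimate on discs of a common radius δ around the points of K, with q = 1/δ. The
factorial is later absorbed by the (j+1)! in the coefficients of the times. -/
theorem exists_norm_iteratedDeriv_le {f : ℂ → ℂ} {U K : Set ℂ} (hf : DifferentiableOn ℂ f U)
    (hU : IsOpen U) (hK : IsCompact K) (hKU : K ⊆ U) :
    ∃ M q : ℝ, ∀ z ∈ K, ∀ j : ℕ, ‖iteratedDeriv j f z‖ ≤ j.factorial * (M * q ^ j) := by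
  obtain ⟨δ, hδ, hδU⟩ := hK.exists_cthickening_subset_open hU hKU
  obtain ⟨M, hM⟩ := hK.cthickening.exists_bound_of_continuousOn (hf.continuousOn.mono hδU)
  refine ⟨M, δ⁻¹, fun z hz j => ?_⟩
  have hsub := Metric.closedBall_subset_cthickening hz δ
  have h := Complex.norm_iteratedDeriv_le_of_forall_mem_sphere_norm_le j hδ
    (hf.diffContOnCl_ball (hsub.trans hδU)) fun w hw => hM w (hsub (Metric.sphere_subset_closedBall hw))
  rwa [inv_pow, ← div_eq_mul_inv, ← mul_div_assoc]

theorem norm_div_factorial_succ_le {a : ℂ} {j : ℕ} {B : ℝ} (h : ‖a‖ ≤ j.factorial * B) :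
    ‖a / ((j + 1).factorial : ℂ)‖ ≤ B := by
  have hpos : (0 : ℝ) < j.factorial := by exact_mod_cast j.factorial_pos
  have hB : 0 ≤ B := nonneg_of_mul_nonneg_right ((norm_nonneg a).trans h) hpos
  rw [norm_div, Complex.norm_natCast, div_le_iff₀ (by exact_mod_cast (j + 1).factorial_pos), mul_comm]
  refine h.trans (mul_le_mul_of_nonneg_right ?_ hB)
  exact_mod_cast Nat.factorial_le j.le_succ

theorem summable_mul_pow_of_mem_entireTimes {t : ℕ → ℂ} (ht : t ∈ entireTimes) (M q M' q' : ℝ) :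
    Summable fun j => (M * q ^ j + M' * q' ^ j) * ‖t j‖ := by
  refine (((ht q).mul_left M).add ((ht q').mul_left M')).congr fun j => ?_
  ring

namespace PeriodPair

variable (L : PeriodPair)

theorem exists_norm_laurentCoeff_div_le :
    ∃ M q : ℝ, ∀ j : ℕ, ‖L.laurentCoeff j / ((j : ℂ) + 1)‖ ≤ M * q ^ j := by
  obtain ⟨M, q, h⟩ := exists_norm_iteratedDeriv_le (L.differentiableOn_weierstrassPExcept 0)
    L.isOpen_compl_lattice_sdiff (isCompact_singleton (x := (0 : ℂ))) (by simp)
  refine ⟨M, q, fun j => ?_⟩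
  have e : L.laurentCoeff j / ((j : ℂ) + 1) =
      iteratedDeriv j (L.weierstrassPExcept 0) 0 / ((j + 1).factorial : ℂ) := by
    rw [laurentCoeff, Nat.factorial_succ, div_div]
    push_cast
    rw [mul_comm]
  rw [e]
  exact norm_div_factorial_succ_le (h 0 rfl j)

theorem summable_timeCoeff {k : ℂ} (hk : k ∉ L.lattice) {t : ℕ → ℂ} (ht : t ∈ entireTimes) :
    Summable fun j => L.timeCoeff k j * t j := by
  obtain ⟨M, q, h⟩ := exists_norm_iteratedDeriv_le L.differentiableOn_weierstrassP
    L.isOpen_compl_lattice (isCompact_singleton (x := k)) (by simpa using hk)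
  obtain ⟨M', q', h'⟩ := L.exists_norm_laurentCoeff_div_le
  refine Summable.of_norm_bounded (summable_mul_pow_of_mem_entireTimes ht M q M' q') fun j => ?_
  rw [norm_mul]
  exact mul_le_mul_of_nonneg_right ((norm_sub_le _ _).trans
    (add_le_add (norm_div_factorial_succ_le (h k rfl j)) (h' j))) (norm_nonneg _)

theorem exists_norm_omega_le {ρ : ℝ} (hρ : ρ < L.minPeriod) :
    ∃ M q M' q' : ℝ, ∀ z : ℂ, ‖z‖ ≤ ρ → ∀ j : ℕ, ‖L.omega j z‖ ≤ M * q ^ j + M' * q' ^ j := by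
  have hsub : Metric.closedBall (0 : ℂ) ρ ⊆ (L.lattice \ {0} : Set ℂ)ᶜ := fun z hz =>
    L.notMem_of_norm_lt (lt_of_le_of_lt (by simpa using hz) hρ)
  obtain ⟨M, q, h⟩ := exists_norm_iteratedDeriv_le (L.differentiableOn_weierstrassPExcept 0)
    L.isOpen_compl_lattice_sdiff (isCompact_closedBall (0 : ℂ) ρ) hsub
  obtain ⟨M', q', h'⟩ := L.exists_norm_laurentCoeff_div_le
  refine ⟨M, q, M', q', fun z hz j => ?_⟩
  rw [L.omega_eq (hz.trans_lt hρ)]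
  exact (norm_sub_le _ _).trans
    (add_le_add (norm_div_factorial_succ_le (h (-z) (by simpa using hz) j)) (h' j))

theorem summable_omega {t : ℕ → ℂ} (ht : t ∈ entireTimes) {z : ℂ} (hz : ‖z‖ < L.minPeriod) :
    Summable fun j => L.omega j z * t j := by
  obtain ⟨M, q, M', q', h⟩ := L.exists_norm_omega_le hz
  refine Summable.of_norm_bounded (summable_mul_pow_of_mem_entireTimes ht M q M' q') fun j => ?_
  rw [norm_mul]
  exact mul_le_mul_of_nonneg_right (h z le_rfl j) (norm_nonneg _)

/-- The function `z ↦ exp (∑ⱼ ω_{j+2}(1/z) t_{j+2})`. -/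
def timeFactor (t : ℕ → ℂ) (z : ℂ) : ℂ := Complex.exp (∑' j : ℕ, L.omega j z * t j)

theorem analyticAt_tsum_omega {t : ℕ → ℂ} (ht : t ∈ entireTimes) {z : ℂ}
    (hz : ‖z‖ < L.minPeriod) : AnalyticAt ℂ (fun z => ∑' j : ℕ, L.omega j z * t j) z := by
  obtain ⟨ρ, hzρ, hρ⟩ := exists_between hz
  obtain ⟨M, q, M', q', h⟩ := L.exists_norm_omega_le hρ
  have hsub : Metric.ball (0 : ℂ) ρ ⊆ Metric.ball 0 L.minPeriod := Metric.ball_subset_ball hρ.le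
  refine (Complex.differentiableOn_tsum_of_summable_norm (U := Metric.ball (0 : ℂ) ρ)
    (summable_mul_pow_of_mem_entireTimes ht M q M' q')
    (fun j => ((L.differentiableOn_omega j).mono hsub).mul_const _) Metric.isOpen_ball
    fun j w hw => ?_).analyticAt (Metric.isOpen_ball.mem_nhds (by simpa using hzρ))
  rw [norm_mul]
  exact mul_le_mul_of_nonneg_right (h w (by simpa using (Metric.mem_ball.mp hw).le) j) (norm_nonneg _)

theorem analyticAt_timeFactor {t : ℕ → ℂ} (ht : t ∈ entireTimes) {z : ℂ}
    (hz : ‖z‖ < L.minPeriod) : AnalyticAt ℂ (L.timeFactor t) z :=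
  (L.analyticAt_tsum_omega ht hz).cexp

theorem analyticAt_timeFactor_zero {t : ℕ → ℂ} (ht : t ∈ entireTimes) :
    AnalyticAt ℂ (L.timeFactor t) 0 :=
  L.analyticAt_timeFactor ht (by simpa using L.minPeriod_pos)

theorem isMonicOrderZero_opC (t : ℕ → ℂ) : (L.opC t).IsMonicOrderZero :=
  PseudoDiffOp.isMonicOrderZero_monic _

theorem isConst_opC (t : ℕ → ℂ) : (L.opC t).IsConst := by
  intro n
  simp only [opC, PseudoDiffOp.monic]
  split_ifs
  · exact Derivation.map_one_eq_zero _
  · exact HolFun.deriv_algebraMap_eq_zero _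
  · exact map_zero _

theorem opC_eq_opSeries {t : ℕ → ℂ} (ht : t ∈ entireTimes) :
    L.opC t = opSeries L.domain fun _ z => L.timeFactor t z := by
  refine eq_opSeries (JointAnalyticOn.of_right (L.analyticAt_timeFactor_zero ht))
    (L.isMonicOrderZero_opC t).2 fun n x => ?_
  rcases n with _ | n
  · rw [taylorCoeff_zero]
    simp [opC, PseudoDiffOp.monic, timeFactor, omega_zero]
  · have h : (L.opC t).coeff (-(n + 1 : ℕ)) =
        algebraMap ℂ (HolFun L.domain) (L.cCoeff t (n + 1)) := by
      simp only [opC, PseudoDiffOp.monic]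
      rw [if_neg (by omega), if_pos (by omega), neg_neg, Int.toNat_natCast]
    rw [h]
    rfl

theorem opOmega_mul_opC {t : ℕ → ℂ} (ht : t ∈ entireTimes) (j : ℕ) :
    L.opOmega j * L.opC t = opSeries L.domain fun _ z => L.omega j z * L.timeFactor t z := by
  rw [opOmega, L.opC_eq_opSeries ht]
  exact (opSeries_mul_right (JointAnalyticOn.of_right (L.analyticAt_omega_zero j))
    (L.analyticAt_timeFactor_zero ht)).symm

/-- Shifting t_{j+2} by s multiplies the symbol of C by exp(s ω_{j+2}(z)), whose s-derivative at 0
is ω_{j+2}(z). -/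
theorem hasOpTimeDerivAt_opC {t : ℕ → ℂ} (ht : t ∈ entireTimes) (j : ℕ) :
    HasOpTimeDerivAt L.opC (L.opOmega j * L.opC t) j t := by
  intro m x
  have hω := L.analyticAt_omega_zero j
  have hτ := L.analyticAt_timeFactor_zero ht
  rw [L.opOmega_mul_opC ht]
  rcases lt_or_ge 0 m with hm | hm
  · simp only [(L.isMonicOrderZero_opC _).2 m hm, opSeries_coeff_pos _ m hm]
    exact hasDerivAt_const _ _
  obtain ⟨n, rfl⟩ : ∃ n : ℕ, m = -n := ⟨(-m).toNat, by omega⟩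
  have hs := fun s => add_single_mem_entireTimes ht j s
  have h1 : ∀ s : ℂ, ((L.opC (t + Pi.single j s)).coeff (-n)).1 x =
      taylorCoeff n (fun z => L.timeFactor t z * Complex.exp (L.omega j z * s)) := fun s => by
    rw [L.opC_eq_opSeries (hs s), opSeries_coeff_apply
      (JointAnalyticOn.of_right (L.analyticAt_timeFactor_zero (hs s)))]
    refine taylorCoeff_congr ?_ n
    filter_upwards [Metric.ball_mem_nhds (0 : ℂ) L.minPeriod_pos] with z hz
    rw [timeFactor, tsum_mul_add_single (L.summable_omega ht (by simpa using hz)), Complex.exp_add]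
    rfl
  simp only [h1]
  rw [opSeries_coeff_apply (JointAnalyticOn.of_right (hω.fun_mul hτ))]
  -- Here s plays the role of the first variable x, so that differentiation in s commutes with
  -- taking Taylor coefficients in z.
  have hG : JointAnalyticAt (fun s z => L.timeFactor t z * Complex.exp (L.omega j z * s)) 0 0 :=
    (JointAnalyticAt.of_right hτ).mul (AnalyticAt.cexp
      (AnalyticAt.mul (JointAnalyticAt.of_right hω) analyticAt_fst))
  refine (hG.hasDerivAt_taylorCoeff n).congr_deriv (congrArg (taylorCoeff n) (funext fun z => ?_))
  have h2 : HasDerivAt (fun s => L.timeFactor t z * Complex.exp (L.omega j z * s))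
      (L.timeFactor t z * (Complex.exp (L.omega j z * 0) * (L.omega j z * 1))) 0 :=
    (((hasDerivAt_id (0 : ℂ)).const_mul (L.omega j z)).cexp).const_mul _
  rw [dX, h2.deriv]
  simp [mul_comm]

theorem formalPsi_coeff (t : ℕ → ℂ) (n : ℤ) :
    (L.formalPsi t).coeff n = (L.opV0 * L.opC t).coeff n := by
  have h : (L.formalPsi t).toOp = L.opV0 * L.opC t := by
    rw [formalPsi, FormalWave.toOp_smul, FormalWave.toOp_smul, FormalWave.toOp_expXi, mul_one]
  rw [← h]
  rfl

theorem wavePsi_neg (x : ℂ) {t : ℕ → ℂ} (ht : t ∈ entireTimes) {z : ℂ} (hz0 : z ≠ 0)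
    (hz : ‖z‖ < L.minPeriod) :
    L.wavePsi x t (-z) = L.vHat0 x z * L.timeFactor t z * Complex.exp (xiPhase x t z⁻¹) := by
  have h1 : Summable fun j => z⁻¹ ^ (j + 2) * t j := by
    refine Summable.of_norm_bounded ((ht ‖z⁻¹‖).mul_left (‖z⁻¹‖ ^ 2)) fun j => le_of_eq ?_
    rw [norm_mul, norm_pow]
    ring
  have h2 : ∑' j, L.timeCoeff (-z) j * t j =
      (∑' j, z⁻¹ ^ (j + 2) * t j) + ∑' j, L.omega j z * t j := by
    rw [← h1.tsum_add (L.summable_omega ht hz)]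
    refine tsum_congr fun j => ?_
    rw [L.timeCoeff_neg j hz0 hz, inv_pow]
    ring
  rw [wavePsi, h2, lamePhi_neg, timeFactor, xiPhase, Complex.exp_add, Complex.exp_add, div_eq_inv_mul]
  ring

/-- The symbol of V₀C is v̂₀ times the exponential of ∑ ω_{j+2} t_{j+2}, holomorphic in the whole
disc up to the nearest nonzero period, so its Taylor series at z = 0 converges there. The sum over ℤ
is supported on non-positive powers of λ. -/
theorem hasSum_formalPsi {t : ℕ → ℂ} (ht : t ∈ entireTimes) (x : L.domain) {lam : ℂ}
    (hlam : lam ≠ 0) (h : ∀ l ∈ L.lattice, l ≠ 0 → ‖lam⁻¹‖ < ‖l‖) :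
    HasSum (fun n : ℤ => ((L.formalPsi t).coeff n).1 x * lam ^ n *
      Complex.exp (xiPhase x t lam)) (L.wavePsi x t (-lam⁻¹)) := by
  have hz : ‖lam⁻¹‖ < L.minPeriod := L.norm_lt_minPeriod_iff.mpr h
  have hF := L.jointAnalyticOn_vHat0.mul (JointAnalyticOn.of_right (L.analyticAt_timeFactor_zero ht))
  rw [L.wavePsi_neg x ht (inv_ne_zero hlam) hz, inv_inv]
  refine HasSum.mul_right _ ?_
  have hinj : Function.Injective fun n : ℕ => -(n : ℤ) := fun a b hab => by simpa using hab
  rw [← hinj.hasSum_iff]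
  · have hd : DifferentiableOn ℂ (fun z => L.vHat0 x z * L.timeFactor t z)
        (Metric.ball 0 L.minPeriod) := fun z hz => by
      have hz : ‖z‖ < L.minPeriod := by simpa using hz
      exact ((L.jointAnalyticAt_vHat0 x.2 (L.notMem_of_norm_lt hz)).analyticAt_right.mul
        (L.analyticAt_timeFactor ht hz)).differentiableAt.differentiableWithinAt
    have hs := Complex.hasSum_taylorSeries_on_ball hd (z := lam⁻¹) (by simpa using hz)
    refine hs.congr_fun fun n => ?_
    have h2 : ((L.formalPsi t).coeff (-n)).1 x =
        taylorCoeff n (fun z => L.vHat0 x z * L.timeFactor t z) := by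
      rw [formalPsi_coeff, L.opV0_eq_opSeries, L.opC_eq_opSeries ht, ← opSeries_mul_right
        L.jointAnalyticOn_vHat0 (L.analyticAt_timeFactor_zero ht), opSeries_coeff_apply hF]
    rw [Function.comp_apply, h2, taylorCoeff, zpow_neg, zpow_natCast, sub_zero, inv_pow, smul_eq_mul,
      smul_eq_mul]
    ring
  · intro n hn
    have hn : 0 < n := by
      by_contra hc
      exact hn ⟨(-n).toNat, by simp only; omega⟩
    rw [formalPsi_coeff, (L.isMonicOrderZero_opV0.mul (L.isMonicOrderZero_opC t)).2 n hn]
    exact zero_mul _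

end PeriodPair

end

/-! ### The main theorem -/

theorem mainTheorem4 (L : PeriodPair) :
    -- the operators `V₀` and `L₀` are well defined
    (∀ n, DifferentiableOn ℂ (L.v0 n) L.domain) ∧
    PseudoDiffOp.IsInverse L.opV0 L.opV0⁻¹ ∧
    L.opL0.IsLaxForm ∧
    -- `Ψ` is defined for all times for which `ξ` converges
    (∀ k ∉ L.lattice, ∀ t ∈ entireTimes, Summable fun j => L.timeCoeff k j * t j) ∧
    -- `Ψ(x, t; k)` is an eigenfunction: `∂Ψ/∂tₙ = (L₀ⁿ)_{≥ 0} Ψ` for all `n ≥ 1`, `t₁ = x`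
    (∀ k ∉ L.lattice, ∀ t : ℕ → ℂ, (Summable fun j => L.timeCoeff k j * t j) →
      DifferentiableOn ℂ (fun y => L.wavePsi y t k) L.domain ∧
      ∀ x : L.domain,
        HasDerivAt (fun y => L.wavePsi y t k)
          ((L.opL0 ^ 1).applyNonneg (fun y => L.wavePsi y t k) x) x ∧
        ∀ j : ℕ, HasDerivAt (fun s : ℂ => L.wavePsi x (t + Pi.single j s) k)
          ((L.opL0 ^ (j + 2)).applyNonneg (fun y => L.wavePsi y t k) x) 0) ∧
    -- `Ψ(x, t; -1/λ) = V₀ C e^ξ`, the expansion converging whenever `|1/λ|` is smaller than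
    -- the absolute value of every nonzero period
    (∀ t ∈ entireTimes, ∀ x : L.domain, ∀ lam : ℂ, lam ≠ 0 →
      (∀ l ∈ L.lattice, l ≠ 0 → ‖lam⁻¹‖ < ‖l‖) →
      HasSum (fun n : ℤ => ((L.formalPsi t).coeff n).1 x * lam ^ n *
        Complex.exp (xiPhase x t lam)) (L.wavePsi x t (-lam⁻¹))) ∧
    -- it solves the auxiliary linear problem of `L₀` with eigenvalue `λ`
    IsWaveFunction L.opL0 L.formalPsi ∧
    -- `V = V₀ C` is a wave operator for `L₀`
    IsWaveOperator L.opL0 L.formalPsi (fun t => L.opV0 * L.opC t) := by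
  have hΩ : ∀ (j : ℕ) (n : ℤ), 0 < n → (L.opOmega j).coeff n = 0 := fun _ _ hn =>
    opSeries_coeff_pos _ _ hn
  have hdΩ : ∀ j : ℕ, (L.opOmega j).IsConst := fun j => isConst_opSeries (L.analyticAt_omega_zero j)
  refine ⟨fun n => L.jointAnalyticOn_vHat0.differentiableOn_taylorCoeff n,
    L.isMonicOrderZero_opV0.isInverse_inv, L.isMonicOrderZero_opV0.isLaxForm,
    fun k hk t ht => L.summable_timeCoeff hk ht, fun k hk t ht =>
      ⟨L.differentiableOn_wavePsi t hk, fun x => ⟨?_, fun j => ?_⟩⟩,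
    fun t ht x lam hlam h => L.hasSum_formalPsi ht x hlam h,
    PseudoDiffOp.isWaveFunction_dressing L.isMonicOrderZero_opV0 L.isMonicOrderZero_opC
      L.isConst_opC hΩ hdΩ L.nonneg_mul_opV0 fun t ht j => L.hasOpTimeDerivAt_opC ht j,
    PseudoDiffOp.isWaveOperator_dressing L.isMonicOrderZero_opV0 L.isMonicOrderZero_opC
      L.isConst_opC hΩ hdΩ L.nonneg_mul_opV0 fun t ht j => L.hasOpTimeDerivAt_opC ht j⟩
  · rw [L.applyNonneg_opL0_one]
    exact ((L.differentiableOn_wavePsi t hk).differentiableAt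
      (L.domain.isOpen.mem_nhds x.2)).hasDerivAt
  · rw [L.applyNonneg_wavePsi j x t hk]
    exact L.hasDerivAt_wavePsi_time j x ht
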